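/- Let $D\ge 3$. A theory $\mathcal L(g^{ab},R_{abcd})$ is a real-valued scalar function of the inverse metric and of the Riemann tensor (no covariant derivatives of the curvature, no parity-breaking terms), i.e. a smooth function on an open set of pairs $(g^{ab},R_{abcd})$ such that the set and the function are invariant under all linear changes of coordinates $A\in GL(D,\mathbb R)$; for instance, any polynomial in the complete contractions of $R_{abcd}$ with $g^{ab}$, or a series of such terms where it converges to a smooth function. For $k\in\{-1,0,1\}$ and smooth positive functions $a(t),F(t)$ let $$\mathrm ds^2_{a,F}=-F(t)\,\mathrm dt^2+\frac{a^2(t)}{1-kr^2}\,\mathrm dr^2+a^2(t)\,r^2\,\mathrm d\Omega^2_{D-2},\qquad 1-kr^2>0 .$$ The theory is called a Cosmological Gravity if its gravitational field equations (the Euler–Lagrange expressions $\delta(\sqrt{|g|}\,\mathcal L)/\delta g_{ab}$ of the action $\int\sqrt{|g|}\,\mathcal L$ with respect to an arbitrary metric), evaluated on the metrics $\mathrm ds^2_{a,F}$ on which $\mathcal L$ is defined, are for all $k\in\{-1,0,1\}$ of at most second order in time derivatives, i.e. all their components at a point with time $t$ depend on $a$ and $F$ only through the values at $t$ of $a,\dot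 a,\ddot a,F,\dot F,\ddot F$. Let $L_{a,1}$ be the reduced Lagrangian, that is, the value of $\mathcal L(g^{ab},R_{abcd})$ on $\mathrm ds^2_{a,1}$ (i.e. $F=1$), regarded as a function of the independent values of $a>0$, $\dot a$, $\ddot a$ (wherever $\mathcal L$ is defined). Then the theory is a Cosmological Gravity if and only if, for all $k\in\{-1,0,1\}$, its reduced Lagrangian is linear in $\ddot a$: $$\frac{\partial^2 L_{a,1}}{\partial\ddot a^2}=0 .$$ Moreover, the equivalence (second-order field equations on the metrics $\mathrm ds^2_{a,F}$ if and only if $\partial^2L_{a,1}/\partial\ddot a^2=0$) holds for each value $k\in\{-1,0,1\}$ separately. -/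

import Mathlib

open scoped ContDiff

noncomputable section

namespace CosmoGravity

/-! Spacetimes of dimension `D = d + 1`. Coordinates are `x : Fin (d + 1) → ℝ`; the index `0` is the
time coordinate `t`, the indices `i.succ` with `i : Fin d` are spatial. -/

/-- Coordinate space of a chart of a `(d + 1)`-dimensional spacetime. -/
abbrev Chart (d : ℕ) : Type := Fin (d + 1) → ℝ

/-- Arrays with two indices (components of the inverse metric `g^{ab}`). -/
abbrev Tensor2 (d : ℕ) : Type := Fin (d + 1) → Fin (d + 1) → ℝ

/-- Arrays with four indices (components of the curvature `R_{abcd}`). -/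
abbrev Tensor4 (d : ℕ) : Type :=
  Fin (d + 1) → Fin (d + 1) → Fin (d + 1) → Fin (d + 1) → ℝ

/-- A field of metric components `g_{ab}(x)`. -/
abbrev MetricField (d : ℕ) : Type := Chart d → Matrix (Fin (d + 1)) (Fin (d + 1)) ℝ

variable {d : ℕ}

/-! ### Curvature of a metric in a chart -/

/-- The partial derivative `∂_c f` at `x`. -/
def pd (c : Fin (d + 1)) (f : Chart d → ℝ) (x : Chart d) : ℝ :=
  fderiv ℝ f x (Pi.single c 1)

/-- The components `g^{ab}` of the inverse metric at `x`. -/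
def invMetric (g : MetricField d) (x : Chart d) : Tensor2 d :=
  fun a b => (g x)⁻¹ a b

/-- The Christoffel symbol `Γ_{ab}^c = ½ g^{ce} (∂_a g_{be} + ∂_b g_{ae} - ∂_e g_{ab})`. -/
def christoffel (g : MetricField d) (a b c : Fin (d + 1)) (x : Chart d) : ℝ :=
  (1 / 2) * ∑ e, invMetric g x c e *
    (pd a (fun y => g y b e) x + pd b (fun y => g y a e) x - pd e (fun y => g y a b) x)

/-- The curvature tensor
`R_{abc}^e = ∂_b Γ_{ac}^e - ∂_a Γ_{bc}^e + Γ_{ca}^f Γ_{bf}^e - Γ_{cb}^f Γ_{af}^e`. -/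
def riemannUp (g : MetricField d) (a b c e : Fin (d + 1)) (x : Chart d) : ℝ :=
  pd b (christoffel g a c e) x - pd a (christoffel g b c e) x
    + ∑ f, (christoffel g c a f x * christoffel g b f e x
      - christoffel g c b f x * christoffel g a f e x)

/-- The curvature tensor with lowered indices, `R_{abcd} = g_{de} R_{abc}^e`. -/
def riemann (g : MetricField d) (x : Chart d) : Tensor4 d :=
  fun a b c f => ∑ e, g x f e * riemannUp g a b c e x

/-! ### Theories `𝓛(g^{ab}, R_{abcd})` -/

/-- Transformation of `g^{ab}` under a linear change of coordinates. -/
def transformInv (A : GL (Fin (d + 1)) ℝ) (h : Tensor2 d) : Tensor2 d :=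
  fun a b => ∑ a', ∑ b', (A : Matrix _ _ ℝ) a a' * (A : Matrix _ _ ℝ) b b' * h a' b'

/-- Transformation of `R_{abcd}` under a linear change of coordinates. -/
def transformCurv (A : GL (Fin (d + 1)) ℝ) (R : Tensor4 d) : Tensor4 d :=
  fun a b c e => ∑ a', ∑ b', ∑ c', ∑ e',
    ((A⁻¹ : GL (Fin (d + 1)) ℝ) : Matrix _ _ ℝ) a' a
      * ((A⁻¹ : GL (Fin (d + 1)) ℝ) : Matrix _ _ ℝ) b' b
      * ((A⁻¹ : GL (Fin (d + 1)) ℝ) : Matrix _ _ ℝ) c' c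
      * ((A⁻¹ : GL (Fin (d + 1)) ℝ) : Matrix _ _ ℝ) e' e * R a' b' c' e'

/-- A diffeomorphism-invariant theory `𝓛(g^{ab}, R_{abcd})` in dimension `d + 1`: a smooth scalar
function of the inverse metric and the curvature, without covariant derivatives of the curvature,
which does not depend on the coordinates, that is, which is unchanged when `g^{ab}` and `R_{abcd}`
are transformed by the (arbitrary) Jacobian of a change of coordinates; orientation-reversing
changes are included, so there are no parity-breaking terms. All polynomials in
complete contractions of the curvature with the inverse metric are of this kind. An infinite series
of such terms need not converge for all curvatures, hence the open coordinate-independent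
`domain`. -/
structure GravityTheory (d : ℕ) where
  /-- The pairs `(g^{ab}, R_{abcd})` at which the Lagrangian is defined. -/
  domain : Set (Tensor2 d × Tensor4 d)
  /-- The Lagrangian as a function of `(g^{ab}, R_{abcd})`. -/
  lagrangian : Tensor2 d × Tensor4 d → ℝ
  isOpen_domain : IsOpen domain
  contDiffOn_lagrangian : ContDiffOn ℝ ∞ lagrangian domain
  transform_mem_domain : ∀ (A : GL (Fin (d + 1)) ℝ) (h : Tensor2 d) (R : Tensor4 d),
    (h, R) ∈ domain → (transformInv A h, transformCurv A R) ∈ domain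
  lagrangian_transform : ∀ (A : GL (Fin (d + 1)) ℝ) (h : Tensor2 d) (R : Tensor4 d),
    (h, R) ∈ domain → lagrangian (transformInv A h, transformCurv A R) = lagrangian (h, R)

namespace GravityTheory

variable (L : GravityTheory d)

/-- The Lagrangian of the theory is defined for the metric `g` at the point `x`. -/
def DefinedAt (g : MetricField d) (x : Chart d) : Prop :=
  (invMetric g x, riemann g x) ∈ L.domain

/-- The value `𝓛(g^{ab}, R_{abcd})` at `x`, for `R_{abcd}` the curvature of the metric `g`. -/
def eval (g : MetricField d) (x : Chart d) : ℝ :=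
  L.lagrangian (invMetric g x, riemann g x)

/-- The Lagrangian density `√|g| 𝓛(g^{ab}, R_{abcd})`. -/
def density (g : MetricField d) (x : Chart d) : ℝ :=
  Real.sqrt |(g x).det| * L.eval g x

/-- The first variation `δ_h(√|g| 𝓛)` of the Lagrangian density at `x` in the direction of the
variation `δg_{ab} = h_{ab}` of the metric. It has the form
`A^{ab} h_{ab} + B^{ab,c} ∂_c h_{ab} + C^{ab,ce} ∂_c ∂_e h_{ab}`. -/
def firstVariation (g h : MetricField d) (x : Chart d) : ℝ :=
  deriv (fun s : ℝ => L.density (fun y => g y + s • h y) x) 0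

end GravityTheory

/-- The symmetric matrix unit `½ (e_a ⊗ e_b + e_b ⊗ e_a)`. -/
def symUnit (a b : Fin (d + 1)) : Matrix (Fin (d + 1)) (Fin (d + 1)) ℝ :=
  (1 / 2 : ℝ) • (Matrix.single a b 1 + Matrix.single b a 1)

namespace GravityTheory

variable (L : GravityTheory d)

/-- The coefficient `A^{ab}` of the first variation. -/
def coeffA (g : MetricField d) (a b : Fin (d + 1)) (x : Chart d) : ℝ :=
  L.firstVariation g (fun _ => symUnit a b) x

/-- The coefficient `B^{ab,c}` of the first variation, read off at `x` from the variation
`(y^c - x^c)` times a matrix unit. -/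
def coeffB (g : MetricField d) (a b c : Fin (d + 1)) (x : Chart d) : ℝ :=
  L.firstVariation g (fun y => (y c - x c) • symUnit a b) x

/-- The coefficient `C^{ab,ce}` of the first variation, symmetric in `c, e`, read off at `x` from
the variation `½ (y^c - x^c) (y^e - x^e)` times a matrix unit. -/
def coeffC (g : MetricField d) (a b c e : Fin (d + 1)) (x : Chart d) : ℝ :=
  L.firstVariation g (fun y => ((1 / 2) * ((y c - x c) * (y e - x e))) • symUnit a b) x

/-- The gravitational field equations of the theory: the Euler-Lagrange expression
`δ(√|g| 𝓛)/δg_{ab} = A^{ab} - ∂_c B^{ab,c} + ∂_c ∂_e C^{ab,ce}` of the action `∫ √|g| 𝓛`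
with respect to all the components of a general metric. It equals `-√|g| 𝓔^{ab}`, where
`√|g| 𝓔_{ab}` is the functional derivative with respect to `g^{ab}`; the vacuum equations of motion
say that it vanishes. -/
def fieldEquations (g : MetricField d) (a b : Fin (d + 1)) (x : Chart d) : ℝ :=
  L.coeffA g a b x - ∑ c, pd c (L.coeffB g a b c) x
    + ∑ c, ∑ e, pd c (pd e (L.coeffC g a b c e)) x

end GravityTheory

/-! ### FLRW metrics -/

/-- The squared radius `r² = ∑ (x^i)²` (sum over the spatial coordinates). -/
def radiusSq (x : Chart d) : ℝ := ∑ i : Fin d, x i.succ ^ 2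

/-- The FLRW metric `-F(t) dt² + a(t)² (dr² / (1 - k r²) + r² dΩ²_{d-1})`, in the coordinates
`(t, x^1, ..., x^d)` with `x = r n` for `r ≥ 0` and `n` in the unit sphere, in which
`dr² / (1 - k r²) + r² dΩ²_{d-1} = (δ_{ij} + k x_i x_j / (1 - k r²)) dx^i dx^j`. -/
def flrw (k : ℝ) (a F : ℝ → ℝ) : MetricField d := fun x =>
  Matrix.of fun i j =>
    if i = 0 then (if j = 0 then -F (x 0) else 0)
    else if j = 0 then 0
    else a (x 0) ^ 2 * ((if i = j then 1 else 0) + k * x i * x j / (1 - k * radiusSq x))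

/-- The polar form of `flrw`: at the point `(t, r n)`, with `n` a unit vector, the tangent vector
with components `τ` along `t`, `ρ` along `r` and `w ⊥ n` along the unit sphere has the squared
length `-F τ² + a² ρ² / (1 - k r²) + a² r² |w|²`. -/
theorem flrw_polar (k : ℝ) (a F : ℝ → ℝ) (t r τ ρ : ℝ) (n w : Fin d → ℝ)
    (hn : ∑ i, n i ^ 2 = 1) (hw : ∑ i, n i * w i = 0) (hr : 1 - k * r ^ 2 ≠ 0) :
    let x : Chart d := Fin.cons t (fun i => r * n i)
    let v : Fin (d + 1) → ℝ := Fin.cons τ (fun i => ρ * n i + r * w i)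
    ∑ i, ∑ j, flrw k a F x i j * v i * v j
      = -F t * τ ^ 2 + a t ^ 2 / (1 - k * r ^ 2) * ρ ^ 2
        + a t ^ 2 * r ^ 2 * ∑ i, w i ^ 2 := by
  intro x v
  have hrad : radiusSq x = r ^ 2 := by
    simp only [radiusSq, x, Fin.cons_succ, mul_pow, ← Finset.mul_sum, hn, mul_one]
  have h2 : ∑ i, v (Fin.succ i) ^ 2 = ρ ^ 2 + r ^ 2 * ∑ i, w i ^ 2 := by
    have : ∀ i : Fin d, v i.succ ^ 2
        = ρ ^ 2 * n i ^ 2 + 2 * ρ * r * (n i * w i) + r ^ 2 * w i ^ 2 := by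
      intro i; simp only [v, Fin.cons_succ]; ring
    simp only [this, Finset.sum_add_distrib, ← Finset.mul_sum, hn, hw]; ring
  have h1 : ∑ i, x (Fin.succ i) * v (Fin.succ i) = r * ρ := by
    have : ∀ i : Fin d, x i.succ * v i.succ
        = r * ρ * n i ^ 2 + r ^ 2 * (n i * w i) := by
      intro i; simp only [x, v, Fin.cons_succ]; ring
    simp only [this, Finset.sum_add_distrib, ← Finset.mul_sum, hn, hw]; ring
  have h3 : ∀ i : Fin d, ∑ j : Fin d, flrw k a F x i.succ j.succ * v i.succ * v j.succ
      = a t ^ 2 * v i.succ ^ 2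
        + a t ^ 2 * k / (1 - k * r ^ 2) * (r * ρ) * (x i.succ * v i.succ) := by
    intro i
    have : ∀ j : Fin d, flrw k a F x i.succ j.succ * v i.succ * v j.succ
        = (if i = j then a t ^ 2 * v i.succ * v j.succ else 0)
          + a t ^ 2 * k / (1 - k * r ^ 2) * (x i.succ * v i.succ) * (x j.succ * v j.succ) := by
      intro j
      have hx0 : x 0 = t := rfl
      simp only [flrw, Matrix.of_apply, Fin.succ_ne_zero, if_false, hrad, hx0, Fin.succ_inj]
      split_ifs <;> ring
    simp only [this, Finset.sum_add_distrib, ← Finset.mul_sum, h1, Finset.sum_ite_eq,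
      Finset.mem_univ, if_true]
    ring
  have h4 : ∀ i : Fin d, flrw k a F x i.succ 0 = 0 := by
    intro i; simp [flrw]
  have h5 : ∀ i : Fin d, flrw k a F x 0 i.succ = 0 := by
    intro i; simp [flrw]
  have h6 : flrw k a F x 0 0 = -F t := by simp [flrw, x]
  have hv0 : v 0 = τ := rfl
  rw [Fin.sum_univ_succ, Fin.sum_univ_succ]
  simp only [Fin.sum_univ_succ (fun j => flrw k a F x _ j * _ * _), h4, h5, h6, h3, hv0,
    Finset.sum_add_distrib, ← Finset.mul_sum, h1, h2, zero_mul, zero_add, Finset.sum_const_zero,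
    add_zero]
  have hI : (1 - k * r ^ 2) * (1 - k * r ^ 2)⁻¹ = 1 := mul_inv_cancel₀ hr
  linear_combination (-(a t ^ 2 * ρ ^ 2)) * hI

/-- The coordinate domain of the FLRW metric: `1 - k r² > 0`. -/
def InFLRWChart (k : ℝ) (x : Chart d) : Prop := 0 < 1 - k * radiusSq x

/-- `a` and `F` are admissible as functions of an FLRW metric for times in the open set `I`:
smooth and positive. -/
structure AdmissibleOn (I : Set ℝ) (a F : ℝ → ℝ) : Prop where
  isOpen : IsOpen I
  contDiffOn_scale : ContDiffOn ℝ ∞ a I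
  contDiffOn_lapse : ContDiffOn ℝ ∞ F I
  scale_pos : ∀ t ∈ I, 0 < a t
  lapse_pos : ∀ t ∈ I, 0 < F t

/-- `f₁` and `f₂` have the same value and the same first and second derivatives at `t`. -/
def SameTwoJet (f₁ f₂ : ℝ → ℝ) (t : ℝ) : Prop :=
  f₁ t = f₂ t ∧ deriv f₁ t = deriv f₂ t ∧ iteratedDeriv 2 f₁ t = iteratedDeriv 2 f₂ t

namespace GravityTheory

variable (L : GravityTheory d)

/-- The field equations of the theory, evaluated on the FLRW metrics with curvature parameter `k`,
are of (at most) second order in time derivatives: the components of the Euler-Lagrange expression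
at a point with time `t` depend on `a` and `F` only through the values at `t` of `a`, `F` and of
their first and second derivatives. -/
def HasSecondOrderFLRWEquations (k : ℝ) : Prop :=
  ∀ (I : Set ℝ) (a₁ F₁ a₂ F₂ : ℝ → ℝ), AdmissibleOn I a₁ F₁ → AdmissibleOn I a₂ F₂ →
    ∀ x : Chart d, x 0 ∈ I → InFLRWChart k x →
      L.DefinedAt (flrw k a₁ F₁) x → L.DefinedAt (flrw k a₂ F₂) x →
      SameTwoJet a₁ a₂ (x 0) → SameTwoJet F₁ F₂ (x 0) →
      ∀ i j, L.fieldEquations (flrw k a₁ F₁) i j x = L.fieldEquations (flrw k a₂ F₂) i j x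

/-- A Cosmological Gravity: the equations of motion for FLRW configurations, of any spatial
curvature `k = -1, 0, 1`, are of second order in time derivatives. -/
def IsCosmologicalGravity : Prop :=
  ∀ k ∈ ({-1, 0, 1} : Set ℝ), L.HasSecondOrderFLRWEquations k

end GravityTheory

/-- The comoving FLRW metric (`F = 1`) whose scale factor has the value `q`, the first derivative
`q'` and the second derivative `q''` at the time `t`. -/
def comovingJet (k t q q' q'' : ℝ) : MetricField d :=
  flrw k (fun s => q + q' * (s - t) + q'' / 2 * (s - t) ^ 2) (fun _ => 1)

namespace GravityTheory

variable (L : GravityTheory d)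

/-- The reduced Lagrangian `L_{a,1}` on the comoving FLRW ansatz at the point `x`, as a function of
the values `q`, `q'`, `q''` of `a`, `ȧ`, `ä` at the time of `x`. -/
def reducedLagrangian (k : ℝ) (x : Chart d) (q q' q'' : ℝ) : ℝ :=
  L.eval (comovingJet k (x 0) q q' q'') x

/-- The reduced Lagrangian is linear in `ä`: `∂² L_{a,1} / ∂ä² = 0` wherever it is defined. -/
def ReducedLagrangianLinear (k : ℝ) : Prop :=
  ∀ (x : Chart d) (q q' q'' : ℝ), InFLRWChart k x → 0 < q →
    L.DefinedAt (comovingJet k (x 0) q q' q'') x →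
      iteratedDeriv 2 (fun s : ℝ => L.reducedLagrangian k x q q' s) q'' = 0

end GravityTheory

end CosmoGravity

end

open scoped ContDiff

set_option linter.unusedSimpArgs false

noncomputable section

namespace CosmoGravity

open Filter Topology

/-! ### Partial derivatives -/

section PartialDerivatives

variable {d : ℕ} {x : Chart d}

/-! Invariance under linear coordinate changes reduces everything to a function of four numbers. At
each point of an FLRW chart a linear change of the spatial coordinates turns the spatial metric γ
into the identity. The pair (g^{ab}, R_{abcd}) then takes a canonical form that depends only on f =
F, b = a² and two curvature coefficients, given by R_{titj} = X γ_{ij} and R_{ijkl} = Y (γ_{ik}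
γ_{jl} - γ_{il} γ_{jk}). Here X = -b''/2 + b'²/(4b) + b'f'/(4f) and Y = k b + b'²/(4f). Write Λ(f,
b, X, Y) = √(f b^d) 𝓛 (`reducedDensity`), and let subscripts on Λ denote partial derivatives.

The field equations come from arbitrary variations of the metric, not only from variations inside
the FLRW family. The canonical pair is fixed by sign changes of the coordinates and by permutations
of the spatial ones, so the derivative of 𝓛 there is an isotropic functional. On tensors with the
antisymmetries of the curvature such a functional sees only four traces
(`IsIsotropic.exists_traces`), and its values on these are controlled by the first derivatives of Λ.
Hence the first variation along φ S, with φ a function and S a constant symmetric array, is explicit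
in the 2-jet of φ (`firstVariation_flrw_smul`). Taking divergences of its coefficients, all terms in
the mixed components of S cancel, and `eulerLagrange_flrw` leaves ρ (tr S · E + S_{00} · C), with ρ
the spatial volume density, E the spatial equation and C the constraint.

Put α = Λ_X / d, δ = Λ_Y / (d (d - 1)) and K = b'/(2f). Derivatives of order above two can enter
only through α' in both equations and through -½ α'' - (d - 1) K δ' in E.

Necessity: b'''' occurs only in α'', through X, and its coefficient in E is Λ_XX / (4d). Adding t⁴
to the scale factor keeps its 2-jet but changes b'''', so second-order equations force Λ_XX = 0 at
every comoving configuration where the theory is defined (`reducedLagrangianLinear_of_secondOrder`).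

Sufficiency: if Λ_XX = 0, then α is locally independent of X, hence a function of (b, b', f), and α'
is of second order. The third derivative b''' enters α'' with coefficient K Λ_XY / d, because ∂Y/∂b'
= K, and enters δ' with coefficient -½ Λ_YX / (d (d - 1)), because ∂X/∂b'' = -½. The two
contributions to E cancel by symmetry of second derivatives (`equations_eq_of_curvHessian`).

Finally, for F = 1 one has X = -a ä and Y = a² (k + ȧ²), so ∂²L_{a,1}/∂ä² is a nonzero multiple of
Λ_XX. A rescaling of time reduces any f to f = 1, and the points reached are exactly those with Y ≥
k b, an inequality that every FLRW metric satisfies (`curvHessian_eq_zero_of_linear`). -/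

theorem pd_congr {f₁ f₂ : Chart d → ℝ} (h : f₁ =ᶠ[𝓝 x] f₂) (c : Fin (d + 1)) :
    pd c f₁ x = pd c f₂ x := by
  simp only [pd, Filter.EventuallyEq.fderiv_eq (𝕜 := ℝ) h]

theorem pd_add {f₁ f₂ : Chart d → ℝ} (h₁ : DifferentiableAt ℝ f₁ x)
    (h₂ : DifferentiableAt ℝ f₂ x) (c : Fin (d + 1)) :
    pd c (fun y => f₁ y + f₂ y) x = pd c f₁ x + pd c f₂ x := by
  simp only [pd, fderiv_fun_add h₁ h₂, add_apply]

theorem pd_sub {f₁ f₂ : Chart d → ℝ} (h₁ : DifferentiableAt ℝ f₁ x)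
    (h₂ : DifferentiableAt ℝ f₂ x) (c : Fin (d + 1)) :
    pd c (fun y => f₁ y - f₂ y) x = pd c f₁ x - pd c f₂ x := by
  simp only [pd, fderiv_fun_sub h₁ h₂, sub_apply]

theorem pd_mul {f₁ f₂ : Chart d → ℝ} (h₁ : DifferentiableAt ℝ f₁ x)
    (h₂ : DifferentiableAt ℝ f₂ x) (c : Fin (d + 1)) :
    pd c (fun y => f₁ y * f₂ y) x = f₁ x * pd c f₂ x + pd c f₁ x * f₂ x := by
  simp only [pd, fderiv_fun_mul h₁ h₂, add_apply,
    smul_apply, smul_eq_mul]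
  ring

theorem pd_const (r : ℝ) (c : Fin (d + 1)) : pd c (fun _ : Chart d => r) x = 0 := by
  simp [pd]

theorem pd_const_mul {f : Chart d → ℝ} (h : DifferentiableAt ℝ f x) (r : ℝ) (c : Fin (d + 1)) :
    pd c (fun y => r * f y) x = r * pd c f x := by
  rw [pd_mul (differentiableAt_const r) h, pd_const]; ring

theorem pd_neg (f : Chart d → ℝ) (c : Fin (d + 1)) :
    pd c (fun y => - f y) x = - pd c f x := by
  simp [pd, fderiv_fun_neg]

theorem pd_sum {ι : Type*} {s : Finset ι} {f : ι → Chart d → ℝ}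
    (h : ∀ i ∈ s, DifferentiableAt ℝ (f i) x) (c : Fin (d + 1)) :
    pd c (fun y => ∑ i ∈ s, f i y) x = ∑ i ∈ s, pd c (f i) x := by
  simp only [pd, fderiv_fun_sum h, sum_apply]

theorem contDiffAt_pd {m n : ℕ∞ω} {f : Chart d → ℝ} (hf : ContDiffAt ℝ n f x) (hmn : m + 1 ≤ n)
    (c : Fin (d + 1)) : ContDiffAt ℝ m (pd c f) x :=
  (hf.fderiv_right hmn).clm_apply contDiffAt_const

theorem pd_pd_comm {f : Chart d → ℝ} (hf : ContDiffAt ℝ 2 f x) (a b : Fin (d + 1)) :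
    pd a (pd b f) x = pd b (pd a f) x := by
  have h : ∀ v w : Chart d, fderiv ℝ (fun y => fderiv ℝ f y v) x w
      = fderiv ℝ (fderiv ℝ f) x w v := by
    intro v w
    have h1 : DifferentiableAt ℝ (fderiv ℝ f) x :=
      (hf.fderiv_right (m := 1) (by norm_num)).differentiableAt (by norm_num)
    rw [fderiv_clm_apply h1 (differentiableAt_const v)]
    simp
  have hs := hf.isSymmSndFDerivAt (by simp)
  change fderiv ℝ (fun y => fderiv ℝ f y _) x _ = fderiv ℝ (fun y => fderiv ℝ f y _) x _
  rw [h, h, hs.eq]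

end PartialDerivatives

/-! ### The curvature as a function of the jet of the metric -/

section Curvature

variable {d : ℕ}

theorem contDiffAt_det {E : Type*} [NormedAddCommGroup E] [NormedSpace ℝ E] {m : ℕ∞ω} {n : ℕ}
    {g : E → Matrix (Fin n) (Fin n) ℝ} {x : E}
    (hg : ∀ a b, ContDiffAt ℝ m (fun y => g y a b) x) : ContDiffAt ℝ m (fun y => (g y).det) x := by
  simp only [Matrix.det_apply']
  exact ContDiffAt.sum fun σ _ => contDiffAt_const.mul (contDiffAt_prod fun i _ => hg _ _)

/-- By Cramer's rule each entry is a cofactor divided by the determinant, both polynomial in the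
entries of `g`. -/
theorem contDiffAt_inv {E : Type*} [NormedAddCommGroup E] [NormedSpace ℝ E] {m : ℕ∞ω} {n : ℕ}
    {g : E → Matrix (Fin n) (Fin n) ℝ} {x : E}
    (hg : ∀ a b, ContDiffAt ℝ m (fun y => g y a b) x) (hdet : (g x).det ≠ 0) (a b : Fin n) :
    ContDiffAt ℝ m (fun y => (g y)⁻¹ a b) x := by
  simp only [Matrix.inv_def, Ring.inverse_eq_inv', Matrix.smul_apply, smul_eq_mul,
    Matrix.adjugate_apply]
  refine ((contDiffAt_det hg).inv hdet).mul (contDiffAt_det fun i j => ?_)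
  by_cases h : i = b
  · simp only [h, Matrix.updateRow_self]; exact contDiffAt_const
  · simp only [Matrix.updateRow_ne h]; exact hg i j

/-- The lowered Christoffel symbol `Γ_{e,ab}` as a function of the first derivatives `∂_c g_{ab}`. -/
def lowChristoffel (D : Fin (d + 1) → Tensor2 d) (e a b : Fin (d + 1)) : ℝ :=
  (1 / 2) * (D a b e + D b a e - D e a b)

/-- The part of the lowered curvature that is linear in the second derivatives
`∂_c ∂_e g_{ab}`. -/
def curvLinear (D2 : Fin (d + 1) → Fin (d + 1) → Tensor2 d) : Tensor4 d := fun a b c f =>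
  (1 / 2) * (D2 b c a f + D2 a f b c - D2 a c b f - D2 b f a c)

/-- The lowered curvature as a function of the inverse metric and of the first and second
derivatives of the metric. -/
def curvJet (u : Tensor2 d) (D : Fin (d + 1) → Tensor2 d)
    (D2 : Fin (d + 1) → Fin (d + 1) → Tensor2 d) : Tensor4 d := fun a b c f =>
  curvLinear D2 a b c f + ∑ m, ∑ n, u m n *
    (lowChristoffel D m a f * lowChristoffel D n b c
      - lowChristoffel D m b f * lowChristoffel D n a c)

/-- The first derivatives of the metric components at `x`. -/
def metricD (g : MetricField d) (x : Chart d) : Fin (d + 1) → Tensor2 d :=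
  fun c a b => pd c (fun y => g y a b) x

/-- The second derivatives of the metric components at `x`. -/
def metricD2 (g : MetricField d) (x : Chart d) : Fin (d + 1) → Fin (d + 1) → Tensor2 d :=
  fun c e a b => pd c (pd e (fun y => g y a b)) x

theorem christoffel_eq (g : MetricField d) (a b c : Fin (d + 1)) (x : Chart d) :
    christoffel g a b c x = ∑ e, invMetric g x c e * lowChristoffel (metricD g x) e a b := by
  simp only [christoffel, lowChristoffel, metricD, Finset.mul_sum]
  exact Finset.sum_congr rfl fun e _ => by ring

/-- The metric cancels the inverse metric in the Christoffel symbol. The result is linear in the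
first derivatives, so it can be differentiated without differentiating an inverse matrix. -/
theorem sum_metric_christoffel (g : MetricField d) {x : Chart d} (hdet : (g x).det ≠ 0)
    (a b f : Fin (d + 1)) :
    ∑ e, g x f e * christoffel g a b e x = lowChristoffel (metricD g x) f a b := by
  have h : g x * (g x)⁻¹ = 1 := Matrix.mul_nonsing_inv _ (isUnit_iff_ne_zero.2 hdet)
  simp only [christoffel_eq, Finset.mul_sum]
  rw [Finset.sum_comm]
  simp only [← mul_assoc, ← Finset.sum_mul, invMetric]
  have h' : ∀ m, ∑ e, g x f e * (g x)⁻¹ e m = (1 : Matrix _ _ ℝ) f m := fun m => by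
    rw [← h, Matrix.mul_apply]
  simp [h', Matrix.one_apply]

theorem contDiffAt_christoffel {g : MetricField d} {x : Chart d}
    (hg : ∀ a b, ContDiffAt ℝ 2 (fun y => g y a b) x) (hdet : (g x).det ≠ 0)
    (a b c : Fin (d + 1)) : ContDiffAt ℝ 1 (christoffel g a b c) x := by
  have h2 : ∀ a b c, ContDiffAt ℝ 1 (pd c (fun y => g y a b)) x :=
    fun a b c => contDiffAt_pd (hg a b) (by norm_num) c
  unfold christoffel
  refine contDiffAt_const.mul (ContDiffAt.sum fun e _ => ContDiffAt.mul ?_ ?_)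
  · exact (contDiffAt_inv hg hdet c e).of_le (by norm_num)
  · exact ((h2 _ _ _).add (h2 _ _ _)).sub (h2 _ _ _)

/-- Moving the metric inside ∂Γ replaces g_{fe} ∂Γ^e by the derivative of the lowered symbol minus
(∂g) Γ. Metric compatibility turns ∂g into lowered symbols, which combine with the Γ Γ terms and
reverse their sign. The resulting form makes the dependence on the jet of the metric explicit, so
that it can be varied. -/
theorem riemann_eq_curvJet {g : MetricField d} {x : Chart d}
    (hg : ∀ a b, ContDiffAt ℝ 2 (fun y => g y a b) x) (hsymm : ∀ y a b, g y a b = g y b a)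
    (hdet : (g x).det ≠ 0) :
    riemann g x = curvJet (invMetric g x) (metricD g x) (metricD2 g x) := by
  have hdet' : ∀ᶠ y in 𝓝 x, (g y).det ≠ 0 :=
    (contDiffAt_det hg).continuousAt.eventually_ne hdet
  have hgd : ∀ a b, DifferentiableAt ℝ (fun y => g y a b) x :=
    fun a b => (hg a b).differentiableAt (by norm_num)
  have hpd : ∀ a b c, DifferentiableAt ℝ (pd c (fun y => g y a b)) x :=
    fun a b c => (contDiffAt_pd (hg a b) (m := 1) (by norm_num) c).differentiableAt (by norm_num)
  have hΓ : ∀ a b c, DifferentiableAt ℝ (christoffel g a b c) x :=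
    fun a b c => (contDiffAt_christoffel hg hdet a b c).differentiableAt (by norm_num)
  -- The product rule applied to g_{fe} Γ_{ab}^e = Γ_{f,ab}, an identity that holds on the
  -- neighbourhood where the determinant is nonzero.
  have key : ∀ a b f c, ∑ e, g x f e * pd c (christoffel g a b e) x
      = (1 / 2) * (metricD2 g x c a b f + metricD2 g x c b a f - metricD2 g x c f a b)
        - ∑ e, metricD g x c f e * christoffel g a b e x := by
    intro a b f c
    have h1 : pd c (fun y => ∑ e, g y f e * christoffel g a b e y) x
        = pd c (fun y => (1 / 2) * (pd a (fun y => g y b f) y + pd b (fun y => g y a f) y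
          - pd f (fun y => g y a b) y)) x := by
      refine pd_congr ?_ c
      filter_upwards [hdet'] with y hy
      rw [sum_metric_christoffel g hy]; rfl
    rw [pd_sum (f := fun e y => g y f e * christoffel g a b e y)
      (fun e _ => (hgd _ _).fun_mul (hΓ _ _ _)), pd_const_mul
      (((hpd _ _ _).fun_add (hpd _ _ _)).fun_sub (hpd _ _ _)),
      pd_sub ((hpd _ _ _).fun_add (hpd _ _ _)) (hpd _ _ _), pd_add (hpd _ _ _) (hpd _ _ _)] at h1
    simp only [pd_mul (hgd _ _) (hΓ _ _ _), Finset.sum_add_distrib] at h1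
    simp only [metricD2, metricD]
    linarith
  -- Metric compatibility: ∂_c g_{ab} = Γ_{a,cb} + Γ_{b,ca}.
  have hD : ∀ c a b, metricD g x c a b
      = lowChristoffel (metricD g x) a c b + lowChristoffel (metricD g x) b c a := by
    intro c a b
    have hs : ∀ c a b, metricD g x c a b = metricD g x c b a := fun c a b => by
      simp only [metricD, hsymm _ a b]
    simp only [lowChristoffel]
    rw [hs a c b, hs b c a, hs c b a]; ring
  have hlow : ∀ e a b, lowChristoffel (metricD g x) e a b = lowChristoffel (metricD g x) e b a := by
    intro e a b
    simp only [lowChristoffel, metricD, hsymm _ a b]; ring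
  have hcs : ∀ a b c, christoffel g a b c x = christoffel g b a c x := by
    intro a b c; simp only [christoffel_eq, hlow _ a b]
  funext a b c f
  have hquad : ∀ a b c, ∑ e, g x f e * ∑ m, christoffel g c a m x * christoffel g b m e x
      = ∑ m, christoffel g c a m x * lowChristoffel (metricD g x) f b m := by
    intro a b c
    simp only [Finset.mul_sum]
    rw [Finset.sum_comm]
    refine Finset.sum_congr rfl fun m _ => ?_
    rw [← sum_metric_christoffel g hdet, Finset.mul_sum]
    exact Finset.sum_congr rfl fun e _ => by ring
  have hraise : ∀ a b c f : Fin (d + 1), ∑ m, ∑ n, invMetric g x m n *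
      (lowChristoffel (metricD g x) m a f * lowChristoffel (metricD g x) n b c)
      = ∑ m, lowChristoffel (metricD g x) m a f * christoffel g b c m x := by
    intro a b c f
    refine Finset.sum_congr rfl fun m _ => ?_
    rw [christoffel_eq, Finset.mul_sum]
    exact Finset.sum_congr rfl fun e _ => by ring
  simp only [riemann, riemannUp, curvJet, mul_add, mul_sub, Finset.sum_add_distrib,
    Finset.sum_sub_distrib, key, hquad, hraise]
  simp only [hD b f, hD a f, add_mul, Finset.sum_add_distrib, hcs c a, hcs c b]
  simp only [curvLinear, metricD2, pd_pd_comm (hg c f) b a]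
  have e1 : ∀ a b c : Fin (d + 1), ∑ m, christoffel g a c m x * lowChristoffel (metricD g x) f b m
      = ∑ m, lowChristoffel (metricD g x) f b m * christoffel g a c m x :=
    fun a b c => Finset.sum_congr rfl fun m _ => mul_comm _ _
  simp only [e1, hsymm _ a c, hsymm _ b c, pd_pd_comm (hg c b) a f]
  ring
end Curvature

/-! ### The first variation of a Lagrangian density -/

section Variation

variable {d : ℕ}

/-- The variation `-g^{ac} h_{ce} g^{eb}` of the inverse metric. -/
def invVar (u : Tensor2 d) (h : Tensor2 d) : Tensor2 d := fun a b =>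
  - ∑ c, ∑ e, u a c * h c e * u e b

/-- The variation of the lowered curvature in terms of the Christoffel symbols `Γ a b e = Γ_{ab}^e`
of the background and of the jet of the variation of the metric. -/
def curvVar (Γ : Fin (d + 1) → Tensor2 d) (h : Tensor2 d) (D : Fin (d + 1) → Tensor2 d)
    (D2 : Fin (d + 1) → Fin (d + 1) → Tensor2 d) : Tensor4 d := fun a b c f =>
  curvLinear D2 a b c f
    + ∑ e, (lowChristoffel D e a f * Γ b c e + lowChristoffel D e b c * Γ a f e
      - lowChristoffel D e b f * Γ a c e - lowChristoffel D e a c * Γ b f e)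
    - ∑ m, ∑ n, h m n * (Γ a f m * Γ b c n - Γ b f m * Γ a c n)

theorem hasDerivAt_inv_apply {n : ℕ} (g h : Matrix (Fin n) (Fin n) ℝ) (hdet : g.det ≠ 0)
    (a b : Fin n) :
    HasDerivAt (fun s : ℝ => (g + s • h)⁻¹ a b) (- ∑ c, ∑ e, g⁻¹ a c * h c e * g⁻¹ e b) 0 := by
  have hent : ∀ i j, ContDiffAt ℝ 1 (fun s : ℝ => (g + s • h) i j) 0 := by
    intro i j
    simp only [Matrix.add_apply, Matrix.smul_apply, smul_eq_mul]
    fun_prop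
  have hdet0 : (g + (0 : ℝ) • h).det ≠ 0 := by simpa using hdet
  have hdiff : ∀ i j, DifferentiableAt ℝ (fun s : ℝ => (g + s • h)⁻¹ i j) 0 := fun i j =>
    (contDiffAt_inv hent hdet0 i j).differentiableAt (by norm_num)
  let U : Matrix (Fin n) (Fin n) ℝ := fun i j => deriv (fun s : ℝ => (g + s • h)⁻¹ i j) 0
  have hinv : g * g⁻¹ = 1 := Matrix.mul_nonsing_inv _ (isUnit_iff_ne_zero.2 hdet)
  -- The product (g + s h)⁻¹ (g + s h) is constantly 1 for small s; its derivative is computed in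
  -- two ways.
  have hU : U * g + g⁻¹ * h = 0 := by
    ext i k
    have h1 : HasDerivAt (fun s : ℝ => ∑ j, (g + s • h)⁻¹ i j * (g + s • h) j k)
        (∑ j, (U i j * (g + (0 : ℝ) • h) j k + (g + (0 : ℝ) • h)⁻¹ i j * h j k)) 0 := by
      refine HasDerivAt.fun_sum fun j _ => (hdiff i j).hasDerivAt.mul ?_
      have : HasDerivAt (fun s : ℝ => g j k + s * h j k) (1 * h j k) 0 :=
        ((hasDerivAt_id (0 : ℝ)).mul_const _).const_add _
      simpa using this
    have h2 : HasDerivAt (fun s : ℝ => ∑ j, (g + s • h)⁻¹ i j * (g + s • h) j k) 0 0 := by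
      refine (hasDerivAt_const (0 : ℝ) ((1 : Matrix (Fin n) (Fin n) ℝ) i k)).congr_of_eventuallyEq ?_
      filter_upwards [(contDiffAt_det hent).continuousAt.eventually_ne hdet0] with s hs
      rw [← Matrix.nonsing_inv_mul _ (isUnit_iff_ne_zero.2 hs), Matrix.mul_apply]
    have h3 := h1.unique h2
    simpa [Finset.sum_add_distrib, Matrix.mul_apply] using h3
  have hU' : U = - (g⁻¹ * h * g⁻¹) := by
    have : (U * g + g⁻¹ * h) * g⁻¹ = 0 := by rw [hU, zero_mul]
    rw [add_mul, mul_assoc, hinv, mul_one] at this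
    exact eq_neg_of_add_eq_zero_left this
  have hval : - ∑ c, ∑ e, g⁻¹ a c * h c e * g⁻¹ e b = U a b := by
    rw [hU', Matrix.neg_apply, Matrix.mul_apply, Finset.sum_comm]
    simp only [Matrix.mul_apply, Finset.sum_mul]
  rw [hval]
  exact (hdiff a b).hasDerivAt

/-- Factor det (g + s h) = det g · det (1 + s g⁻¹ h). The second factor is 1 + s tr(g⁻¹ h) + O(s²),
hence positive for small s, so the absolute value affects only the constant factor det g. -/
theorem hasDerivAt_sqrt_abs_det {n : ℕ} (g h : Matrix (Fin n) (Fin n) ℝ) (hdet : g.det ≠ 0) :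
    HasDerivAt (fun s : ℝ => Real.sqrt |(g + s • h).det|)
      (Real.sqrt |g.det| * ((1 / 2) * (g⁻¹ * h).trace)) 0 := by
  obtain ⟨c, hc⟩ : ∃ c : ℝ → ℝ, Differentiable ℝ c ∧ ∀ s : ℝ,
      (1 + s • (g⁻¹ * h)).det = 1 + (g⁻¹ * h).trace * s + c s * s ^ 2 := by
    refine ⟨_, ?_, fun s => Matrix.det_one_add_smul s (g⁻¹ * h)⟩
    exact Polynomial.differentiable _
  have hfac : ∀ s : ℝ, (g + s • h).det
      = g.det * (1 + (g⁻¹ * h).trace * s + c s * s ^ 2) := by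
    intro s
    rw [← hc.2, ← Matrix.det_mul, mul_add, mul_one, Matrix.mul_smul, ← mul_assoc,
      Matrix.mul_nonsing_inv _ (isUnit_iff_ne_zero.2 hdet), one_mul]
  have hw : HasDerivAt (fun s : ℝ => 1 + (g⁻¹ * h).trace * s + c s * s ^ 2)
      (g⁻¹ * h).trace 0 := by
    have h1 := (((hasDerivAt_id (0 : ℝ)).const_mul (g⁻¹ * h).trace).const_add 1).fun_add
      ((hc.1 0).hasDerivAt.fun_mul ((hasDerivAt_id (0 : ℝ)).fun_pow 2))
    simpa using h1
  have hs := (hw.sqrt (by simp)).const_mul (Real.sqrt |g.det|)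
  have hpos : ∀ᶠ s : ℝ in 𝓝 0, 0 < 1 + (g⁻¹ * h).trace * s + c s * s ^ 2 :=
    hw.continuousAt.eventually (lt_mem_nhds (by simp))
  refine HasDerivAt.congr_of_eventuallyEq (hs.congr_deriv ?_) ?_
  · simp only [mul_zero, add_zero, ne_eq, OfNat.ofNat_ne_zero, not_false_eq_true, zero_pow,
      Real.sqrt_one]
    ring
  · filter_upwards [hpos] with s hs
    rw [hfac, abs_mul, Real.sqrt_mul (abs_nonneg _), abs_of_pos hs]

theorem hasDerivAt_curvJet {u : ℝ → Tensor2 d} {u' : Tensor2 d}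
    (hu : ∀ a b, HasDerivAt (fun s => u s a b) (u' a b) 0)
    (D E : Fin (d + 1) → Tensor2 d) (D2 E2 : Fin (d + 1) → Fin (d + 1) → Tensor2 d)
    (a b c f : Fin (d + 1)) :
    HasDerivAt (fun s : ℝ => curvJet (u s) (fun c a b => D c a b + s * E c a b)
        (fun c e a b => D2 c e a b + s * E2 c e a b) a b c f)
      (curvLinear E2 a b c f + ∑ m, ∑ n, (u' m n *
        (lowChristoffel D m a f * lowChristoffel D n b c
          - lowChristoffel D m b f * lowChristoffel D n a c)
        + u 0 m n * (lowChristoffel E m a f * lowChristoffel D n b c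
          + lowChristoffel D m a f * lowChristoffel E n b c
          - (lowChristoffel E m b f * lowChristoffel D n a c
          + lowChristoffel D m b f * lowChristoffel E n a c)))) 0 := by
  have hlow : ∀ e a b, HasDerivAt
      (fun s : ℝ => lowChristoffel (fun c a b => D c a b + s * E c a b) e a b)
      (lowChristoffel E e a b) 0 := by
    intro e a b
    have h : HasDerivAt (fun s : ℝ => lowChristoffel D e a b + s * lowChristoffel E e a b)
        (1 * lowChristoffel E e a b) 0 := ((hasDerivAt_id (0 : ℝ)).mul_const _).const_add _
    rw [one_mul] at h
    convert h using 2
    simp only [lowChristoffel]; ring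
  have hlin : HasDerivAt (fun s : ℝ => curvLinear (fun c e a b => D2 c e a b + s * E2 c e a b) a b c f)
      (curvLinear E2 a b c f) 0 := by
    have h : HasDerivAt (fun s : ℝ => curvLinear D2 a b c f + s * curvLinear E2 a b c f)
        (1 * curvLinear E2 a b c f) 0 := ((hasDerivAt_id (0 : ℝ)).mul_const _).const_add _
    rw [one_mul] at h
    convert h using 2
    simp only [curvLinear]; ring
  have h0 : (fun c a b => D c a b + (0 : ℝ) * E c a b) = D := by
    funext c a b; ring
  have := hlin.fun_add (HasDerivAt.fun_sum (u := Finset.univ) fun m _ =>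
    HasDerivAt.fun_sum (u := Finset.univ) fun n _ => (hu m n).fun_mul
      (((hlow m a f).fun_mul (hlow n b c)).fun_sub ((hlow m b f).fun_mul (hlow n a c))))
  simp only [h0] at this
  exact this

/-- Moves the two inverse metrics of g⁻¹ h g⁻¹ onto the lowered Christoffel symbols, so that the
variation of the quadratic part of the curvature is expressed by h and raised symbols. -/
theorem sum_congruence {u h : Tensor2 d} (hu : ∀ a b, u a b = u b a) (l l' : Fin (d + 1) → ℝ) :
    ∑ m, ∑ n, (∑ c, ∑ e, u m c * h c e * u e n) * (l m * l' n)
      = ∑ c, ∑ e, h c e * ((∑ m, u c m * l m) * (∑ n, u e n * l' n)) := by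
  simp only [Finset.sum_mul_sum]
  simp only [Finset.sum_mul, Finset.mul_sum]
  calc _ = ∑ m, ∑ c, ∑ n, ∑ e, u m c * h c e * u e n * (l m * l' n) :=
        Finset.sum_congr rfl fun m _ => Finset.sum_comm
    _ = ∑ c, ∑ m, ∑ n, ∑ e, u m c * h c e * u e n * (l m * l' n) := Finset.sum_comm
    _ = ∑ c, ∑ m, ∑ e, ∑ n, u m c * h c e * u e n * (l m * l' n) :=
        Finset.sum_congr rfl fun c _ => Finset.sum_congr rfl fun m _ => Finset.sum_comm
    _ = ∑ c, ∑ e, ∑ m, ∑ n, u m c * h c e * u e n * (l m * l' n) :=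
        Finset.sum_congr rfl fun c _ => Finset.sum_comm
    _ = _ := Finset.sum_congr rfl fun c _ => Finset.sum_congr rfl fun e _ =>
        Finset.sum_congr rfl fun m _ => Finset.sum_congr rfl fun n _ => by rw [hu m c]; ring

/-- Along g + s h the first and second derivatives of the metric are affine in s. The curvature is a
polynomial in them and in the inverse metric, so only the derivative of the inverse is nontrivial.
-/
theorem hasDerivAt_jet {g h : MetricField d} {x : Chart d}
    (hg : ∀ a b, ContDiffAt ℝ 2 (fun y => g y a b) x) (hgs : ∀ y a b, g y a b = g y b a)
    (hh : ∀ a b, ContDiffAt ℝ 2 (fun y => h y a b) x) (hhs : ∀ y a b, h y a b = h y b a)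
    (hdet : (g x).det ≠ 0) :
    HasDerivAt (fun s : ℝ => (invMetric (fun y => g y + s • h y) x,
        riemann (fun y => g y + s • h y) x))
      (invVar (invMetric g x) (h x), curvVar (fun a b e => christoffel g a b e x) (h x)
        (metricD h x) (metricD2 h x)) 0 := by
  have hinv : ∀ a b, HasDerivAt (fun s : ℝ => invMetric (fun y => g y + s • h y) x a b)
      (invVar (invMetric g x) (h x) a b) 0 :=
    fun a b => hasDerivAt_inv_apply (g x) (h x) hdet a b
  refine HasDerivAt.prodMk (hasDerivAt_pi.2 fun a => hasDerivAt_pi.2 fun b => hinv a b) ?_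
  refine hasDerivAt_pi.2 fun a => hasDerivAt_pi.2 fun b => hasDerivAt_pi.2 fun c =>
    hasDerivAt_pi.2 fun f => ?_
  have hcurv := hasDerivAt_curvJet hinv (metricD g x) (metricD h x) (metricD2 g x)
    (metricD2 h x) a b c f
  have hgd : ∀ a b, DifferentiableAt ℝ (fun y => g y a b) x :=
    fun a b => (hg a b).differentiableAt (by norm_num)
  have hhd : ∀ a b, DifferentiableAt ℝ (fun y => h y a b) x :=
    fun a b => (hh a b).differentiableAt (by norm_num)
  have hgc : ∀ s : ℝ, ∀ a b, ContDiffAt ℝ 2 (fun y => (g y + s • h y) a b) x := by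
    intro s a b
    simp only [Matrix.add_apply, Matrix.smul_apply, smul_eq_mul]
    exact (hg a b).add (contDiffAt_const.mul (hh a b))
  have hD : ∀ s : ℝ, metricD (fun y => g y + s • h y) x
      = fun c a b => metricD g x c a b + s * metricD h x c a b := by
    intro s; funext c a b
    simp only [metricD, Matrix.add_apply, Matrix.smul_apply, smul_eq_mul]
    rw [pd_add (hgd a b) ((hhd a b).const_mul s), pd_const_mul (hhd a b)]
  have hD2 : ∀ s : ℝ, metricD2 (fun y => g y + s • h y) x
      = fun c e a b => metricD2 g x c e a b + s * metricD2 h x c e a b := by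
    intro s; funext c e a b
    have hev : pd e (fun y => (g y + s • h y) a b) =ᶠ[𝓝 x]
        fun y => pd e (fun y => g y a b) y + s * pd e (fun y => h y a b) y := by
      filter_upwards [(hg a b).eventually (by simp), (hh a b).eventually (by simp)] with y h1 h2
      have h1 := h1.differentiableAt (by norm_num)
      have h2 := h2.differentiableAt (by norm_num)
      simp only [Matrix.add_apply, Matrix.smul_apply, smul_eq_mul]
      rw [pd_add h1 (h2.const_mul s), pd_const_mul h2]
    have h1 : DifferentiableAt ℝ (pd e (fun y => g y a b)) x :=
      (contDiffAt_pd (hg a b) (m := 1) (by norm_num) e).differentiableAt (by norm_num)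
    have h2 : DifferentiableAt ℝ (pd e (fun y => h y a b)) x :=
      (contDiffAt_pd (hh a b) (m := 1) (by norm_num) e).differentiableAt (by norm_num)
    simp only [metricD2]
    rw [pd_congr hev, pd_add h1 (h2.const_mul s), pd_const_mul h2]
  have hdet' : ∀ᶠ s : ℝ in 𝓝 0, (g x + s • h x).det ≠ 0 := by
    have hent : ∀ i j, ContDiffAt ℝ 1 (fun s : ℝ => (g x + s • h x) i j) 0 := by
      intro i j
      simp only [Matrix.add_apply, Matrix.smul_apply, smul_eq_mul]
      fun_prop
    exact (contDiffAt_det hent).continuousAt.eventually_ne (by simpa using hdet)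
  -- The jet formula for the curvature needs an invertible metric, which is available only for s
  -- near 0.
  have hfun : (fun s : ℝ => riemann (fun y => g y + s • h y) x a b c f) =ᶠ[𝓝 0]
      fun s => curvJet (invMetric (fun y => g y + s • h y) x)
        (fun c a b => metricD g x c a b + s * metricD h x c a b)
        (fun c e a b => metricD2 g x c e a b + s * metricD2 h x c e a b) a b c f := by
    filter_upwards [hdet'] with s hs
    rw [riemann_eq_curvJet (hgc s) _ hs, hD, hD2]
    intro y a b
    simp only [Matrix.add_apply, Matrix.smul_apply, hgs y a b, hhs y a b]
  refine (hcurv.congr_of_eventuallyEq hfun).congr_deriv ?_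
  have hus : ∀ a b, invMetric g x a b = invMetric g x b a := by
    intro a b
    have : (g x).transpose = g x := by ext i j; exact hgs x j i
    change (g x)⁻¹ a b = (g x)⁻¹.transpose a b
    rw [Matrix.transpose_nonsing_inv, this]
  have hz : invMetric (fun y => g y + (0 : ℝ) • h y) x = invMetric g x := by
    simp only [zero_smul, add_zero]
  -- In each bilinear term the inverse metric raises a background factor; in the term from the
  -- varied inverse metric both background factors are raised.
  have q1 : ∀ a b c f : Fin (d + 1), ∀ D : Fin (d + 1) → Tensor2 d, ∑ m, ∑ n, invMetric g x m n *
      (lowChristoffel D m a f * lowChristoffel (metricD g x) n b c)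
      = ∑ m, lowChristoffel D m a f * christoffel g b c m x := by
    intro a b c f D
    refine Finset.sum_congr rfl fun m _ => ?_
    rw [christoffel_eq, Finset.mul_sum]
    exact Finset.sum_congr rfl fun e _ => by ring
  have q2 : ∀ a b c f : Fin (d + 1), ∀ D : Fin (d + 1) → Tensor2 d, ∑ m, ∑ n, invMetric g x m n *
      (lowChristoffel (metricD g x) m a f * lowChristoffel D n b c)
      = ∑ m, lowChristoffel D m b c * christoffel g a f m x := by
    intro a b c f D
    rw [Finset.sum_comm, ← q1]
    refine Finset.sum_congr rfl fun m _ => Finset.sum_congr rfl fun n _ => ?_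
    rw [hus n m]; ring
  have q3 : ∀ a b c f : Fin (d + 1), ∑ m, ∑ n, invVar (invMetric g x) (h x) m n *
      (lowChristoffel (metricD g x) m a f * lowChristoffel (metricD g x) n b c)
      = - ∑ m, ∑ n, h x m n * (christoffel g a f m x * christoffel g b c n x) := by
    intro a b c f
    simp only [invVar, neg_mul, Finset.sum_neg_distrib, christoffel_eq]
    exact congrArg Neg.neg (sum_congruence hus _ _)
  simp only [curvVar, hz, mul_add, mul_sub, Finset.sum_add_distrib, Finset.sum_sub_distrib, q1, q2,
    q3]
  ring

/-- The first variation of the Lagrangian density in terms of the derivative of the Lagrangian. -/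
theorem GravityTheory.firstVariation_eq (L : GravityTheory d) {g h : MetricField d} {x : Chart d}
    (hg : ∀ a b, ContDiffAt ℝ 2 (fun y => g y a b) x) (hgs : ∀ y a b, g y a b = g y b a)
    (hh : ∀ a b, ContDiffAt ℝ 2 (fun y => h y a b) x) (hhs : ∀ y a b, h y a b = h y b a)
    (hdet : (g x).det ≠ 0) (hdef : L.DefinedAt g x) :
    L.firstVariation g h x = Real.sqrt |(g x).det| *
      ((1 / 2) * ((g x)⁻¹ * h x).trace * L.eval g x
        + fderiv ℝ L.lagrangian (invMetric g x, riemann g x)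
          (invVar (invMetric g x) (h x), curvVar (fun a b e => christoffel g a b e x) (h x)
            (metricD h x) (metricD2 h x))) := by
  have hL : DifferentiableAt ℝ L.lagrangian (invMetric g x, riemann g x) :=
    (L.contDiffOn_lagrangian.contDiffAt (L.isOpen_domain.mem_nhds hdef)).differentiableAt
      (by simp)
  have hz : (fun y => g y + (0 : ℝ) • h y) = g := by funext y; simp
  have h1 := hasDerivAt_jet hg hgs hh hhs hdet
  have h2 : HasDerivAt (fun s : ℝ => L.eval (fun y => g y + s • h y) x)
      (fderiv ℝ L.lagrangian (invMetric g x, riemann g x)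
          (invVar (invMetric g x) (h x), curvVar (fun a b e => christoffel g a b e x) (h x)
            (metricD h x) (metricD2 h x))) 0 := by
    refine HasFDerivAt.comp_hasDerivAt (l := L.lagrangian) (0 : ℝ) ?_ h1
    simp only [hz]
    exact hL.hasFDerivAt
  have h3 := ((hasDerivAt_sqrt_abs_det (g x) (h x) hdet).fun_mul h2).deriv
  simp only [zero_smul, add_zero] at h3
  unfold GravityTheory.firstVariation GravityTheory.density
  refine h3.trans ?_
  ring

end Variation

/-! ### The spatial geometry of the FLRW metrics -/

section Spatial

variable {d : ℕ}

/-- The Kronecker symbol. -/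
def kron (i j : Fin d) : ℝ := if i = j then 1 else 0

theorem kron_comm (i j : Fin d) : kron i j = kron j i := by
  simp only [kron, eq_comm]

theorem sum_kron_mul (i : Fin d) (f : Fin d → ℝ) : ∑ j, kron i j * f j = f i := by
  simp [kron]

theorem sum_mul_kron (i : Fin d) (f : Fin d → ℝ) : ∑ j, f j * kron i j = f i := by
  simp [kron]

theorem sum_kron_mul' (i : Fin d) (f : Fin d → ℝ) : ∑ j, kron j i * f j = f i := by
  simp [kron]

theorem sum_mul_kron' (i : Fin d) (f : Fin d → ℝ) : ∑ j, f j * kron j i = f i := by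
  simp [kron]

theorem sum_kron_self : ∑ i : Fin d, kron i i = d := by
  simp [kron]

/-- The function `1 / (1 - k r²)`. -/
def conf (k : ℝ) (x : Chart d) : ℝ := (1 - k * radiusSq x)⁻¹

/-- The spatial volume density `1 / √(1 - k r²)`. -/
def rho (k : ℝ) (x : Chart d) : ℝ := (Real.sqrt (1 - k * radiusSq x))⁻¹

/-- The spatial metric `γ_{ij} = δ_{ij} + k x_i x_j / (1 - k r²)`. -/
def spaceMetric (k : ℝ) (i j : Fin d) (x : Chart d) : ℝ :=
  kron i j + k * (x i.succ * x j.succ * conf k x)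

/-- The inverse spatial metric `γ^{ij} = δ_{ij} - k x_i x_j`. -/
def spaceInv (k : ℝ) (i j : Fin d) (x : Chart d) : ℝ :=
  kron i j - k * (x i.succ * x j.succ)

/-- The spatial position vector with its index lowered. -/
def lowPos (k : ℝ) (i : Fin d) (x : Chart d) : ℝ := x i.succ * conf k x

variable {k : ℝ} {x : Chart d}

theorem spaceMetric_comm (i j : Fin d) : spaceMetric k i j x = spaceMetric k j i x := by
  simp only [spaceMetric, kron_comm i j]; ring

theorem spaceInv_comm (i j : Fin d) : spaceInv k i j x = spaceInv k j i x := by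
  simp only [spaceInv, kron_comm i j]; ring

theorem conf_mul (hx : InFLRWChart k x) : conf k x * (1 - k * radiusSq x) = 1 :=
  inv_mul_cancel₀ (ne_of_gt hx)

theorem rho_pos (hx : InFLRWChart k x) : 0 < rho k x := inv_pos.2 (Real.sqrt_pos.2 hx)

theorem rho_sq (hx : InFLRWChart k x) : rho k x ^ 2 = conf k x := by
  rw [rho, conf, inv_pow, Real.sq_sqrt (le_of_lt hx)]

theorem sum_pos_mul_pos : ∑ i : Fin d, x i.succ * x i.succ = radiusSq x := by
  simp only [radiusSq, sq]

theorem sum_spaceMetric_mul_pos (hx : InFLRWChart k x) (i : Fin d) :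
    ∑ j : Fin d, spaceMetric k i j x * x j.succ = lowPos k i x := by
  have h := conf_mul hx
  have : ∀ j : Fin d, spaceMetric k i j x * x j.succ
      = kron i j * x j.succ + k * x i.succ * conf k x * (x j.succ * x j.succ) := by
    intro j; simp only [spaceMetric]; ring
  simp only [this, Finset.sum_add_distrib, ← Finset.mul_sum, sum_kron_mul, sum_pos_mul_pos, lowPos]
  linear_combination -(x i.succ) * h

theorem sum_spaceInv_mul_lowPos (hx : InFLRWChart k x) (i : Fin d) :
    ∑ j : Fin d, spaceInv k i j x * lowPos k j x = x i.succ := by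
  have h := conf_mul hx
  have : ∀ j : Fin d, spaceInv k i j x * lowPos k j x
      = kron i j * (x j.succ * conf k x) - k * x i.succ * conf k x * (x j.succ * x j.succ) := by
    intro j; simp only [spaceInv, lowPos]; ring
  simp only [this, Finset.sum_sub_distrib, ← Finset.mul_sum, sum_kron_mul, sum_pos_mul_pos]
  linear_combination (x i.succ) * h

/-- Sherman–Morrison for the rank-one perturbation of the identity by k x xᵀ / (1 - k r²). -/
theorem sum_spaceInv_mul_spaceMetric (hx : InFLRWChart k x) (i l : Fin d) :
    ∑ j : Fin d, spaceInv k i j x * spaceMetric k j l x = kron i l := by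
  have h := sum_spaceInv_mul_lowPos hx i
  have : ∀ j : Fin d, spaceInv k i j x * spaceMetric k j l x
      = spaceInv k i j x * kron j l + k * x l.succ * (spaceInv k i j x * lowPos k j x) := by
    intro j; simp only [spaceMetric, lowPos]; ring
  simp only [this, Finset.sum_add_distrib, ← Finset.mul_sum, h, sum_mul_kron']
  simp only [spaceInv]; ring

theorem sum_spaceMetric_mul_spaceInv (hx : InFLRWChart k x) (i l : Fin d) :
    ∑ j : Fin d, spaceMetric k i j x * spaceInv k j l x = kron i l := by
  rw [kron_comm, ← sum_spaceInv_mul_spaceMetric hx l i]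
  exact Finset.sum_congr rfl fun j _ => by
    rw [spaceMetric_comm i j, spaceInv_comm j l]; ring

/-! Derivatives of the spatial geometry. -/

theorem contDiff_coord {m : ℕ∞ω} (i : Fin (d + 1)) : ContDiff ℝ m (fun y : Chart d => y i) :=
  contDiff_apply ℝ ℝ i

theorem contDiff_radiusSq {m : ℕ∞ω} : ContDiff ℝ m (radiusSq : Chart d → ℝ) :=
  ContDiff.sum fun i _ => (contDiff_coord i.succ).pow 2

theorem contDiffAt_conf {m : ℕ∞ω} (hx : InFLRWChart k x) : ContDiffAt ℝ m (conf k) x :=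
  (contDiffAt_const.sub (contDiffAt_const.mul contDiff_radiusSq.contDiffAt)).inv (ne_of_gt hx)

theorem contDiffAt_rho {m : ℕ∞ω} (hx : InFLRWChart k x) : ContDiffAt ℝ m (rho k) x :=
  ((contDiffAt_const.sub (contDiffAt_const.mul contDiff_radiusSq.contDiffAt)).sqrt
    (ne_of_gt hx)).inv (ne_of_gt (Real.sqrt_pos.2 hx))

theorem contDiffAt_spaceMetric {m : ℕ∞ω} (hx : InFLRWChart k x) (i j : Fin d) :
    ContDiffAt ℝ m (spaceMetric k i j) x :=
  contDiffAt_const.add (contDiffAt_const.mul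
    (((contDiff_coord _).contDiffAt.mul (contDiff_coord _).contDiffAt).mul (contDiffAt_conf hx)))

theorem contDiff_spaceInv {m : ℕ∞ω} (i j : Fin d) :
    ContDiff ℝ m (spaceInv k i j : Chart d → ℝ) :=
  contDiff_const.sub (contDiff_const.mul ((contDiff_coord _).mul (contDiff_coord _)))

theorem differentiableAt_coord (i : Fin (d + 1)) :
    DifferentiableAt ℝ (fun y : Chart d => y i) x :=
  (contDiff_coord (m := 1) i).contDiffAt.differentiableAt (by norm_num)

theorem differentiableAt_radiusSq : DifferentiableAt ℝ (radiusSq : Chart d → ℝ) x :=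
  (contDiff_radiusSq (m := 1)).contDiffAt.differentiableAt (by norm_num)

theorem differentiableAt_conf (hx : InFLRWChart k x) : DifferentiableAt ℝ (conf k) x :=
  (contDiffAt_conf (m := 1) hx).differentiableAt (by norm_num)

theorem differentiableAt_rho (hx : InFLRWChart k x) : DifferentiableAt ℝ (rho k) x :=
  (contDiffAt_rho (m := 1) hx).differentiableAt (by norm_num)

theorem differentiableAt_spaceMetric (hx : InFLRWChart k x) (i j : Fin d) :
    DifferentiableAt ℝ (spaceMetric k i j) x :=
  (contDiffAt_spaceMetric (m := 1) hx i j).differentiableAt (by norm_num)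

theorem differentiableAt_spaceInv (i j : Fin d) :
    DifferentiableAt ℝ (spaceInv k i j : Chart d → ℝ) x :=
  (contDiff_spaceInv (m := 1) i j).contDiffAt.differentiableAt (by norm_num)

theorem pd_coord (c i : Fin (d + 1)) :
    pd c (fun y : Chart d => y i) x = if i = c then 1 else 0 := by
  have h : HasFDerivAt (fun y : Chart d => y i) (ContinuousLinearMap.proj i) x :=
    (ContinuousLinearMap.proj (R := ℝ) (φ := fun _ : Fin (d + 1) => ℝ) i).hasFDerivAt
  rw [pd, h.fderiv]
  simp [Pi.single_apply]

theorem pd_succ_coord (i j : Fin d) : pd i.succ (fun y : Chart d => y j.succ) x = kron j i := by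
  rw [pd_coord]; simp [kron]

theorem pd_zero_coord (j : Fin d) : pd 0 (fun y : Chart d => y j.succ) x = 0 := by
  rw [pd_coord]; simp

theorem hasFDerivAt_time {f : ℝ → ℝ} (hf : DifferentiableAt ℝ f (x 0)) :
    HasFDerivAt (fun y : Chart d => f (y 0))
      (deriv f (x 0) • (ContinuousLinearMap.proj 0 : Chart d →L[ℝ] ℝ)) x :=
  HasDerivAt.comp_hasFDerivAt (h₂ := f) (f := fun y : Chart d => y 0) x hf.hasDerivAt
    (ContinuousLinearMap.proj (R := ℝ) (φ := fun _ : Fin (d + 1) => ℝ) 0).hasFDerivAt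

theorem differentiableAt_time {f : ℝ → ℝ} (hf : DifferentiableAt ℝ f (x 0)) :
    DifferentiableAt ℝ (fun y : Chart d => f (y 0)) x := (hasFDerivAt_time hf).differentiableAt

theorem contDiffAt_time {m : ℕ∞ω} {f : ℝ → ℝ} (hf : ContDiffAt ℝ m f (x 0)) :
    ContDiffAt ℝ m (fun y : Chart d => f (y 0)) x :=
  ContDiffAt.comp (g := f) x hf (contDiff_coord 0).contDiffAt

theorem pd_zero_time {f : ℝ → ℝ} (hf : DifferentiableAt ℝ f (x 0)) :
    pd 0 (fun y : Chart d => f (y 0)) x = deriv f (x 0) := by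
  rw [pd, (hasFDerivAt_time hf).fderiv]; simp

theorem pd_succ_time {f : ℝ → ℝ} (hf : DifferentiableAt ℝ f (x 0)) (i : Fin d) :
    pd i.succ (fun y : Chart d => f (y 0)) x = 0 := by
  rw [pd, (hasFDerivAt_time hf).fderiv]; simp

theorem pd_succ_radiusSq (i : Fin d) : pd i.succ radiusSq x = 2 * x i.succ := by
  have h : (radiusSq : Chart d → ℝ) = fun y => ∑ j : Fin d, y j.succ * y j.succ := by
    funext y; simp only [radiusSq, sq]
  rw [h, pd_sum fun j _ => (differentiableAt_coord _).fun_mul (differentiableAt_coord _)]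
  simp only [pd_mul (differentiableAt_coord _) (differentiableAt_coord _), pd_succ_coord]
  simp only [Finset.sum_add_distrib, sum_mul_kron', sum_kron_mul']; ring

theorem pd_zero_radiusSq : pd 0 radiusSq x = 0 := by
  have h : (radiusSq : Chart d → ℝ) = fun y => ∑ j : Fin d, y j.succ * y j.succ := by
    funext y; simp only [radiusSq, sq]
  rw [h, pd_sum fun j _ => (differentiableAt_coord _).fun_mul (differentiableAt_coord _)]
  simp only [pd_mul (differentiableAt_coord _) (differentiableAt_coord _), pd_zero_coord]
  simp

theorem hasFDerivAt_lapse : HasFDerivAt (fun y : Chart d => 1 - k * radiusSq y)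
    (-(k • fderiv ℝ radiusSq x)) x := by
  have := (differentiableAt_radiusSq (x := x)).hasFDerivAt.const_mul k
  exact this.const_sub 1

theorem pd_conf (hx : InFLRWChart k x) (c : Fin (d + 1)) :
    pd c (conf k) x = conf k x ^ 2 * (k * pd c radiusSq x) := by
  have h := HasDerivAt.comp_hasFDerivAt (h₂ := fun s : ℝ => s⁻¹)
    (f := fun y : Chart d => 1 - k * radiusSq y) x (hasDerivAt_inv (ne_of_gt hx)) hasFDerivAt_lapse
  have h' : fderiv ℝ (conf k) x = _ := h.fderiv
  rw [pd, h', pd, conf]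
  simp

theorem pd_rho (hx : InFLRWChart k x) (c : Fin (d + 1)) :
    pd c (rho k) x = rho k x * conf k x * (k / 2 * pd c radiusSq x) := by
  have h1 : HasFDerivAt (fun y : Chart d => Real.sqrt (1 - k * radiusSq y)) _ x :=
    hasFDerivAt_lapse.sqrt (ne_of_gt hx)
  have h := HasDerivAt.comp_hasFDerivAt (h₂ := fun s : ℝ => s⁻¹)
    (f := fun y : Chart d => Real.sqrt (1 - k * radiusSq y)) x
      (hasDerivAt_inv (ne_of_gt (Real.sqrt_pos.2 hx))) h1
  have h' : fderiv ℝ (rho k) x = _ := h.fderiv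
  rw [pd, h', pd, ← rho_sq hx, rho]
  simp
  ring

theorem pd_succ_rho (hx : InFLRWChart k x) (i : Fin d) :
    pd i.succ (rho k) x = k * rho k x * lowPos k i x := by
  rw [pd_rho hx, pd_succ_radiusSq, lowPos]; ring

theorem pd_zero_rho (hx : InFLRWChart k x) : pd 0 (rho k) x = 0 := by
  rw [pd_rho hx, pd_zero_radiusSq]; ring

theorem pd_zero_spaceMetric (hx : InFLRWChart k x) (i j : Fin d) :
    pd 0 (spaceMetric k i j) x = 0 := by
  have h : spaceMetric k i j = fun y : Chart d =>
    kron i j + k * (y i.succ * y j.succ * conf k y) := rfl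
  have h1 := differentiableAt_coord (x := x) i.succ
  have h2 := differentiableAt_coord (x := x) j.succ
  have h3 := differentiableAt_conf hx
  rw [h, pd_add (differentiableAt_const _) (((h1.fun_mul h2).fun_mul h3).const_mul k),
    pd_const, pd_const_mul ((h1.fun_mul h2).fun_mul h3), pd_mul (h1.fun_mul h2) h3, pd_mul h1 h2,
    pd_conf hx, pd_zero_radiusSq, pd_zero_coord, pd_zero_coord]
  ring

/-- In this form the derivatives of γ combine in the Christoffel formula so that the spatial symbols
become k x^m γ_{ij}. It rests on ∂ of 1/(1 - k r²) being 2k x times its square. -/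
theorem pd_succ_spaceMetric (hx : InFLRWChart k x) (i j l : Fin d) :
    pd l.succ (spaceMetric k i j) x
      = k * (lowPos k i x * spaceMetric k j l x + lowPos k j x * spaceMetric k i l x) := by
  have h : spaceMetric k i j = fun y : Chart d =>
    kron i j + k * (y i.succ * y j.succ * conf k y) := rfl
  have h1 := differentiableAt_coord (x := x) i.succ
  have h2 := differentiableAt_coord (x := x) j.succ
  have h3 := differentiableAt_conf hx
  rw [h, pd_add (differentiableAt_const _) (((h1.fun_mul h2).fun_mul h3).const_mul k),
    pd_const, pd_const_mul ((h1.fun_mul h2).fun_mul h3), pd_mul (h1.fun_mul h2) h3, pd_mul h1 h2,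
    pd_conf hx, pd_succ_radiusSq, pd_succ_coord, pd_succ_coord]
  simp only [spaceMetric, lowPos]
  ring

theorem pd_zero_spaceInv (i j : Fin d) : pd 0 (spaceInv k i j : Chart d → ℝ) x = 0 := by
  have h : spaceInv k i j = fun y : Chart d => kron i j - k * (y i.succ * y j.succ) := rfl
  have h1 := differentiableAt_coord (x := x) i.succ
  have h2 := differentiableAt_coord (x := x) j.succ
  rw [h, pd_sub (differentiableAt_const _) ((h1.fun_mul h2).const_mul k),
    pd_const, pd_const_mul (h1.fun_mul h2), pd_mul h1 h2, pd_zero_coord, pd_zero_coord]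
  ring

theorem pd_succ_spaceInv (i j l : Fin d) : pd l.succ (spaceInv k i j : Chart d → ℝ) x
    = - k * (kron i l * x j.succ + x i.succ * kron j l) := by
  have h : spaceInv k i j = fun y : Chart d => kron i j - k * (y i.succ * y j.succ) := rfl
  have h1 := differentiableAt_coord (x := x) i.succ
  have h2 := differentiableAt_coord (x := x) j.succ
  rw [h, pd_sub (differentiableAt_const _) ((h1.fun_mul h2).const_mul k),
    pd_const, pd_const_mul (h1.fun_mul h2), pd_mul h1 h2, pd_succ_coord, pd_succ_coord]
  ring

end Spatial

/-! ### Christoffel symbols and curvature of the FLRW metrics -/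

/-- The square of the scale factor. -/
def sqScale (a : ℝ → ℝ) (t : ℝ) : ℝ := a t ^ 2

/-- The Hubble rate `ȧ / a`, in terms of the square of the scale factor. -/
def hubble (a : ℝ → ℝ) (t : ℝ) : ℝ := deriv (sqScale a) t / (2 * sqScale a t)

/-- The rate `Ḟ / (2 F)`. -/
def lapseRate (F : ℝ → ℝ) (t : ℝ) : ℝ := deriv F t / (2 * F t)

/-- The factor `a ȧ / F` of the extrinsic curvature. -/
def expansion (a F : ℝ → ℝ) (t : ℝ) : ℝ := deriv (sqScale a) t / (2 * F t)

/-- The coefficient of `γ_{ij}` in `R_{titj}`, as a function of the jets of `a²` and `F`. -/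
def timeCurv (b b₁ b₂ f f₁ : ℝ) : ℝ := - b₂ / 2 + b₁ ^ 2 / (4 * b) + b₁ * f₁ / (4 * f)

/-- The coefficient of `γ_{ik} γ_{jl} - γ_{il} γ_{jk}` in `R_{ijkl}`, as a function of the jets of
`a²` and `F`. -/
def spaceCurv (k b b₁ f : ℝ) : ℝ := k * b + b₁ ^ 2 / (4 * f)

namespace AdmissibleOn

variable {I : Set ℝ} {a F : ℝ → ℝ} {t : ℝ}

theorem contDiffOn_sqScale (h : AdmissibleOn I a F) : ContDiffOn ℝ ∞ (sqScale a) I :=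
  h.contDiffOn_scale.pow 2

theorem contDiffAt_sqScale (h : AdmissibleOn I a F) (ht : t ∈ I) :
    ContDiffAt ℝ ∞ (sqScale a) t := h.contDiffOn_sqScale.contDiffAt (h.isOpen.mem_nhds ht)

theorem contDiffAt_lapse (h : AdmissibleOn I a F) (ht : t ∈ I) :
    ContDiffAt ℝ ∞ F t := h.contDiffOn_lapse.contDiffAt (h.isOpen.mem_nhds ht)

theorem contDiffAt_deriv {f : ℝ → ℝ} (hf : ContDiffAt ℝ ∞ f t) : ContDiffAt ℝ ∞ (deriv f) t := by
  have h1 : ContDiffAt ℝ ∞ (fun s => fderiv ℝ f s 1) t :=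
    (hf.fderiv_right (m := ∞) (by simp)).clm_apply contDiffAt_const
  exact h1

theorem sqScale_pos (h : AdmissibleOn I a F) (ht : t ∈ I) : 0 < sqScale a t :=
  pow_pos (h.scale_pos t ht) 2

theorem contDiffAt_hubble (h : AdmissibleOn I a F) (ht : t ∈ I) : ContDiffAt ℝ ∞ (hubble a) t :=
  (contDiffAt_deriv (h.contDiffAt_sqScale ht)).div
    (contDiffAt_const.mul (h.contDiffAt_sqScale ht)) (by have := h.sqScale_pos ht; positivity)

theorem contDiffAt_lapseRate (h : AdmissibleOn I a F) (ht : t ∈ I) :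
    ContDiffAt ℝ ∞ (lapseRate F) t :=
  (contDiffAt_deriv (h.contDiffAt_lapse ht)).div
    (contDiffAt_const.mul (h.contDiffAt_lapse ht)) (by have := h.lapse_pos t ht; positivity)

theorem contDiffAt_expansion (h : AdmissibleOn I a F) (ht : t ∈ I) :
    ContDiffAt ℝ ∞ (expansion a F) t :=
  (contDiffAt_deriv (h.contDiffAt_sqScale ht)).div
    (contDiffAt_const.mul (h.contDiffAt_lapse ht)) (by have := h.lapse_pos t ht; positivity)

theorem deriv_hubble (h : AdmissibleOn I a F) (ht : t ∈ I) :
    deriv (hubble a) t = deriv (deriv (sqScale a)) t / (2 * sqScale a t)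
      - deriv (sqScale a) t ^ 2 / (2 * sqScale a t ^ 2) := by
  have hb := h.contDiffAt_sqScale ht
  have hp := h.sqScale_pos ht
  have := ((contDiffAt_deriv hb).differentiableAt (by simp)).hasDerivAt.fun_div
    ((hb.differentiableAt (by simp)).hasDerivAt.const_mul 2) (by positivity)
  refine this.deriv.trans ?_
  field_simp

theorem deriv_expansion (h : AdmissibleOn I a F) (ht : t ∈ I) :
    deriv (expansion a F) t = deriv (deriv (sqScale a)) t / (2 * F t)
      - deriv (sqScale a) t * deriv F t / (2 * F t ^ 2) := by
  have hb := h.contDiffAt_sqScale ht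
  have hF := h.contDiffAt_lapse ht
  have hp := h.lapse_pos t ht
  have := ((contDiffAt_deriv hb).differentiableAt (by simp)).hasDerivAt.fun_div
    ((hF.differentiableAt (by simp)).hasDerivAt.const_mul 2) (by positivity)
  refine this.deriv.trans ?_
  field_simp

end AdmissibleOn

section FLRW

variable {d : ℕ}

/-- The components of `dt`. -/
def timeArr (a : Fin (d + 1)) : ℝ := if a = 0 then 1 else 0

/-- A spatial array with two indices, extended by zero. -/
def spaceArr (s : Fin d → Fin d → ℝ) : Tensor2 d := fun a b =>
  Fin.cases 0 (fun i => Fin.cases 0 (fun j => s i j) b) a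

@[simp] theorem timeArr_zero : timeArr (0 : Fin (d + 1)) = 1 := by simp [timeArr]

@[simp] theorem timeArr_succ (i : Fin d) : timeArr i.succ = 0 := by simp [timeArr]

@[simp] theorem spaceArr_zero_left (s : Fin d → Fin d → ℝ) (a : Fin (d + 1)) :
    spaceArr s 0 a = 0 := rfl

@[simp] theorem spaceArr_zero_right (s : Fin d → Fin d → ℝ) (a : Fin (d + 1)) :
    spaceArr s a 0 = 0 := by
  cases a using Fin.cases <;> rfl

@[simp] theorem spaceArr_succ (s : Fin d → Fin d → ℝ) (i j : Fin d) :
    spaceArr s i.succ j.succ = s i j := rfl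

/-- The array `α dt dt + β s`. -/
def blockInv (s : Fin d → Fin d → ℝ) (α β : ℝ) : Tensor2 d := fun a b =>
  α * (timeArr a * timeArr b) + β * spaceArr s a b

/-- The curvature array with `R_{titj} = X s_{ij}` and
`R_{ijkl} = Y (s_{ik} s_{jl} - s_{il} s_{jk})`. -/
def blockCurv (s : Fin d → Fin d → ℝ) (X Y : ℝ) : Tensor4 d := fun a b c f =>
  X * (timeArr a * timeArr c * spaceArr s b f - timeArr b * timeArr c * spaceArr s a f
    - timeArr a * timeArr f * spaceArr s b c + timeArr b * timeArr f * spaceArr s a c)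
  + Y * (spaceArr s a c * spaceArr s b f - spaceArr s a f * spaceArr s b c)

variable {k : ℝ} {a F : ℝ → ℝ} {I : Set ℝ} {x : Chart d}

@[simp] theorem flrw_zero_zero : flrw k a F x 0 0 = - F (x 0) := by simp [flrw]

@[simp] theorem flrw_zero_succ (i : Fin d) : flrw k a F x 0 i.succ = 0 := by simp [flrw]

@[simp] theorem flrw_succ_zero (i : Fin d) : flrw k a F x i.succ 0 = 0 := by simp [flrw]

@[simp] theorem flrw_succ_succ (i j : Fin d) :
    flrw k a F x i.succ j.succ = sqScale a (x 0) * spaceMetric k i j x := by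
  simp only [flrw, Matrix.of_apply, Fin.succ_ne_zero, if_false, Fin.succ_inj, sqScale,
    spaceMetric, kron, conf]
  split_ifs <;> ring

theorem flrw_comm (y : Chart d) (i j : Fin (d + 1)) : flrw k a F y i j = flrw k a F y j i := by
  cases i using Fin.cases <;> cases j using Fin.cases <;> simp [spaceMetric_comm]

theorem isOpen_inFLRWChart : IsOpen {x : Chart d | InFLRWChart k x} := by
  have h : Continuous fun x : Chart d => 1 - k * radiusSq x :=
    continuous_const.sub (continuous_const.mul (contDiff_radiusSq (m := 0)).continuous)
  exact isOpen_lt continuous_const h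

theorem eventually_inFLRWChart (hI : AdmissibleOn I a F) (ht : x 0 ∈ I) (hx : InFLRWChart k x) :
    ∀ᶠ y in 𝓝 x, y 0 ∈ I ∧ InFLRWChart k y :=
  ((continuous_apply 0).continuousAt.eventually (hI.isOpen.mem_nhds ht)).and
    (isOpen_inFLRWChart.mem_nhds hx)

theorem contDiffAt_flrw (hI : AdmissibleOn I a F) (ht : x 0 ∈ I) (hx : InFLRWChart k x)
    (i j : Fin (d + 1)) : ContDiffAt ℝ ∞ (fun y => flrw k a F y i j) x := by
  cases i using Fin.cases <;> cases j using Fin.cases <;>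
    simp only [flrw_zero_zero, flrw_zero_succ, flrw_succ_zero, flrw_succ_succ]
  · exact (contDiffAt_time (hI.contDiffAt_lapse ht)).neg
  · exact contDiffAt_const
  · exact contDiffAt_const
  · exact (contDiffAt_time (hI.contDiffAt_sqScale ht)).mul (contDiffAt_spaceMetric hx _ _)

theorem flrw_mul_blockInv (hI : AdmissibleOn I a F) (ht : x 0 ∈ I) (hx : InFLRWChart k x) :
    flrw k a F x * Matrix.of (blockInv (fun i j => spaceInv k i j x)
      (-(F (x 0))⁻¹) (sqScale a (x 0))⁻¹) = 1 := by
  have hb := hI.sqScale_pos ht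
  have hF := hI.lapse_pos _ ht
  ext i j
  rw [Matrix.mul_apply, Fin.sum_univ_succ]
  have h := sum_spaceMetric_mul_spaceInv hx
  cases i using Fin.cases with
  | zero => cases j using Fin.cases with
    | zero => simp [blockInv, hF.ne']
    | succ j => simp [blockInv, Fin.succ_ne_zero, eq_comm]
  | succ i => cases j using Fin.cases with
    | zero => simp [blockInv]
    | succ j =>
      simp only [flrw_succ_zero, zero_mul, flrw_succ_succ, Matrix.of_apply, blockInv,
        timeArr_succ, mul_zero, zero_add, spaceArr_succ]
      have : ∀ m, sqScale a (x 0) * spaceMetric k i m x * ((sqScale a (x 0))⁻¹ * spaceInv k m j x)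
          = spaceMetric k i m x * spaceInv k m j x := fun m => by field_simp
      simp only [this, h, kron, Matrix.one_apply, Fin.succ_inj]

theorem invMetric_flrw (hI : AdmissibleOn I a F) (ht : x 0 ∈ I) (hx : InFLRWChart k x) :
    invMetric (flrw k a F) x = blockInv (fun i j => spaceInv k i j x)
      (-(F (x 0))⁻¹) (sqScale a (x 0))⁻¹ := by
  have h := Matrix.inv_eq_right_inv (flrw_mul_blockInv hI ht hx)
  funext i j
  simp only [invMetric, h, Matrix.of_apply]

theorem det_flrw_ne_zero (hI : AdmissibleOn I a F) (ht : x 0 ∈ I) (hx : InFLRWChart k x) :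
    (flrw k a F x).det ≠ 0 := by
  have h := congrArg Matrix.det (flrw_mul_blockInv hI ht hx)
  rw [Matrix.det_mul, Matrix.det_one] at h
  exact left_ne_zero_of_mul_eq_one h

/-- Expansion along the time row leaves a multiple of a rank-one perturbation of the identity, to
which the matrix determinant lemma applies. -/
theorem det_flrw (hx : InFLRWChart k x) :
    (flrw k a F x).det = - (F (x 0) * sqScale a (x 0) ^ d * rho k x ^ 2) := by
  have hsub : (flrw k a F x).submatrix Fin.succ Fin.succ = sqScale a (x 0) • (1 +
      Matrix.replicateCol Unit (fun i : Fin d => k * conf k x * x i.succ) *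
        Matrix.replicateRow Unit (fun i : Fin d => x i.succ)) := by
    ext i j
    simp only [Matrix.submatrix_apply, flrw_succ_succ, spaceMetric, kron, Matrix.smul_apply,
      Matrix.add_apply, Matrix.one_apply, Matrix.mul_apply, Matrix.replicateCol_apply,
      Matrix.replicateRow_apply, Finset.univ_unique, Finset.sum_singleton, smul_eq_mul]
    ring
  rw [Matrix.det_succ_row_zero, Fin.sum_univ_succ]
  simp only [flrw_zero_zero, flrw_zero_succ, Fin.succAbove_zero, hsub, Matrix.det_smul,
    Matrix.det_one_add_replicateCol_mul_replicateRow]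
  have h1 : (fun i : Fin d => x i.succ) ⬝ᵥ (fun i : Fin d => k * conf k x * x i.succ)
      = k * conf k x * radiusSq x := by
    simp only [dotProduct, ← sum_pos_mul_pos, Finset.mul_sum]
    exact Finset.sum_congr rfl fun i _ => by ring
  have h2 : 1 + k * conf k x * radiusSq x = rho k x ^ 2 := by
    rw [rho_sq hx]
    linear_combination - conf_mul hx
  simp [h1, h2]
  ring

/-! Christoffel symbols -/

theorem metricD_flrw_time (hI : AdmissibleOn I a F) (ht : x 0 ∈ I) (hx : InFLRWChart k x)
    (i j : Fin (d + 1)) : metricD (flrw k a F) x 0 i j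
      = - deriv F (x 0) * (timeArr i * timeArr j)
        + deriv (sqScale a) (x 0) * spaceArr (fun i j => spaceMetric k i j x) i j := by
  have hF := (hI.contDiffAt_lapse ht).differentiableAt (by simp)
  have hb := (hI.contDiffAt_sqScale ht).differentiableAt (by simp)
  cases i using Fin.cases <;> cases j using Fin.cases <;>
    simp only [metricD, flrw_zero_zero, flrw_zero_succ, flrw_succ_zero, flrw_succ_succ, pd_neg,
      pd_zero_time hF, pd_const, pd_mul (differentiableAt_time hb)
      (differentiableAt_spaceMetric hx _ _), pd_zero_time hb, pd_zero_spaceMetric hx,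
      timeArr_zero, timeArr_succ, spaceArr_zero_left, spaceArr_zero_right, spaceArr_succ] <;> ring

theorem metricD_flrw_space (hI : AdmissibleOn I a F) (ht : x 0 ∈ I) (hx : InFLRWChart k x)
    (l : Fin d) (i j : Fin (d + 1)) : metricD (flrw k a F) x l.succ i j
      = sqScale a (x 0) * spaceArr (fun i j => k * (lowPos k i x * spaceMetric k j l x
        + lowPos k j x * spaceMetric k i l x)) i j := by
  have hF := (hI.contDiffAt_lapse ht).differentiableAt (by simp)
  have hb := (hI.contDiffAt_sqScale ht).differentiableAt (by simp)
  cases i using Fin.cases <;> cases j using Fin.cases <;>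
    simp only [metricD, flrw_zero_zero, flrw_zero_succ, flrw_succ_zero, flrw_succ_succ, pd_neg,
      pd_succ_time hF, pd_const, pd_mul (differentiableAt_time hb)
      (differentiableAt_spaceMetric hx _ _), pd_succ_time hb, pd_succ_spaceMetric hx,
      spaceArr_zero_left, spaceArr_zero_right, spaceArr_succ] <;> ring

theorem christoffel_flrw_upper_time (hI : AdmissibleOn I a F) (ht : x 0 ∈ I)
    (hx : InFLRWChart k x) (i j : Fin (d + 1)) : christoffel (flrw k a F) i j 0 x
      = lapseRate F (x 0) * (timeArr i * timeArr j)
        + expansion a F (x 0) * spaceArr (fun i j => spaceMetric k i j x) i j := by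
  have hF := (hI.lapse_pos _ ht).ne'
  rw [christoffel_eq, invMetric_flrw hI ht hx, Fin.sum_univ_succ]
  cases i using Fin.cases <;> cases j using Fin.cases <;>
    simp [blockInv, lowChristoffel, metricD_flrw_time hI ht hx, metricD_flrw_space hI ht hx,
      lapseRate, expansion] <;> field_simp

theorem christoffel_flrw_zero_zero_succ (hI : AdmissibleOn I a F) (ht : x 0 ∈ I)
    (hx : InFLRWChart k x) (m : Fin d) : christoffel (flrw k a F) 0 0 m.succ x = 0 := by
  rw [christoffel_eq, invMetric_flrw hI ht hx, Fin.sum_univ_succ]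
  simp [blockInv, lowChristoffel, metricD_flrw_time hI ht hx, metricD_flrw_space hI ht hx]

theorem christoffel_flrw_zero_succ_succ (hI : AdmissibleOn I a F) (ht : x 0 ∈ I)
    (hx : InFLRWChart k x) (i m : Fin d) :
    christoffel (flrw k a F) 0 i.succ m.succ x = hubble a (x 0) * kron i m := by
  have hb := (hI.sqScale_pos ht).ne'
  rw [christoffel_eq, invMetric_flrw hI ht hx, Fin.sum_univ_succ]
  simp only [blockInv, timeArr_succ, spaceArr_succ, spaceArr_zero_right, lowChristoffel,
    metricD_flrw_time hI ht hx, metricD_flrw_space hI ht hx, timeArr_zero, spaceArr_zero_left]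
  have h := sum_spaceInv_mul_spaceMetric hx m i
  rw [kron_comm i m, ← h, Finset.mul_sum, hubble]
  simp only [mul_zero, zero_mul, add_zero, zero_add, sub_zero]
  refine Finset.sum_congr rfl fun j _ => ?_
  rw [spaceMetric_comm j i]
  field_simp

theorem christoffel_flrw_succ_zero_succ (hI : AdmissibleOn I a F) (ht : x 0 ∈ I)
    (hx : InFLRWChart k x) (i m : Fin d) :
    christoffel (flrw k a F) i.succ 0 m.succ x = hubble a (x 0) * kron i m := by
  rw [← christoffel_flrw_zero_succ_succ hI ht hx]
  simp only [christoffel, flrw_comm _ i.succ 0]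
  congr 1
  exact Finset.sum_congr rfl fun e _ => by ring

/-- The factor a² cancels. Of the derivatives of γ only 2k times the lowered position vector times
γ_{ij} survives the cyclic combination, and raising its index gives x^m. This factorisation through
γ_{ij} drives all later contractions. -/
theorem christoffel_flrw_succ_succ_succ (hI : AdmissibleOn I a F) (ht : x 0 ∈ I)
    (hx : InFLRWChart k x) (i j m : Fin d) :
    christoffel (flrw k a F) i.succ j.succ m.succ x = k * x m.succ * spaceMetric k i j x := by
  have hb := (hI.sqScale_pos ht).ne'
  rw [christoffel_eq, invMetric_flrw hI ht hx, Fin.sum_univ_succ]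
  simp only [blockInv, timeArr_succ, spaceArr_succ, spaceArr_zero_right, lowChristoffel,
    metricD_flrw_space hI ht hx]
  have h := sum_spaceInv_mul_lowPos hx m
  rw [← h, Finset.mul_sum, Finset.sum_mul]
  simp only [mul_zero, zero_mul, zero_add]
  refine Finset.sum_congr rfl fun l _ => ?_
  rw [spaceMetric_comm l i, spaceMetric_comm l j, spaceMetric_comm j i]
  field_simp
  ring

/-! Curvature -/

theorem pd_zero_mul_space {f : ℝ → ℝ} {s : Chart d → ℝ} (hf : DifferentiableAt ℝ f (x 0))
    (hs : DifferentiableAt ℝ s x) :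
    pd 0 (fun y => f (y 0) * s y) x = f (x 0) * pd 0 s x + deriv f (x 0) * s x := by
  rw [pd_mul (differentiableAt_time hf) hs, pd_zero_time hf]

theorem pd_succ_mul_space {f : ℝ → ℝ} {s : Chart d → ℝ} (hf : DifferentiableAt ℝ f (x 0))
    (hs : DifferentiableAt ℝ s x) (i : Fin d) :
    pd i.succ (fun y => f (y 0) * s y) x = f (x 0) * pd i.succ s x := by
  rw [pd_mul (differentiableAt_time hf) hs, pd_succ_time hf]; ring

/-- The closed form of the symbol holds throughout a neighbourhood in the chart, so it may be
differentiated. The same device serves for the other symbols. -/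
theorem pd_christoffel_upper_time (hI : AdmissibleOn I a F) (ht : x 0 ∈ I)
    (hx : InFLRWChart k x) (c i j : Fin (d + 1)) : pd c (christoffel (flrw k a F) i j 0) x
      = deriv (lapseRate F) (x 0) * (timeArr c * (timeArr i * timeArr j))
        + deriv (expansion a F) (x 0) * timeArr c * spaceArr (fun i j => spaceMetric k i j x) i j
        + expansion a F (x 0) * spaceArr (fun i j => pd c (spaceMetric k i j) x) i j := by
  have hN := (hI.contDiffAt_lapseRate ht).differentiableAt (by simp)
  have hK := (hI.contDiffAt_expansion ht).differentiableAt (by simp)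
  have hev : christoffel (flrw k a F) i j 0 =ᶠ[𝓝 x] fun y => lapseRate F (y 0) *
      (timeArr i * timeArr j)
        + expansion a F (y 0) * spaceArr (fun i j => spaceMetric k i j y) i j := by
    filter_upwards [eventually_inFLRWChart hI ht hx] with y hy
    exact christoffel_flrw_upper_time hI hy.1 hy.2 i j
  rw [pd_congr hev]
  have hs := fun i j => differentiableAt_spaceMetric hx (d := d) i j
  cases i using Fin.cases <;> cases j using Fin.cases <;> cases c using Fin.cases <;>
    simp [pd_const, pd_zero_time hN, pd_succ_time hN, pd_zero_mul_space hK (hs _ _),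
      pd_succ_mul_space hK (hs _ _), pd_zero_spaceMetric hx]

theorem pd_christoffel_zero_zero_succ (hI : AdmissibleOn I a F) (ht : x 0 ∈ I)
    (hx : InFLRWChart k x) (c : Fin (d + 1)) (m : Fin d) :
    pd c (christoffel (flrw k a F) 0 0 m.succ) x = 0 := by
  rw [← pd_const (x := x) 0 c]
  refine pd_congr ?_ c
  filter_upwards [eventually_inFLRWChart hI ht hx] with y hy
  exact christoffel_flrw_zero_zero_succ hI hy.1 hy.2 m

theorem pd_christoffel_zero_succ_succ (hI : AdmissibleOn I a F) (ht : x 0 ∈ I)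
    (hx : InFLRWChart k x) (c : Fin (d + 1)) (i m : Fin d) :
    pd c (christoffel (flrw k a F) 0 i.succ m.succ) x
      = deriv (hubble a) (x 0) * timeArr c * kron i m := by
  have hH := (hI.contDiffAt_hubble ht).differentiableAt (by simp)
  have hev : christoffel (flrw k a F) 0 i.succ m.succ =ᶠ[𝓝 x]
      fun y => hubble a (y 0) * kron i m := by
    filter_upwards [eventually_inFLRWChart hI ht hx] with y hy
    exact christoffel_flrw_zero_succ_succ hI hy.1 hy.2 i m
  rw [pd_congr hev]
  cases c using Fin.cases with
  | zero => rw [pd_zero_mul_space hH (differentiableAt_const _), pd_const]; simp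
  | succ c => rw [pd_succ_mul_space hH (differentiableAt_const _), pd_const]; simp

theorem pd_christoffel_succ_zero_succ (hI : AdmissibleOn I a F) (ht : x 0 ∈ I)
    (hx : InFLRWChart k x) (c : Fin (d + 1)) (i m : Fin d) :
    pd c (christoffel (flrw k a F) i.succ 0 m.succ) x
      = deriv (hubble a) (x 0) * timeArr c * kron i m := by
  rw [← pd_christoffel_zero_succ_succ hI ht hx]
  refine pd_congr ?_ c
  filter_upwards [eventually_inFLRWChart hI ht hx] with y hy
  rw [christoffel_flrw_zero_succ_succ hI hy.1 hy.2, christoffel_flrw_succ_zero_succ hI hy.1 hy.2]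

theorem pd_christoffel_succ_succ_succ (hI : AdmissibleOn I a F) (ht : x 0 ∈ I)
    (hx : InFLRWChart k x) (c : Fin (d + 1)) (i j m : Fin d) :
    pd c (christoffel (flrw k a F) i.succ j.succ m.succ) x
      = k * x m.succ * pd c (spaceMetric k i j) x
        + k * pd c (fun y => y m.succ) x * spaceMetric k i j x := by
  have hev : christoffel (flrw k a F) i.succ j.succ m.succ =ᶠ[𝓝 x]
      fun y => k * y m.succ * spaceMetric k i j y := by
    filter_upwards [eventually_inFLRWChart hI ht hx] with y hy
    exact christoffel_flrw_succ_succ_succ hI hy.1 hy.2 i j m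
  rw [pd_congr hev, pd_mul ((differentiableAt_coord _).const_mul k)
    (differentiableAt_spaceMetric hx i j), pd_const_mul (differentiableAt_coord _)]

/-- The symbols are products of functions of time with γ, δ or x, so each component of the curvature
is a function of time times γ or products of γ and δ. Components with an odd number of time indices
cancel, and the purely spatial ones have constant-curvature form, with k corrected by the extrinsic
term. -/
theorem riemann_flrw {a' : ℝ → ℝ} (hI : AdmissibleOn I a' F) (ht : x 0 ∈ I) (hx : InFLRWChart k x) :
    riemann (flrw k a' F) x = blockCurv (fun i j => spaceMetric k i j x)
      (timeCurv (sqScale a' (x 0)) (deriv (sqScale a') (x 0)) (deriv (deriv (sqScale a')) (x 0))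
        (F (x 0)) (deriv F (x 0)))
      (spaceCurv k (sqScale a' (x 0)) (deriv (sqScale a') (x 0)) (F (x 0))) := by
  have hb := (hI.sqScale_pos ht).ne'
  have hF := (hI.lapse_pos _ ht).ne'
  have hlow : ∀ i : Fin d, ∑ j : Fin d, x j.succ * spaceMetric k i j x = lowPos k i x := by
    intro i
    rw [← sum_spaceMetric_mul_pos hx]
    exact Finset.sum_congr rfl fun j _ => mul_comm _ _
  -- Antisymmetry in the first pair: only the components with at most one ordering of a time index
  -- need computing.
  have hswap : ∀ a b c e, riemannUp (flrw k a' F) a b c e x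
      = - riemannUp (flrw k a' F) b a c e x := by
    intro a b c e
    simp only [riemannUp, Finset.sum_sub_distrib]; ring
  have hs := fun i j : Fin d => spaceMetric_comm (k := k) (x := x) i j
  have h00 : ∀ j m : Fin d, riemannUp (flrw k a' F) 0 j.succ 0 m.succ x
      = (- deriv (hubble a') (x 0) + lapseRate F (x 0) * hubble a' (x 0) - hubble a' (x 0) ^ 2)
        * kron j m := by
    intro j m
    simp only [riemannUp, Fin.sum_univ_succ, pd_christoffel_zero_zero_succ hI ht hx,
      pd_christoffel_succ_zero_succ hI ht hx, christoffel_flrw_upper_time hI ht hx,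
      christoffel_flrw_zero_zero_succ hI ht hx, christoffel_flrw_zero_succ_succ hI ht hx,
      christoffel_flrw_succ_zero_succ hI ht hx, timeArr_zero, timeArr_succ, spaceArr_zero_left,
      spaceArr_zero_right]
    have : ∀ n, hubble a' (x 0) * kron j n * (hubble a' (x 0) * kron n m)
        = hubble a' (x 0) ^ 2 * (kron j n * kron n m) := fun n => by ring
    simp only [zero_mul, zero_sub, this, Finset.sum_neg_distrib, ← Finset.mul_sum, sum_kron_mul]
    ring
  have h00t : ∀ j : Fin d, riemannUp (flrw k a' F) 0 j.succ 0 0 x = 0 := by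
    intro j
    simp [riemannUp, Fin.sum_univ_succ, pd_christoffel_upper_time hI ht hx,
      christoffel_flrw_upper_time hI ht hx, christoffel_flrw_zero_zero_succ hI ht hx]
  have h0it : ∀ j i : Fin d, riemannUp (flrw k a' F) 0 j.succ i.succ 0 x
      = (- deriv (expansion a' F) (x 0) + hubble a' (x 0) * expansion a' F (x 0)
        - lapseRate F (x 0) * expansion a' F (x 0)) * spaceMetric k i j x := by
    intro j i
    simp only [riemannUp, Fin.sum_univ_succ, pd_christoffel_upper_time hI ht hx,
      christoffel_flrw_upper_time hI ht hx, christoffel_flrw_succ_zero_succ hI ht hx,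
      timeArr_zero, timeArr_succ, spaceArr_zero_left, spaceArr_zero_right, spaceArr_succ,
      pd_zero_spaceMetric hx]
    have : ∀ n, hubble a' (x 0) * kron i n * (expansion a' F (x 0) * spaceMetric k j n x)
        = hubble a' (x 0) * expansion a' F (x 0) * (kron i n * spaceMetric k j n x) :=
      fun n => by ring
    simp only [zero_mul, mul_zero, add_zero, zero_add, sub_zero, this, ← Finset.mul_sum,
      sum_kron_mul, hs j i]
    ring
  have h0is : ∀ j i m : Fin d, riemannUp (flrw k a' F) 0 j.succ i.succ m.succ x = 0 := by
    intro j i m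
    simp only [riemannUp, Fin.sum_univ_succ, pd_christoffel_succ_succ_succ hI ht hx,
      pd_christoffel_zero_succ_succ hI ht hx,
      christoffel_flrw_upper_time hI ht hx, christoffel_flrw_succ_zero_succ hI ht hx,
      christoffel_flrw_zero_zero_succ hI ht hx,
      christoffel_flrw_zero_succ_succ hI ht hx, christoffel_flrw_succ_succ_succ hI ht hx,
      timeArr_zero, timeArr_succ, spaceArr_zero_left, spaceArr_zero_right, spaceArr_succ,
      pd_zero_spaceMetric hx, pd_zero_coord]
    have : ∀ n, hubble a' (x 0) * kron i n * (k * x m.succ * spaceMetric k j n x)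
          - k * x n.succ * spaceMetric k i j x * (hubble a' (x 0) * kron n m)
        = hubble a' (x 0) * k * x m.succ * (kron i n * spaceMetric k j n x)
          - k * hubble a' (x 0) * spaceMetric k i j x * (kron n m * x n.succ) :=
      fun n => by ring
    simp only [zero_mul, mul_zero, add_zero, zero_add, sub_zero, this, ← Finset.mul_sum,
      sum_kron_mul, sum_kron_mul', Finset.sum_sub_distrib, hs j i]
    ring
  have hij0t : ∀ i j : Fin d, riemannUp (flrw k a' F) i.succ j.succ 0 0 x = 0 := by
    intro i j
    simp only [riemannUp, Fin.sum_univ_succ, pd_christoffel_upper_time hI ht hx,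
      christoffel_flrw_upper_time hI ht hx, christoffel_flrw_zero_succ_succ hI ht hx,
      timeArr_zero, timeArr_succ, spaceArr_zero_left, spaceArr_zero_right, spaceArr_succ]
    have : ∀ i j n, hubble a' (x 0) * kron i n * (expansion a' F (x 0) * spaceMetric k j n x)
        = hubble a' (x 0) * expansion a' F (x 0) * (kron i n * spaceMetric k j n x) :=
      fun i j n => by ring
    simp only [zero_mul, mul_zero, add_zero, zero_add, sub_zero, this, ← Finset.mul_sum,
      sum_kron_mul, Finset.sum_sub_distrib, hs j i]
    ring
  have hij0s : ∀ i j m : Fin d, riemannUp (flrw k a' F) i.succ j.succ 0 m.succ x = 0 := by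
    intro i j m
    simp only [riemannUp, Fin.sum_univ_succ, pd_christoffel_succ_zero_succ hI ht hx,
      christoffel_flrw_upper_time hI ht hx, christoffel_flrw_zero_succ_succ hI ht hx,
      christoffel_flrw_succ_succ_succ hI ht hx,
      timeArr_zero, timeArr_succ, spaceArr_zero_left, spaceArr_zero_right, spaceArr_succ]
    have : ∀ i j n, hubble a' (x 0) * kron i n * (k * x m.succ * spaceMetric k j n x)
        = hubble a' (x 0) * k * x m.succ * (kron i n * spaceMetric k j n x) :=
      fun i j n => by ring
    simp only [zero_mul, mul_zero, add_zero, zero_add, sub_zero, this, ← Finset.mul_sum,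
      sum_kron_mul, Finset.sum_sub_distrib, hs j i]
    ring
  have hijlt : ∀ i j l : Fin d, riemannUp (flrw k a' F) i.succ j.succ l.succ 0 x = 0 := by
    intro i j l
    simp only [riemannUp, Fin.sum_univ_succ, pd_christoffel_upper_time hI ht hx,
      christoffel_flrw_upper_time hI ht hx, christoffel_flrw_succ_succ_succ hI ht hx,
      timeArr_zero, timeArr_succ, spaceArr_zero_left, spaceArr_zero_right, spaceArr_succ,
      pd_succ_spaceMetric hx]
    have : ∀ i j n : Fin d, k * x n.succ * spaceMetric k l i x
          * (expansion a' F (x 0) * spaceMetric k j n x)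
        = k * spaceMetric k l i x * expansion a' F (x 0) * (x n.succ * spaceMetric k j n x) :=
      fun i j n => by ring
    simp only [zero_mul, mul_zero, add_zero, zero_add, sub_zero, this, ← Finset.mul_sum,
      Finset.sum_sub_distrib, hlow]
    simp only [hs j i, hs l i, hs l j]
    ring
  have hijls : ∀ i j l m : Fin d, riemannUp (flrw k a' F) i.succ j.succ l.succ m.succ x
      = (k + expansion a' F (x 0) * hubble a' (x 0))
        * (spaceMetric k i l x * kron j m - spaceMetric k j l x * kron i m) := by
    intro i j l m
    simp only [riemannUp, Fin.sum_univ_succ, pd_christoffel_succ_succ_succ hI ht hx,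
      christoffel_flrw_upper_time hI ht hx, christoffel_flrw_succ_succ_succ hI ht hx,
      christoffel_flrw_succ_zero_succ hI ht hx,
      timeArr_zero, timeArr_succ, spaceArr_zero_left, spaceArr_zero_right, spaceArr_succ,
      pd_succ_spaceMetric hx, pd_succ_coord]
    have : ∀ i j n : Fin d, k * x n.succ * spaceMetric k l i x
          * (k * x m.succ * spaceMetric k j n x)
        = k * spaceMetric k l i x * k * x m.succ * (x n.succ * spaceMetric k j n x) :=
      fun i j n => by ring
    simp only [zero_mul, mul_zero, add_zero, zero_add, sub_zero, this, ← Finset.mul_sum,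
      Finset.sum_sub_distrib, hlow]
    simp only [hs j i, hs l i, hs l j, kron_comm m]
    ring
  have hX : sqScale a' (x 0) * (- deriv (hubble a') (x 0) + lapseRate F (x 0) * hubble a' (x 0)
      - hubble a' (x 0) ^ 2) = timeCurv (sqScale a' (x 0)) (deriv (sqScale a') (x 0))
        (deriv (deriv (sqScale a')) (x 0)) (F (x 0)) (deriv F (x 0)) := by
    rw [hI.deriv_hubble ht]
    simp only [lapseRate, hubble, timeCurv]
    field_simp
    ring
  -- X arises twice: from a raised spatial index, lowered by a² γ, and from a raised time index,
  -- lowered by -F. The two expressions agree.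
  have hX' : F (x 0) * (- deriv (expansion a' F) (x 0) + hubble a' (x 0) * expansion a' F (x 0)
        - lapseRate F (x 0) * expansion a' F (x 0))
      = timeCurv (sqScale a' (x 0)) (deriv (sqScale a') (x 0))
        (deriv (deriv (sqScale a')) (x 0)) (F (x 0)) (deriv F (x 0)) := by
    rw [hI.deriv_expansion ht]
    simp only [lapseRate, hubble, expansion, timeCurv]
    field_simp
    ring
  have hY : sqScale a' (x 0) * (k + expansion a' F (x 0) * hubble a' (x 0))
      = spaceCurv k (sqScale a' (x 0)) (deriv (sqScale a') (x 0)) (F (x 0)) := by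
    simp only [hubble, expansion, spaceCurv]
    field_simp
    ring
  have hzero : ∀ c e, riemannUp (flrw k a' F) 0 0 c e x = 0 := by
    intro c e; simp [riemannUp]
  rw [← hX] at hX'
  rw [← hX, ← hY]
  funext a b c f
  simp only [riemann, blockCurv, Fin.sum_univ_succ]
  cases a using Fin.cases <;> cases b using Fin.cases <;> cases c using Fin.cases <;>
    cases f using Fin.cases <;>
    simp only [hzero, h00, h00t, h0it, h0is, hij0t, hij0s, hijlt, hijls, hswap (Fin.succ _) 0,
      timeArr_zero, timeArr_succ, spaceArr_zero_left, spaceArr_zero_right, spaceArr_succ,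
      flrw_zero_zero, flrw_zero_succ, flrw_succ_zero, flrw_succ_succ, mul_zero, zero_mul,
      Finset.sum_const_zero, add_zero, sub_zero, neg_zero, zero_sub, zero_add, mul_one]
  · rename_i j f
    rw [spaceMetric_comm j f, one_mul, ← sum_kron_mul j (fun m => spaceMetric k f m x),
      Finset.mul_sum]
    exact Finset.sum_congr rfl fun m _ => by ring
  · rename_i j f
    rw [spaceMetric_comm j f]
    linear_combination - spaceMetric k f j x * hX'
  · rename_i j f
    rw [spaceMetric_comm j f, one_mul, ← sum_kron_mul j (fun m => spaceMetric k f m x), mul_neg,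
      Finset.mul_sum, ← Finset.sum_neg_distrib]
    exact Finset.sum_congr rfl fun m _ => by ring
  · rename_i j f
    rw [spaceMetric_comm j f]
    linear_combination spaceMetric k f j x * hX'
  · rename_i i j l f
    rw [hs j f, hs i f, ← sum_kron_mul j (fun m => spaceMetric k f m x),
      ← sum_kron_mul i (fun m => spaceMetric k f m x), Finset.mul_sum, Finset.sum_mul,
      ← Finset.sum_sub_distrib, Finset.mul_sum]
    exact Finset.sum_congr rfl fun m _ => by ring

end FLRW

/-! ### Linear changes of coordinates -/

section Transform

variable {d : ℕ}

/-- A linear change of coordinates, acting on pairs `(g^{ab}, R_{abcd})`. -/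
def transformMap (A : GL (Fin (d + 1)) ℝ) :
    (Tensor2 d × Tensor4 d) →L[ℝ] (Tensor2 d × Tensor4 d) :=
  LinearMap.toContinuousLinearMap
    { toFun := fun p => (transformInv A p.1, transformCurv A p.2)
      map_add' := by
        intro p q
        refine Prod.ext ?_ ?_
        · funext a b
          simp only [transformInv, Prod.fst_add, Pi.add_apply, mul_add, Finset.sum_add_distrib]
        · funext a b c f
          simp only [transformCurv, Prod.snd_add, Pi.add_apply, mul_add, Finset.sum_add_distrib]
      map_smul' := by
        intro r p
        refine Prod.ext ?_ ?_
        · funext a b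
          simp only [transformInv, Prod.smul_fst, Pi.smul_apply, smul_eq_mul, RingHom.id_apply,
            Finset.mul_sum]
          exact Finset.sum_congr rfl fun _ _ => Finset.sum_congr rfl fun _ _ => by ring
        · funext a b c f
          simp only [transformCurv, Prod.smul_snd, Pi.smul_apply, smul_eq_mul, RingHom.id_apply,
            Finset.mul_sum]
          exact Finset.sum_congr rfl fun _ _ => Finset.sum_congr rfl fun _ _ =>
            Finset.sum_congr rfl fun _ _ => Finset.sum_congr rfl fun _ _ => by ring }

theorem transformMap_apply (A : GL (Fin (d + 1)) ℝ) (p : Tensor2 d × Tensor4 d) :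
    transformMap A p = (transformInv A p.1, transformCurv A p.2) := rfl

namespace GravityTheory

variable (L : GravityTheory d)

theorem differentiableAt_lagrangian {p : Tensor2 d × Tensor4 d} (hp : p ∈ L.domain) :
    DifferentiableAt ℝ L.lagrangian p :=
  (L.contDiffOn_lagrangian.contDiffAt (L.isOpen_domain.mem_nhds hp)).differentiableAt (by simp)

/-- Differentiate the invariance of the Lagrangian, which holds on an open set, using that the
change of coordinates acts linearly. -/
theorem fderiv_transformMap (A : GL (Fin (d + 1)) ℝ) {p : Tensor2 d × Tensor4 d}
    (hp : p ∈ L.domain) (q : Tensor2 d × Tensor4 d) :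
    fderiv ℝ L.lagrangian (transformMap A p) (transformMap A q) = fderiv ℝ L.lagrangian p q := by
  have hp' : transformMap A p ∈ L.domain := L.transform_mem_domain A p.1 p.2 hp
  have h1 := (L.differentiableAt_lagrangian hp').hasFDerivAt.comp p (transformMap A).hasFDerivAt
  have h2 : HasFDerivAt L.lagrangian
      ((fderiv ℝ L.lagrangian (transformMap A p)).comp (transformMap A)) p := by
    refine h1.congr_of_eventuallyEq ?_
    filter_upwards [L.isOpen_domain.mem_nhds hp] with r hr
    exact (L.lagrangian_transform A r.1 r.2 hr).symm
  rw [h2.fderiv]; rfl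

end GravityTheory

/-! Block-diagonal changes of coordinates -/

/-- The matrix with blocks `c` and `M`. -/
def blockMat (c : ℝ) (M : Matrix (Fin d) (Fin d) ℝ) : Matrix (Fin (d + 1)) (Fin (d + 1)) ℝ :=
  Matrix.of (blockInv (fun i j => M i j) c 1)

theorem blockMat_mul {c c' : ℝ} {M N : Matrix (Fin d) (Fin d) ℝ} (hc : c * c' = 1)
    (h : M * N = 1) : blockMat c M * blockMat c' N = 1 := by
  ext i j
  rw [Matrix.mul_apply, Fin.sum_univ_succ]
  cases i using Fin.cases with
  | zero => cases j using Fin.cases with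
    | zero => simp [blockMat, blockInv, hc]
    | succ j => simp [blockMat, blockInv, Matrix.one_apply, (Fin.succ_ne_zero _).symm]
  | succ i => cases j using Fin.cases with
    | zero => simp [blockMat, blockInv]
    | succ j =>
      have := congrFun (congrFun h i) j
      rw [Matrix.mul_apply] at this
      simp [blockMat, blockInv, this, Matrix.one_apply]

/-- The block-diagonal change of coordinates with blocks `c` and `M`. -/
def blockGL {c c' : ℝ} {M N : Matrix (Fin d) (Fin d) ℝ} (hc : c * c' = 1) (h : M * N = 1) :
    GL (Fin (d + 1)) ℝ :=
  ⟨blockMat c M, blockMat c' N, blockMat_mul hc h,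
    blockMat_mul (by rw [mul_comm, hc]) (mul_eq_one_comm.1 h)⟩

theorem blockGL_coe {c c' : ℝ} {M N : Matrix (Fin d) (Fin d) ℝ} (hc : c * c' = 1)
    (h : M * N = 1) : ((blockGL hc h : GL (Fin (d + 1)) ℝ) : Matrix _ _ ℝ) = blockMat c M := rfl

theorem blockGL_inv_coe {c c' : ℝ} {M N : Matrix (Fin d) (Fin d) ℝ} (hc : c * c' = 1)
    (h : M * N = 1) :
    (((blockGL hc h)⁻¹ : GL (Fin (d + 1)) ℝ) : Matrix _ _ ℝ) = blockMat c' N := rfl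

/-- The covariant transformation of a tensor with two indices. -/
def covTransform (N : Matrix (Fin (d + 1)) (Fin (d + 1)) ℝ) (P : Tensor2 d) : Tensor2 d :=
  fun a b => ∑ a', ∑ b', N a' a * N b' b * P a' b'

theorem sum_four_mul {ι : Type*} [Fintype ι] (p q : ι → ι → ℝ) :
    ∑ a, ∑ b, ∑ c, ∑ f, p a c * q b f = (∑ a, ∑ c, p a c) * ∑ b, ∑ f, q b f := by
  rw [Finset.sum_mul]
  refine Finset.sum_congr rfl fun a _ => ?_
  rw [Finset.sum_comm, Finset.sum_mul]
  refine Finset.sum_congr rfl fun c _ => ?_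
  simp only [Finset.mul_sum]

theorem sum_four_mul' {ι : Type*} [Fintype ι] (p q : ι → ι → ℝ) :
    ∑ a, ∑ b, ∑ c, ∑ f, p b c * q a f = (∑ a, ∑ c, p a c) * ∑ b, ∑ f, q b f := by
  rw [Finset.sum_comm, ← sum_four_mul]

/-- A product of two bilinear forms transforms factor by factor. Together with the other pairing of
indices in `transformCurv_pair'` this covers every term of `blockCurv`. -/
theorem transformCurv_pair (A : GL (Fin (d + 1)) ℝ) (P Q : Tensor2 d) (a b c f : Fin (d + 1)) :
    transformCurv A (fun a b c f => P a c * Q b f) a b c f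
      = covTransform (d := d) (A⁻¹ : GL (Fin (d + 1)) ℝ) P a c
        * covTransform (d := d) (A⁻¹ : GL (Fin (d + 1)) ℝ) Q b f := by
  simp only [transformCurv, covTransform, ← sum_four_mul]
  exact Finset.sum_congr rfl fun _ _ => Finset.sum_congr rfl fun _ _ =>
    Finset.sum_congr rfl fun _ _ => Finset.sum_congr rfl fun _ _ => by ring

theorem transformCurv_pair' (A : GL (Fin (d + 1)) ℝ) (P Q : Tensor2 d) (a b c f : Fin (d + 1)) :
    transformCurv A (fun a b c f => P b c * Q a f) a b c f
      = covTransform (d := d) (A⁻¹ : GL (Fin (d + 1)) ℝ) P b c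
        * covTransform (d := d) (A⁻¹ : GL (Fin (d + 1)) ℝ) Q a f := by
  simp only [transformCurv, covTransform, ← sum_four_mul']
  exact Finset.sum_congr rfl fun _ _ => Finset.sum_congr rfl fun _ _ =>
    Finset.sum_congr rfl fun _ _ => Finset.sum_congr rfl fun _ _ => by ring

theorem transformCurv_blockCurv (A : GL (Fin (d + 1)) ℝ) (s s' : Fin d → Fin d → ℝ) (r X Y : ℝ)
    (hT : covTransform (d := d) (A⁻¹ : GL (Fin (d + 1)) ℝ) (fun a b => timeArr a * timeArr b)
      = fun a b => r * (timeArr a * timeArr b))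
    (hS : covTransform (d := d) (A⁻¹ : GL (Fin (d + 1)) ℝ) (spaceArr s) = spaceArr s') :
    transformCurv A (blockCurv s X Y) = blockCurv s' (r * X) Y := by
  funext a b c f
  -- The factors are ordered so that each term pairs its indices as (ac)(bf) or (bc)(af), the two
  -- patterns for which the transformation has been factored.
  have h : transformCurv A (blockCurv s X Y) a b c f
      = X * (transformCurv A (fun a b c f => (timeArr a * timeArr c) * spaceArr s b f) a b c f
        - transformCurv A (fun a b c f => (timeArr b * timeArr c) * spaceArr s a f) a b c f
        - transformCurv A (fun a b c f => spaceArr s b c * (timeArr a * timeArr f)) a b c f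
        + transformCurv A (fun a b c f => spaceArr s a c * (timeArr b * timeArr f)) a b c f)
      + Y * (transformCurv A (fun a b c f => spaceArr s a c * spaceArr s b f) a b c f
        - transformCurv A (fun a b c f => spaceArr s b c * spaceArr s a f) a b c f) := by
    simp only [transformCurv, ← Finset.sum_sub_distrib, ← Finset.sum_add_distrib, Finset.mul_sum]
    refine Finset.sum_congr rfl fun _ _ => Finset.sum_congr rfl fun _ _ =>
      Finset.sum_congr rfl fun _ _ => Finset.sum_congr rfl fun _ _ => ?_
    simp only [blockCurv]; ring
  rw [h, transformCurv_pair A (fun a c => timeArr a * timeArr c) (spaceArr s),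
    transformCurv_pair' A (fun a c => timeArr a * timeArr c) (spaceArr s),
    transformCurv_pair A (spaceArr s) (fun a c => timeArr a * timeArr c),
    transformCurv_pair' A (spaceArr s) (fun a c => timeArr a * timeArr c),
    transformCurv_pair A (spaceArr s) (spaceArr s),
    transformCurv_pair' A (spaceArr s) (spaceArr s)]
  simp only [hT, hS, blockCurv]
  ring

theorem covTransform_blockMat_time (c : ℝ) (N : Matrix (Fin d) (Fin d) ℝ) :
    covTransform (blockMat c N) (fun a b => timeArr a * timeArr b)
      = fun a b => c ^ 2 * (timeArr a * timeArr b) := by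
  funext a b
  simp only [covTransform, Fin.sum_univ_succ]
  cases a using Fin.cases <;> cases b using Fin.cases <;> simp [blockMat, blockInv, sq]

theorem covTransform_blockMat_space (c : ℝ) (N : Matrix (Fin d) (Fin d) ℝ)
    (s : Fin d → Fin d → ℝ) : covTransform (blockMat c N) (spaceArr s)
      = spaceArr (fun i j => ∑ l, ∑ m, N l i * N m j * s l m) := by
  funext a b
  simp only [covTransform, Fin.sum_univ_succ]
  cases a using Fin.cases <;> cases b using Fin.cases <;> simp [blockMat, blockInv]

theorem transformInv_blockGL {c c' : ℝ} {M N : Matrix (Fin d) (Fin d) ℝ} (hc : c * c' = 1)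
    (h : M * N = 1) (s : Fin d → Fin d → ℝ) (α β : ℝ) :
    transformInv (blockGL hc h) (blockInv s α β)
      = blockInv (fun i j => ∑ l, ∑ m, M i l * M j m * s l m) (c ^ 2 * α) β := by
  funext a b
  simp only [transformInv, blockGL_coe, Fin.sum_univ_succ]
  cases a using Fin.cases <;> cases b using Fin.cases <;>
    simp [blockMat, blockInv, sq, Finset.mul_sum, mul_left_comm, mul_assoc]

theorem transformCurv_blockGL {c c' : ℝ} {M N : Matrix (Fin d) (Fin d) ℝ} (hc : c * c' = 1)
    (h : M * N = 1) (s : Fin d → Fin d → ℝ) (X Y : ℝ) :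
    transformCurv (blockGL hc h) (blockCurv s X Y)
      = blockCurv (fun i j => ∑ l, ∑ m, N l i * N m j * s l m) (c' ^ 2 * X) Y := by
  refine transformCurv_blockCurv _ s _ _ X Y ?_ ?_
  · rw [blockGL_inv_coe]; exact covTransform_blockMat_time c' N
  · rw [blockGL_inv_coe]; exact covTransform_blockMat_space c' N s

end Transform

/-! ### The canonical form of an FLRW curvature -/

section Canonical

variable {d : ℕ}

/-- The pair `(g^{ab}, R_{abcd})` in a spatially orthonormal frame, with `g^{00} = α`,
`g^{ij} = β δ_{ij}`, `R_{titj} = X δ_{ij}` and `R_{ijkl} = Y (δ_{ik} δ_{jl} - δ_{il} δ_{jk})`, for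
`p = (α, β, X, Y)`. -/
def canonical (d : ℕ) : (ℝ × ℝ × ℝ × ℝ) →L[ℝ] (Tensor2 d × Tensor4 d) :=
  LinearMap.toContinuousLinearMap
    { toFun := fun p => (blockInv kron p.1 p.2.1, blockCurv kron p.2.2.1 p.2.2.2)
      map_add' := by
        intro p q
        refine Prod.ext ?_ ?_
        · funext a b
          simp only [blockInv, Prod.fst_add, Prod.snd_add, Pi.add_apply]; ring
        · funext a b c f
          simp only [blockCurv, Prod.fst_add, Prod.snd_add, Pi.add_apply]; ring
      map_smul' := by
        intro r p
        refine Prod.ext ?_ ?_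
        · funext a b
          simp only [blockInv, Prod.smul_fst, Prod.smul_snd, Pi.smul_apply, smul_eq_mul,
            RingHom.id_apply]; ring
        · funext a b c f
          simp only [blockCurv, Prod.smul_fst, Prod.smul_snd, Pi.smul_apply, smul_eq_mul,
            RingHom.id_apply]; ring }

theorem canonical_apply (α β X Y : ℝ) :
    canonical d (α, β, X, Y) = (blockInv kron α β, blockCurv kron X Y) := rfl

/-- A pure rescaling of time: g^{00} carries two upper time indices and X two lower ones, so they
scale inversely. This later normalises F to 1. -/
theorem canonical_scale_time {c : ℝ} (hc : c ≠ 0) (α β X Y : ℝ) :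
    ∃ A : GL (Fin (d + 1)) ℝ, transformMap A (canonical d (α, β, X, Y))
      = canonical d (c ^ 2 * α, β, c⁻¹ ^ 2 * X, Y) := by
  refine ⟨blockGL (mul_inv_cancel₀ hc) (one_mul 1), ?_⟩
  have h : (fun i j : Fin d => ∑ l, ∑ m, (1 : Matrix (Fin d) (Fin d) ℝ) i l
      * (1 : Matrix (Fin d) (Fin d) ℝ) j m * kron l m) = kron := by
    funext i j
    simp [Matrix.one_apply, kron]
  have h' : (fun i j : Fin d => ∑ l, ∑ m, (1 : Matrix (Fin d) (Fin d) ℝ) l i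
      * (1 : Matrix (Fin d) (Fin d) ℝ) m j * kron l m) = kron := by
    funext i j
    simp [Matrix.one_apply, kron, eq_comm]
  rw [transformMap_apply, canonical_apply, transformInv_blockGL, transformCurv_blockGL, h, h']
  rfl

end Canonical

/-! ### Symmetries of the canonical form -/

section Symmetry

variable {d : ℕ}

/-- Writing the spatial δ as the full δ minus dt dt makes its invariance under signs and
permutations fixing time evident. -/
theorem spaceArr_kron (a b : Fin (d + 1)) :
    spaceArr kron a b = (if a = b then 1 else 0) - timeArr a * timeArr b := by
  cases a using Fin.cases <;> cases b using Fin.cases <;>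
    simp [kron, Fin.succ_ne_zero, (Fin.succ_ne_zero _).symm]

/-- The change of coordinates that multiplies the coordinates by signs. -/
def signGL (ε : Fin (d + 1) → ℝ) (hε : ∀ a, ε a * ε a = 1) : GL (Fin (d + 1)) ℝ :=
  ⟨Matrix.diagonal ε, Matrix.diagonal ε, by simp [Matrix.diagonal_mul_diagonal, hε],
    by simp [Matrix.diagonal_mul_diagonal, hε]⟩

theorem transformInv_signGL (ε : Fin (d + 1) → ℝ) (hε : ∀ a, ε a * ε a = 1) (u : Tensor2 d) :
    transformInv (signGL ε hε) u = fun a b => ε a * ε b * u a b := by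
  have h : ((signGL ε hε : GL (Fin (d + 1)) ℝ) : Matrix _ _ ℝ) = Matrix.diagonal ε := rfl
  funext a b
  simp [transformInv, h, Matrix.diagonal_apply]

theorem transformCurv_signGL (ε : Fin (d + 1) → ℝ) (hε : ∀ a, ε a * ε a = 1) (v : Tensor4 d) :
    transformCurv (signGL ε hε) v = fun a b c f => ε a * ε b * ε c * ε f * v a b c f := by
  have h : (((signGL ε hε)⁻¹ : GL (Fin (d + 1)) ℝ) : Matrix _ _ ℝ) = Matrix.diagonal ε := rfl
  funext a b c f
  simp [transformCurv, h, Matrix.diagonal_apply]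

theorem transformMap_signGL_canonical (ε : Fin (d + 1) → ℝ) (hε : ∀ a, ε a * ε a = 1)
    (p : ℝ × ℝ × ℝ × ℝ) : transformMap (signGL ε hε) (canonical d p) = canonical d p := by
  obtain ⟨α, β, X, Y⟩ := p
  have hT : ∀ a c : Fin (d + 1), ε a * ε c * (timeArr a * timeArr c) = timeArr a * timeArr c := by
    intro a c
    cases a using Fin.cases <;> cases c using Fin.cases <;> simp [hε]
  have hS : ∀ a c : Fin (d + 1), ε a * ε c * spaceArr kron a c = spaceArr kron a c := by
    intro a c
    rw [spaceArr_kron, mul_sub, hT]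
    split_ifs with h
    · rw [h, hε]; ring
    · ring
  rw [transformMap_apply, canonical_apply, transformInv_signGL, transformCurv_signGL]
  refine Prod.ext ?_ ?_
  · funext a b
    simp only [blockInv]
    linear_combination α * hT a b + β * hS a b
  · funext a b c f
    have e : ε a * ε b * ε c * ε f * blockCurv kron X Y a b c f
      = X * ((ε a * ε c * (timeArr a * timeArr c)) * (ε b * ε f * spaceArr kron b f)
        - (ε b * ε c * (timeArr b * timeArr c)) * (ε a * ε f * spaceArr kron a f)
        - (ε a * ε f * (timeArr a * timeArr f)) * (ε b * ε c * spaceArr kron b c)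
        + (ε b * ε f * (timeArr b * timeArr f)) * (ε a * ε c * spaceArr kron a c))
      + Y * ((ε a * ε c * spaceArr kron a c) * (ε b * ε f * spaceArr kron b f)
        - (ε a * ε f * spaceArr kron a f) * (ε b * ε c * spaceArr kron b c)) := by
      simp only [blockCurv]; ring
    change ε a * ε b * ε c * ε f * blockCurv kron X Y a b c f = blockCurv kron X Y a b c f
    rw [e]
    simp only [hT, hS, blockCurv]

/-- The change of coordinates that permutes the coordinates. -/
def permGL (π : Equiv.Perm (Fin (d + 1))) : GL (Fin (d + 1)) ℝ :=
  ⟨Matrix.of fun a a' => if π a' = a then 1 else 0, Matrix.of fun a' a => if π a' = a then 1 else 0,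
    by
      ext a b
      have h : ∀ j a, (π j = a) = (j = π.symm a) := fun j a => by rw [Equiv.eq_symm_apply]
      simp only [Matrix.mul_apply, Matrix.of_apply, h]
      simp only [mul_ite, mul_one, mul_zero, Finset.sum_ite_eq', Finset.mem_univ, if_true,
        EmbeddingLike.apply_eq_iff_eq, Matrix.one_apply, eq_comm],
    by ext a b; simp [Matrix.mul_apply, Matrix.one_apply, eq_comm]⟩

theorem transformInv_permGL (π : Equiv.Perm (Fin (d + 1))) (u : Tensor2 d) :
    transformInv (permGL π) u = fun a b => u (π.symm a) (π.symm b) := by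
  have h : ∀ a a', ((permGL π : GL (Fin (d + 1)) ℝ) : Matrix _ _ ℝ) a a'
    = if π a' = a then 1 else 0 := fun _ _ => rfl
  funext a b
  simp [transformInv, h, ← Equiv.eq_symm_apply]

theorem transformCurv_permGL (π : Equiv.Perm (Fin (d + 1))) (v : Tensor4 d) :
    transformCurv (permGL π) v
      = fun a b c f => v (π.symm a) (π.symm b) (π.symm c) (π.symm f) := by
  have h : ∀ a' a, (((permGL π)⁻¹ : GL (Fin (d + 1)) ℝ) : Matrix _ _ ℝ) a' a
    = if π a' = a then 1 else 0 := fun _ _ => rfl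
  funext a b c f
  simp [transformCurv, h, ← Equiv.eq_symm_apply]

theorem transformMap_permGL_canonical (π : Equiv.Perm (Fin (d + 1))) (hπ : π 0 = 0)
    (p : ℝ × ℝ × ℝ × ℝ) : transformMap (permGL π) (canonical d p) = canonical d p := by
  obtain ⟨α, β, X, Y⟩ := p
  have hT : ∀ a : Fin (d + 1), timeArr (π.symm a) = timeArr a := by
    intro a
    have : π.symm a = 0 ↔ a = 0 := by rw [Equiv.symm_apply_eq, hπ]
    simp only [timeArr, this]
  have hS : ∀ a c : Fin (d + 1), spaceArr kron (π.symm a) (π.symm c) = spaceArr kron a c := by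
    intro a c
    simp only [spaceArr_kron, hT, EmbeddingLike.apply_eq_iff_eq]
  rw [transformMap_apply, canonical_apply, transformInv_permGL, transformCurv_permGL]
  refine Prod.ext ?_ ?_
  · funext a b
    simp only [blockInv, hT, hS]
  · funext a b c f
    simp only [blockCurv, hT, hS]

/-- Swap i with i', then swap the image of j with j'. The second transposition moves neither i' nor
o. This is the transitivity on ordered pairs of spatial indices used to equate coefficients. -/
theorem exists_perm_pair {n : Type*} [DecidableEq n] {o i j i' j' : n} (hij : i ≠ j)
    (hij' : i' ≠ j') (hi : i ≠ o) (hj : j ≠ o) (hi' : i' ≠ o) (hj' : j' ≠ o) :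
    ∃ π : Equiv.Perm n, π o = o ∧ π i = i' ∧ π j = j' := by
  refine ⟨(Equiv.swap i i').trans (Equiv.swap (Equiv.swap i i' j) j'), ?_, ?_, ?_⟩
  · have h1 : Equiv.swap i i' o = o := Equiv.swap_apply_of_ne_of_ne hi.symm hi'.symm
    have h2 : Equiv.swap i i' j ≠ o := by
      rw [← h1]; exact fun h => hj (Equiv.injective _ h)
    simp only [Equiv.trans_apply, h1]
    exact Equiv.swap_apply_of_ne_of_ne h2.symm hj'.symm
  · have h2 : Equiv.swap i i' j ≠ i' := by
      intro h
      have h3 : Equiv.swap i i' j = Equiv.swap i i' i := by rw [h, Equiv.swap_apply_left]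
      exact hij (Equiv.injective _ h3).symm
    simp only [Equiv.trans_apply, Equiv.swap_apply_left]
    exact Equiv.swap_apply_of_ne_of_ne h2.symm hij'
  · simp only [Equiv.trans_apply, Equiv.swap_apply_left]

/-- The standard basis of the space of tensors with two indices. -/
def unit2 (a b : Fin (d + 1)) : Tensor2 d := fun a' b' => if a' = a ∧ b' = b then 1 else 0

/-- The standard basis of the space of tensors with four indices. -/
def unit4 (a b c f : Fin (d + 1)) : Tensor4 d := fun a' b' c' f' =>
  if a' = a ∧ b' = b ∧ c' = c ∧ f' = f then 1 else 0

theorem map_eq_sum_units (φ : (Tensor2 d × Tensor4 d) →L[ℝ] ℝ) (u : Tensor2 d) (v : Tensor4 d) :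
    φ (u, v) = (∑ a, ∑ b, φ (unit2 a b, 0) * u a b)
      + ∑ a, ∑ b, ∑ c, ∑ f, φ (0, unit4 a b c f) * v a b c f := by
  have hu : u = ∑ a, ∑ b, u a b • unit2 a b := by
    funext a b
    simp [unit2, Finset.sum_apply, Finset.sum_ite, ite_and]
  have hv : v = ∑ a, ∑ b, ∑ c, ∑ f, v a b c f • unit4 a b c f := by
    funext a b c f
    simp [unit4, Finset.sum_apply, ite_and]
  have h : (u, v) = ContinuousLinearMap.inl ℝ (Tensor2 d) (Tensor4 d) u
      + ContinuousLinearMap.inr ℝ (Tensor2 d) (Tensor4 d) v := by simp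
  conv_lhs => rw [h, map_add, hu, hv]
  simp only [map_sum, map_smul, smul_eq_mul, ContinuousLinearMap.inl_apply,
    ContinuousLinearMap.inr_apply, mul_comm]

/-- Invariance of a linear functional under the symmetries of the canonical form. -/
structure IsIsotropic (φ : (Tensor2 d × Tensor4 d) →L[ℝ] ℝ) : Prop where
  sign : ∀ (ε : Fin (d + 1) → ℝ) (hε : ∀ a, ε a * ε a = 1) (q : Tensor2 d × Tensor4 d),
    φ (transformMap (signGL ε hε) q) = φ q
  perm : ∀ π : Equiv.Perm (Fin (d + 1)), π 0 = 0 → ∀ q : Tensor2 d × Tensor4 d,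
    φ (transformMap (permGL π) q) = φ q

namespace IsIsotropic

variable {φ : (Tensor2 d × Tensor4 d) →L[ℝ] ℝ}

theorem unit2_sign (hφ : IsIsotropic φ) (ε : Fin (d + 1) → ℝ) (hε : ∀ a, ε a * ε a = 1)
    (a b : Fin (d + 1)) : φ (unit2 a b, 0) = ε a * ε b * φ (unit2 a b, 0) := by
  have h : transformMap (signGL ε hε) (unit2 a b, 0)
      = (ε a * ε b) • ((unit2 a b, 0) : Tensor2 d × Tensor4 d) := by
    rw [transformMap_apply, transformInv_signGL, transformCurv_signGL]
    refine Prod.ext ?_ ?_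
    · funext a' b'
      simp only [unit2, Prod.smul_fst, Pi.smul_apply, smul_eq_mul]
      split_ifs with h
      · rw [h.1, h.2]
      · ring
    · funext a' b' c' f'
      simp
  conv_lhs => rw [← hφ.sign ε hε, h, map_smul, smul_eq_mul]

theorem unit4_sign (hφ : IsIsotropic φ) (ε : Fin (d + 1) → ℝ) (hε : ∀ a, ε a * ε a = 1)
    (a b c f : Fin (d + 1)) :
    φ (0, unit4 a b c f) = ε a * ε b * ε c * ε f * φ (0, unit4 a b c f) := by
  have h : transformMap (signGL ε hε) (0, unit4 a b c f)
      = (ε a * ε b * ε c * ε f) • ((0, unit4 a b c f) : Tensor2 d × Tensor4 d) := by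
    rw [transformMap_apply, transformInv_signGL, transformCurv_signGL]
    refine Prod.ext ?_ ?_
    · funext a' b'
      simp
    · funext a' b' c' f'
      simp only [unit4, Prod.smul_snd, Pi.smul_apply, smul_eq_mul]
      split_ifs with h
      · rw [h.1, h.2.1, h.2.2.1, h.2.2.2]
      · ring
  conv_lhs => rw [← hφ.sign ε hε, h, map_smul, smul_eq_mul]

theorem unit2_perm (hφ : IsIsotropic φ) (π : Equiv.Perm (Fin (d + 1))) (hπ : π 0 = 0)
    (a b : Fin (d + 1)) : φ (unit2 (π a) (π b), 0) = φ (unit2 a b, 0) := by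
  have h : transformMap (permGL π) (unit2 a b, 0)
      = ((unit2 (π a) (π b), 0) : Tensor2 d × Tensor4 d) := by
    rw [transformMap_apply, transformInv_permGL, transformCurv_permGL]
    refine Prod.ext ?_ ?_
    · funext a' b'
      simp only [unit2, Equiv.symm_apply_eq]
    · funext a' b' c' f'
      simp
  rw [← h, hφ.perm π hπ]

theorem unit4_perm (hφ : IsIsotropic φ) (π : Equiv.Perm (Fin (d + 1))) (hπ : π 0 = 0)
    (a b c f : Fin (d + 1)) :
    φ (0, unit4 (π a) (π b) (π c) (π f)) = φ (0, unit4 a b c f) := by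
  have h : transformMap (permGL π) (0, unit4 a b c f)
      = ((0, unit4 (π a) (π b) (π c) (π f)) : Tensor2 d × Tensor4 d) := by
    rw [transformMap_apply, transformInv_permGL, transformCurv_permGL]
    refine Prod.ext ?_ ?_
    · funext a' b'
      simp
    · funext a' b' c' f'
      simp only [unit4, Equiv.symm_apply_eq]
  rw [← h, hφ.perm π hπ]

/-- The sign vector that reflects a single coordinate. -/
def reflection (e a : Fin (d + 1)) : ℝ := if a = e then -1 else 1

theorem reflection_mul_self (e a : Fin (d + 1)) : reflection e a * reflection e a = 1 := by
  unfold reflection; split_ifs <;> norm_num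

theorem unit2_eq_zero (hφ : IsIsotropic φ) {a b : Fin (d + 1)} (h : a ≠ b) :
    φ (unit2 a b, 0) = 0 := by
  have := hφ.unit2_sign (reflection a) (reflection_mul_self a) a b
  simp only [reflection, if_true, h.symm, if_false] at this
  linarith

/-- The index c occurs exactly once, so reflecting the coordinate c changes the sign of the basis
tensor. -/
theorem unit4_eq_zero_left (hφ : IsIsotropic φ) {a b c f : Fin (d + 1)} (hca : c ≠ a) (hcb : c ≠ b)
    (hcf : c ≠ f) : φ (0, unit4 a b c f) = 0 := by
  have := hφ.unit4_sign (reflection c) (reflection_mul_self c) a b c f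
  simp only [reflection, if_true, hca.symm, hcb.symm, hcf.symm, if_false] at this
  linarith

theorem unit4_eq_zero_right (hφ : IsIsotropic φ) {a b c f : Fin (d + 1)} (hca : f ≠ a)
    (hcb : f ≠ b) (hcf : c ≠ f) : φ (0, unit4 a b c f) = 0 := by
  have := hφ.unit4_sign (reflection f) (reflection_mul_self f) a b c f
  simp only [reflection, if_true, hca.symm, hcb.symm, hcf, if_false] at this
  linarith

/-- An isotropic functional on tensors with the antisymmetries of the curvature only depends on
four traces. -/
theorem exists_traces (hφ : IsIsotropic φ) (hd : 2 ≤ d) : ∃ κ₀ κ₁ κ₂ κ₃ : ℝ,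
    ∀ (u : Tensor2 d) (v : Tensor4 d), (∀ a b c f, v a b c f = - v b a c f) →
      (∀ a b c f, v a b c f = - v a b f c) →
      φ (u, v) = κ₀ * u 0 0 + κ₁ * ∑ i : Fin d, u i.succ i.succ
        + κ₂ * ∑ i : Fin d, v 0 i.succ 0 i.succ
        + κ₃ * ∑ i : Fin d, ∑ j : Fin d, v i.succ j.succ i.succ j.succ := by
  let i₀ : Fin d := ⟨0, by omega⟩
  let i₁ : Fin d := ⟨1, by omega⟩
  have hi : i₀ ≠ i₁ := by simp [i₀, i₁]
  -- An antisymmetric v has v_{abba} = -v_{abab}, so the two coefficients enter only through their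
  -- difference.
  let w : Fin (d + 1) → Fin (d + 1) → ℝ := fun a b =>
    φ (0, unit4 a b a b) - φ (0, unit4 a b b a)
  have hw : ∀ π : Equiv.Perm (Fin (d + 1)), π 0 = 0 → ∀ a b, w (π a) (π b) = w a b := by
    intro π hπ a b
    simp only [w, hφ.unit4_perm π hπ]
  have hperm1 : ∀ i : Fin d, ∃ π : Equiv.Perm (Fin (d + 1)), π 0 = 0 ∧ π i₀.succ = i.succ :=
    fun i => ⟨Equiv.swap i₀.succ i.succ, Equiv.swap_apply_of_ne_of_ne (Fin.succ_ne_zero _).symm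
      (Fin.succ_ne_zero _).symm, Equiv.swap_apply_left _ _⟩
  have hu1 : ∀ i : Fin d, φ (unit2 i.succ i.succ, 0) = φ (unit2 i₀.succ i₀.succ, 0) := by
    intro i
    obtain ⟨π, h0, h1⟩ := hperm1 i
    rw [← hφ.unit2_perm π h0 i₀.succ, h1]
  have hw0 : ∀ i : Fin d, w 0 i.succ = w 0 i₀.succ := by
    intro i
    obtain ⟨π, h0, h1⟩ := hperm1 i
    rw [← hw π h0 0 i₀.succ, h0, h1]
  have hw0' : ∀ i : Fin d, w i.succ 0 = w i₀.succ 0 := by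
    intro i
    obtain ⟨π, h0, h1⟩ := hperm1 i
    rw [← hw π h0 i₀.succ 0, h0, h1]
  have hw1 : ∀ i j : Fin d, i ≠ j → w i.succ j.succ = w i₀.succ i₁.succ := by
    intro i j hij
    obtain ⟨π, h0, h1, h2⟩ := exists_perm_pair (o := (0 : Fin (d + 1)))
      (fun h => hi (Fin.succ_injective _ h)) (fun h => hij (Fin.succ_injective _ h))
      (Fin.succ_ne_zero i₀) (Fin.succ_ne_zero i₁) (Fin.succ_ne_zero i) (Fin.succ_ne_zero j)
    rw [← hw π h0 i₀.succ i₁.succ, h1, h2]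
  refine ⟨φ (unit2 0 0, 0), φ (unit2 i₀.succ i₀.succ, 0), w 0 i₀.succ + w i₀.succ 0,
    w i₀.succ i₁.succ, fun u v hv hv' => ?_⟩
  have hdiag : ∀ a c f, v a a c f = 0 := fun a c f => by linarith [hv a a c f]
  have hdiag' : ∀ a b c, v a b c c = 0 := fun a b c => by linarith [hv' a b c c]
  have hU : ∑ a, ∑ b, φ (unit2 a b, 0) * u a b = φ (unit2 0 0, 0) * u 0 0
      + φ (unit2 i₀.succ i₀.succ, 0) * ∑ i : Fin d, u i.succ i.succ := by
    have h1 : ∀ a, ∑ b, φ (unit2 a b, 0) * u a b = φ (unit2 a a, 0) * u a a := by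
      intro a
      refine Finset.sum_eq_single a (fun b _ hb => ?_) (by simp)
      rw [hφ.unit2_eq_zero hb.symm, zero_mul]
    simp only [h1, Fin.sum_univ_succ, hu1, Finset.mul_sum]
  -- For a ≠ b, an index c or f outside {a, b} occurs once, where the functional vanishes, or c = f,
  -- where v vanishes. Only the orderings abab and abba remain.
  have hin : ∀ a b, ∑ c, ∑ f, φ (0, unit4 a b c f) * v a b c f = w a b * v a b a b := by
    intro a b
    by_cases hab : a = b
    · subst hab; simp [hdiag]
    have h1 : ∀ c, c ≠ a → c ≠ b → ∑ f, φ (0, unit4 a b c f) * v a b c f = 0 := by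
      intro c hca hcb
      refine Finset.sum_eq_zero fun f _ => ?_
      by_cases hcf : c = f
      · rw [← hcf, hdiag', mul_zero]
      · rw [hφ.unit4_eq_zero_left hca hcb hcf, zero_mul]
    have h2 : ∀ c f, f ≠ a → f ≠ b → φ (0, unit4 a b c f) * v a b c f = 0 := by
      intro c f hca hcb
      by_cases hcf : c = f
      · rw [← hcf, hdiag', mul_zero]
      · rw [hφ.unit4_eq_zero_right hca hcb hcf, zero_mul]
    have h3 : ∀ c, ∑ f, φ (0, unit4 a b c f) * v a b c f = φ (0, unit4 a b c a) * v a b c a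
        + φ (0, unit4 a b c b) * v a b c b := by
      intro c
      exact Fintype.sum_eq_add a b hab fun f hf => h2 c f hf.1 hf.2
    rw [Fintype.sum_eq_add a b hab fun c hc => h1 c hc.1 hc.2, h3, h3, hdiag', hdiag',
      hv' a b b a]
    simp only [w]; ring
  rw [map_eq_sum_units, hU]
  simp only [hin]
  have hsucc : ∀ i : Fin d, ∑ j : Fin d, w i.succ j.succ * v i.succ j.succ i.succ j.succ
      = w i₀.succ i₁.succ * ∑ j : Fin d, v i.succ j.succ i.succ j.succ := by
    intro i
    rw [Finset.mul_sum]
    refine Finset.sum_congr rfl fun j _ => ?_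
    by_cases hij : i = j
    · rw [hij, hdiag]; ring
    · rw [hw1 i j hij]
  have hrev : ∀ i : Fin d, v i.succ 0 i.succ 0 = v 0 i.succ 0 i.succ := by
    intro i; rw [hv, hv']; ring
  simp only [Fin.sum_univ_succ, hw0, hw0', hsucc, hdiag, hrev, Finset.sum_add_distrib,
    ← Finset.mul_sum]
  ring

end IsIsotropic

namespace GravityTheory

variable (L : GravityTheory d)

/-- The derivative of an invariant function at a point is invariant under the stabiliser of that
point. -/
theorem isIsotropic_fderiv {p : ℝ × ℝ × ℝ × ℝ} (hp : canonical d p ∈ L.domain) :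
    IsIsotropic (fderiv ℝ L.lagrangian (canonical d p)) where
  sign ε hε q := by
    have := L.fderiv_transformMap (signGL ε hε) hp q
    rwa [transformMap_signGL_canonical] at this
  perm π hπ q := by
    have := L.fderiv_transformMap (permGL π) hp q
    rwa [transformMap_permGL_canonical π hπ] at this

/-- The derivative of the Lagrangian at a canonical point only sees the traces of a variation. -/
theorem fderiv_canonical (hd : 2 ≤ d) {p : ℝ × ℝ × ℝ × ℝ} (hp : canonical d p ∈ L.domain)
    {u : Tensor2 d} {v : Tensor4 d} (hv : ∀ a b c f, v a b c f = - v b a c f)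
    (hv' : ∀ a b c f, v a b c f = - v a b f c) :
    fderiv ℝ L.lagrangian (canonical d p) (u, v) = fderiv ℝ L.lagrangian (canonical d p)
      (canonical d (u 0 0, (∑ i : Fin d, u i.succ i.succ) / d,
        (∑ i : Fin d, v 0 i.succ 0 i.succ) / d,
        (∑ i : Fin d, ∑ j : Fin d, v i.succ j.succ i.succ j.succ) / (d * (d - 1)))) := by
  obtain ⟨κ₀, κ₁, κ₂, κ₃, h⟩ := (L.isIsotropic_fderiv hp).exists_traces hd
  have hd0 : (d : ℝ) ≠ 0 := by positivity
  have hd1 : (d : ℝ) - 1 ≠ 0 := by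
    have : (2 : ℝ) ≤ d := by exact_mod_cast hd
    linarith
  rw [h u v hv hv', canonical_apply (d := d) (u 0 0),
    h _ _ (fun a b c f => by simp only [blockCurv]; ring)
    (fun a b c f => by simp only [blockCurv]; ring)]
  have hk : ∀ i : Fin d, kron i i = 1 := fun i => by simp [kron]
  have hkk : ∀ i : Fin d, ∑ j : Fin d, kron i j * kron j i = 1 := fun i => by
    rw [sum_kron_mul, hk]
  simp only [blockInv, blockCurv, timeArr_zero, timeArr_succ, spaceArr_zero_left,
    spaceArr_zero_right, spaceArr_succ, hk]
  -- The normalisations d and d (d - 1) are the traces of the unit canonical arrays; d ≥ 2 makes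
  -- both nonzero.
  have e : ∑ i : Fin d, ∑ j : Fin d, (1 * 1 - kron i j * kron j i) = (d : ℝ) * (d - 1) := by
    simp [Finset.sum_sub_distrib, hkk]; ring
  simp only [mul_zero, zero_mul, mul_one, add_zero, zero_add, sub_zero, Finset.sum_const,
    Finset.card_univ, Fintype.card_fin, nsmul_eq_mul, ← Finset.mul_sum] at e ⊢
  rw [e]
  field_simp

end GravityTheory

end Symmetry

/-! ### The first variation on an FLRW background -/

section Frame

variable {d : ℕ} {k : ℝ} {x : Chart d}

/-- The matrix `δ_{ij} + μ x_i x_j`. -/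
def shiftMat (μ : ℝ) (x : Chart d) : Matrix (Fin d) (Fin d) ℝ :=
  Matrix.of fun i j => kron i j + μ * (x i.succ * x j.succ)

/-- Since (x xᵀ)² = r² x xᵀ, these matrices are closed under multiplication. Square roots and
inverses of γ can thus be sought among them by solving scalar equations. -/
theorem sum_shiftMat_mul (μ ν : ℝ) (x : Chart d) (l m : Fin d) :
    ∑ i, shiftMat μ x l i * shiftMat ν x i m
      = kron l m + (μ + ν + μ * ν * radiusSq x) * (x l.succ * x m.succ) := by
  have h : ∀ i, shiftMat μ x l i * shiftMat ν x i m = kron l i * kron i m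
      + ν * x m.succ * (kron l i * x i.succ) + μ * x l.succ * (kron i m * x i.succ)
      + μ * ν * x l.succ * x m.succ * (x i.succ * x i.succ) := by
    intro i; simp only [shiftMat, Matrix.of_apply]; ring
  simp only [h, Finset.sum_add_distrib, ← Finset.mul_sum, sum_kron_mul, sum_kron_mul',
    sum_pos_mul_pos]
  ring

/-- A change of the spatial coordinates to an orthonormal frame. -/
theorem exists_orthonormal_frame (hx : InFLRWChart k x) : ∃ M N : Matrix (Fin d) (Fin d) ℝ,
    M * N = 1 ∧ (∀ l m, ∑ i, M i l * M i m = spaceMetric k l m x) ∧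
      ∀ l m, ∑ i, N l i * N m i = spaceInv k l m x := by
  have hρ := rho_pos hx
  have hσ := rho_sq hx
  have hc := conf_mul hx
  -- The relation ρ² (1 - k r²) = 1, arranged for elimination of r².
  have hr : k * rho k x ^ 2 * radiusSq x = rho k x ^ 2 - 1 := by
    rw [hσ]; linear_combination - hc
  have hsymm : ∀ μ l m, shiftMat μ x l m = shiftMat μ x m l := by
    intro μ l m; simp only [shiftMat, Matrix.of_apply, kron_comm l m]; ring
  have h1 : 1 + rho k x ≠ 0 := by positivity
  -- M is the positive square root of γ: its eigenvalue along x is 1 + μ r² = ρ, so μ = (ρ - 1)/r² =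
  -- k ρ²/(1 + ρ), a form without division by r². For its inverse 1 + ν r² = 1/ρ gives ν = -k ρ/(1 +
  -- ρ).
  refine ⟨shiftMat (k * rho k x ^ 2 / (1 + rho k x)) x, shiftMat (-(k * rho k x / (1 + rho k x))) x,
    ?_, fun l m => ?_, fun l m => ?_⟩
  · ext l m
    rw [Matrix.mul_apply, sum_shiftMat_mul]
    have : k * rho k x ^ 2 / (1 + rho k x) + -(k * rho k x / (1 + rho k x))
        + k * rho k x ^ 2 / (1 + rho k x) * -(k * rho k x / (1 + rho k x)) * radiusSq x = 0 := by
      field_simp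
      linear_combination (-k * rho k x) * hr
    rw [this, Matrix.one_apply, kron]; ring
  · simp only [hsymm _ _ l]
    rw [sum_shiftMat_mul, spaceMetric, ← hσ]
    have : k * rho k x ^ 2 / (1 + rho k x) + k * rho k x ^ 2 / (1 + rho k x)
        + k * rho k x ^ 2 / (1 + rho k x) * (k * rho k x ^ 2 / (1 + rho k x)) * radiusSq x
        = k * rho k x ^ 2 := by
      field_simp
      linear_combination k * hr
    rw [this]; ring
  · simp only [hsymm _ m]
    rw [sum_shiftMat_mul, spaceInv]
    have : -(k * rho k x / (1 + rho k x)) + -(k * rho k x / (1 + rho k x))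
        + -(k * rho k x / (1 + rho k x)) * -(k * rho k x / (1 + rho k x)) * radiusSq x
        = - k := by
      field_simp
      linear_combination k * hr
    rw [this]; ring

/-- The hypothesis on N says γ⁻¹ = N Nᵀ, so M γ⁻¹ Mᵀ = (M N)(M N)ᵀ = 1. -/
theorem sum_frame_inv {M N : Matrix (Fin d) (Fin d) ℝ} (h : M * N = 1)
    (hN : ∀ l m, ∑ i, N l i * N m i = spaceInv k l m x) :
    (fun i j => ∑ l, ∑ m, M i l * M j m * spaceInv k l m x) = kron := by
  have hG : Matrix.of (fun l m => spaceInv k l m x) = N * N.transpose := by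
    ext l m; rw [Matrix.mul_apply]; exact (hN l m).symm
  have h1 : M * Matrix.of (fun l m => spaceInv k l m x) * M.transpose = 1 := by
    rw [hG, ← mul_assoc, h, one_mul, ← Matrix.transpose_mul, h, Matrix.transpose_one]
  funext i j
  have h2 := congrFun (congrFun h1 i) j
  simp only [Matrix.mul_apply, Matrix.transpose_apply, Matrix.of_apply, Finset.sum_mul] at h2
  rw [Finset.sum_comm] at h2
  rw [kron, ← Matrix.one_apply, ← h2]
  exact Finset.sum_congr rfl fun _ _ => Finset.sum_congr rfl fun _ _ => by ring

theorem sum_frame_metric {M N : Matrix (Fin d) (Fin d) ℝ} (h : M * N = 1)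
    (hM : ∀ l m, ∑ i, M i l * M i m = spaceMetric k l m x) :
    (fun i j => ∑ l, ∑ m, N l i * N m j * spaceMetric k l m x) = kron := by
  have hG : Matrix.of (fun l m => spaceMetric k l m x) = M.transpose * M := by
    ext l m; rw [Matrix.mul_apply]; exact (hM l m).symm
  have h1 : N.transpose * Matrix.of (fun l m => spaceMetric k l m x) * N = 1 := by
    rw [hG, mul_assoc, mul_assoc, h, mul_one, ← Matrix.transpose_mul, h, Matrix.transpose_one]
  funext i j
  have h2 := congrFun (congrFun h1 i) j
  simp only [Matrix.mul_apply, Matrix.transpose_apply, Matrix.of_apply, Finset.sum_mul] at h2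
  rw [Finset.sum_comm] at h2
  rw [kron, ← Matrix.one_apply, ← h2]
  exact Finset.sum_congr rfl fun _ _ => Finset.sum_congr rfl fun _ _ => by ring

theorem sum_comm_three {ι κ : Type*} [Fintype ι] [Fintype κ] (f : ι → κ → κ → ℝ) :
    ∑ i, ∑ l, ∑ m, f i l m = ∑ l, ∑ m, ∑ i, f i l m := by
  rw [Finset.sum_comm]
  exact Finset.sum_congr rfl fun _ _ => Finset.sum_comm

theorem sum_comm_two_four {ι κ : Type*} [Fintype ι] [Fintype κ] (f : ι → ι → κ → κ → κ → κ → ℝ) :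
    ∑ i, ∑ j, ∑ a, ∑ b, ∑ c, ∑ e, f i j a b c e
      = ∑ a, ∑ b, ∑ c, ∑ e, ∑ i, ∑ j, f i j a b c e := by
  have h : ∀ g : ι → ι → ℝ, ∑ i, ∑ j, g i j = ∑ z : ι × ι, g z.1 z.2 := fun g =>
    (Fintype.sum_prod_type' g).symm
  simp only [h]
  rw [Finset.sum_comm]
  refine Finset.sum_congr rfl fun a _ => ?_
  rw [Finset.sum_comm]
  exact Finset.sum_congr rfl fun b _ => sum_comm_three _

theorem transformInv_blockGL_zero {M N : Matrix (Fin d) (Fin d) ℝ} (h : M * N = 1)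
    (u : Tensor2 d) : transformInv (blockGL (one_mul 1) h) u 0 0 = u 0 0 := by
  simp [transformInv, blockGL_coe, Fin.sum_univ_succ, blockMat, blockInv]

/-- A plain trace in the orthonormal frame is a trace with γ in the original coordinates. The next
two lemmas do the same for the curvature with γ⁻¹. -/
theorem sum_transformInv_blockGL {M N : Matrix (Fin d) (Fin d) ℝ} (h : M * N = 1)
    (hM : ∀ l m, ∑ i, M i l * M i m = spaceMetric k l m x) (u : Tensor2 d) :
    ∑ i : Fin d, transformInv (blockGL (one_mul 1) h) u i.succ i.succ
      = ∑ l : Fin d, ∑ m : Fin d, spaceMetric k l m x * u l.succ m.succ := by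
  simp only [← hM, Finset.sum_mul]
  rw [← sum_comm_three]
  refine Finset.sum_congr rfl fun i _ => ?_
  simp [transformInv, blockGL_coe, Fin.sum_univ_succ, blockMat, blockInv]

theorem sum_transformCurv_blockGL_time {M N : Matrix (Fin d) (Fin d) ℝ} (h : M * N = 1)
    (hN : ∀ l m, ∑ i, N l i * N m i = spaceInv k l m x) (v : Tensor4 d) :
    ∑ i : Fin d, transformCurv (blockGL (one_mul 1) h) v 0 i.succ 0 i.succ
      = ∑ l : Fin d, ∑ m : Fin d, spaceInv k l m x * v 0 l.succ 0 m.succ := by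
  simp only [← hN, Finset.sum_mul]
  rw [← sum_comm_three]
  refine Finset.sum_congr rfl fun i _ => ?_
  simp only [transformCurv, blockGL_inv_coe]
  simp [Fin.sum_univ_succ, blockMat, blockInv]

theorem sum_transformCurv_blockGL_space {M N : Matrix (Fin d) (Fin d) ℝ} (h : M * N = 1)
    (hN : ∀ l m, ∑ i, N l i * N m i = spaceInv k l m x) (v : Tensor4 d) :
    ∑ i : Fin d, ∑ j : Fin d, transformCurv (blockGL (one_mul 1) h) v i.succ j.succ i.succ j.succ
      = ∑ i : Fin d, ∑ j : Fin d, ∑ l : Fin d, ∑ m : Fin d,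
        spaceInv k i l x * spaceInv k j m x * v i.succ j.succ l.succ m.succ := by
  have h1 : ∀ i j : Fin d, transformCurv (blockGL (one_mul 1) h) v i.succ j.succ i.succ j.succ
      = ∑ a : Fin d, ∑ b : Fin d, ∑ c : Fin d, ∑ f : Fin d, N a i * N c i * (N b j * N f j)
        * v a.succ b.succ c.succ f.succ := by
    intro i j
    simp only [transformCurv, blockGL_inv_coe]
    simp [Fin.sum_univ_succ, blockMat, blockInv]
    exact Finset.sum_congr rfl fun _ _ => Finset.sum_congr rfl fun _ _ =>
      Finset.sum_congr rfl fun _ _ => Finset.sum_congr rfl fun _ _ => by ring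
  simp only [h1, ← hN, Finset.sum_mul_sum]
  simp only [Finset.sum_mul]
  exact sum_comm_two_four _

theorem transformCurv_antisymm_left (A : GL (Fin (d + 1)) ℝ) {v : Tensor4 d}
    (hv : ∀ a b c f, v a b c f = - v b a c f) (a b c f : Fin (d + 1)) :
    transformCurv A v a b c f = - transformCurv A v b a c f := by
  simp only [transformCurv, ← Finset.sum_neg_distrib]
  rw [Finset.sum_comm]
  refine Finset.sum_congr rfl fun _ _ => Finset.sum_congr rfl fun _ _ =>
    Finset.sum_congr rfl fun _ _ => Finset.sum_congr rfl fun _ _ => ?_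
  rw [hv]; ring

theorem transformCurv_antisymm_right (A : GL (Fin (d + 1)) ℝ) {v : Tensor4 d}
    (hv : ∀ a b c f, v a b c f = - v a b f c) (a b c f : Fin (d + 1)) :
    transformCurv A v a b c f = - transformCurv A v a b f c := by
  simp only [transformCurv, ← Finset.sum_neg_distrib]
  refine Finset.sum_congr rfl fun _ _ => Finset.sum_congr rfl fun _ _ => ?_
  rw [Finset.sum_comm]
  refine Finset.sum_congr rfl fun _ _ => Finset.sum_congr rfl fun _ _ => ?_
  rw [hv]; ring

theorem curvVar_antisymm_left (Γ : Fin (d + 1) → Tensor2 d) (h : Tensor2 d)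
    (D : Fin (d + 1) → Tensor2 d) (D2 : Fin (d + 1) → Fin (d + 1) → Tensor2 d)
    (a b c f : Fin (d + 1)) : curvVar Γ h D D2 a b c f = - curvVar Γ h D D2 b a c f := by
  simp only [curvVar, curvLinear, mul_sub, Finset.sum_sub_distrib, Finset.sum_add_distrib]
  ring

/-- Exchanging c and f swaps the two Christoffel factors contracted with h, so the symmetry of h is
needed. The two antisymmetries are what `fderiv_canonical` requires of a variation of the curvature.
-/
theorem curvVar_antisymm_right (Γ : Fin (d + 1) → Tensor2 d) {h : Tensor2 d}
    (hh : ∀ a b, h a b = h b a) (D : Fin (d + 1) → Tensor2 d)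
    (D2 : Fin (d + 1) → Fin (d + 1) → Tensor2 d)
    (a b c f : Fin (d + 1)) : curvVar Γ h D D2 a b c f = - curvVar Γ h D D2 a b f c := by
  have e : ∀ P Q : Fin (d + 1) → ℝ, ∑ m, ∑ n, h m n * (P m * Q n)
      = ∑ m, ∑ n, h m n * (Q m * P n) := by
    intro P Q
    rw [Finset.sum_comm]
    exact Finset.sum_congr rfl fun _ _ => Finset.sum_congr rfl fun _ _ => by rw [hh]; ring
  simp only [curvVar, curvLinear, mul_sub, Finset.sum_sub_distrib, Finset.sum_add_distrib,
    e (fun m => Γ a c m), e (fun m => Γ b c m)]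
  ring

end Frame

/-! ### The reduced density as a function of (f, b, X, Y) -/

section Reduced

variable {d : ℕ}

namespace GravityTheory

variable (L : GravityTheory d)

/-- The Lagrangian at the canonical point with `g_{00} = -f`, `g_{ij} = b δ_{ij}` and curvature
coefficients `X`, `Y`. -/
def canonicalPoint (d : ℕ) (p : ℝ × ℝ × ℝ × ℝ) : Tensor2 d × Tensor4 d :=
  canonical d (- (p.1)⁻¹, (p.2.1)⁻¹, p.2.2.1, p.2.2.2)

/-- The Lagrangian density on FLRW metrics divided by the spatial volume density, as a function of
`(f, b, X, Y)`. -/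
def reducedDensity (p : ℝ × ℝ × ℝ × ℝ) : ℝ :=
  Real.sqrt (p.1 * p.2.1 ^ d) * L.lagrangian (canonicalPoint d p)

theorem contDiffAt_reducedDensity {p : ℝ × ℝ × ℝ × ℝ} (hf : 0 < p.1) (hb : 0 < p.2.1)
    (hp : canonicalPoint d p ∈ L.domain) : ContDiffAt ℝ ∞ L.reducedDensity p := by
  have h1 : ContDiffAt ℝ ∞ (fun q : ℝ × ℝ × ℝ × ℝ => Real.sqrt (q.1 * q.2.1 ^ d)) p := by
    refine ContDiffAt.sqrt ?_ (by positivity)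
    fun_prop
  have h2 : ContDiffAt ℝ ∞ (canonicalPoint d) p := by
    refine (canonical d).contDiff.contDiffAt.comp p ?_
    refine ContDiffAt.prodMk (contDiffAt_fst.inv hf.ne').neg (ContDiffAt.prodMk ?_ ?_)
    · exact ContDiffAt.inv (by fun_prop) hb.ne'
    · fun_prop
  exact h1.mul ((L.contDiffOn_lagrangian.contDiffAt (L.isOpen_domain.mem_nhds hp)).comp p h2)

/-- Product rule along a line. The canonical point contains -1/f and 1/b, whose derivatives f'/f²
and -b'/b² are exactly the variation -g⁻¹ h g⁻¹ of the inverse metric. -/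
theorem fderiv_reducedDensity {f b X Y : ℝ} (hf : 0 < f) (hb : 0 < b)
    (hp : canonicalPoint d (f, b, X, Y) ∈ L.domain) (f' b' X' Y' : ℝ) :
    fderiv ℝ L.reducedDensity (f, b, X, Y) (f', b', X', Y')
      = Real.sqrt (f * b ^ d) * ((1 / 2) * (f' / f + d * b' / b)
        * L.lagrangian (canonicalPoint d (f, b, X, Y))
        + fderiv ℝ L.lagrangian (canonicalPoint d (f, b, X, Y))
          (canonical d (f' / f ^ 2, - b' / b ^ 2, X', Y'))) := by
  have hline : HasDerivAt (fun s : ℝ => ((f + s * f', b + s * b', X + s * X', Y + s * Y') :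
      ℝ × ℝ × ℝ × ℝ)) (f', b', X', Y') 0 := by
    have h : ∀ r r' : ℝ, HasDerivAt (fun s : ℝ => r + s * r') r' 0 := by
      intro r r'
      simpa using ((hasDerivAt_id (0 : ℝ)).mul_const r').const_add r
    exact (h f f').prodMk ((h b b').prodMk ((h X X').prodMk (h Y Y')))
  have h1 : HasDerivAt (fun s : ℝ => L.reducedDensity (f + s * f', b + s * b', X + s * X',
      Y + s * Y')) (fderiv ℝ L.reducedDensity (f, b, X, Y) (f', b', X', Y')) 0 := by
    refine HasFDerivAt.comp_hasDerivAt (l := L.reducedDensity) (0 : ℝ) ?_ hline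
    simp only [zero_mul, add_zero]
    exact ((L.contDiffAt_reducedDensity hf hb hp).differentiableAt (by simp)).hasFDerivAt
  have hlf : HasDerivAt (fun s : ℝ => f + s * f') f' 0 := by
    simpa using ((hasDerivAt_id (0 : ℝ)).mul_const f').const_add f
  have hlb : HasDerivAt (fun s : ℝ => b + s * b') b' 0 := by
    simpa using ((hasDerivAt_id (0 : ℝ)).mul_const b').const_add b
  have hlX : HasDerivAt (fun s : ℝ => X + s * X') X' 0 := by
    simpa using ((hasDerivAt_id (0 : ℝ)).mul_const X').const_add X
  have hlY : HasDerivAt (fun s : ℝ => Y + s * Y') Y' 0 := by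
    simpa using ((hasDerivAt_id (0 : ℝ)).mul_const Y').const_add Y
  have hcan : HasDerivAt (fun s : ℝ => canonicalPoint d (f + s * f', b + s * b', X + s * X',
      Y + s * Y')) (canonical d (f' / f ^ 2, - b' / b ^ 2, X', Y')) 0 := by
    have h2 := (hlf.fun_inv (by simpa using hf.ne')).fun_neg.prodMk
      ((hlb.fun_inv (by simpa using hb.ne')).prodMk (hlX.prodMk hlY))
    have h3 := (canonical d).hasFDerivAt.comp_hasDerivAt (0 : ℝ) h2
    refine h3.congr_deriv ?_
    simp [neg_div]
  have hlag : HasDerivAt (fun s : ℝ => L.lagrangian (canonicalPoint d (f + s * f', b + s * b',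
      X + s * X', Y + s * Y'))) (fderiv ℝ L.lagrangian (canonicalPoint d (f, b, X, Y))
          (canonical d (f' / f ^ 2, - b' / b ^ 2, X', Y'))) 0 := by
    refine HasFDerivAt.comp_hasDerivAt (l := L.lagrangian) (0 : ℝ) ?_ hcan
    simp only [zero_mul, add_zero]
    exact (L.differentiableAt_lagrangian hp).hasFDerivAt
  have hsq : HasDerivAt (fun s : ℝ => Real.sqrt ((f + s * f') * (b + s * b') ^ d))
      (Real.sqrt (f * b ^ d) * ((1 / 2) * (f' / f + d * b' / b))) 0 := by
    have h2 := (hlf.fun_mul (hlb.fun_pow d)).sqrt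
      (by simpa using (by positivity : f * b ^ d ≠ 0))
    refine h2.congr_deriv ?_
    simp only [zero_mul, add_zero]
    have hpos : 0 < f * b ^ d := by positivity
    have hs := Real.sq_sqrt hpos.le
    have hs' := Real.sqrt_pos.2 hpos
    rw [div_eq_iff (by positivity)]
    -- The exponent d - 1 is a truncated subtraction; for d = 0 the factor d makes both sides
    -- vanish.
    have e : b ^ (d - 1) * d = b ^ d * (d / b) := by
      cases d with
      | zero => simp
      | succ n => simp; field_simp; ring
    have : f' * b ^ d + f * (↑d * b ^ (d - 1) * b')
        = (f * b ^ d) * (f' / f + d * b' / b) := by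
      have e' : ↑d * b ^ (d - 1) * b' = b ^ d * (d / b) * b' := by rw [← e]; ring
      rw [e']; field_simp
    rw [this]
    linear_combination (-(f' / f + d * b' / b)) * hs
  have h4 := h1.unique (hsq.fun_mul hlag)
  rw [h4]
  simp only [zero_mul, add_zero]
  ring

end GravityTheory

end Reduced

theorem sum_comm_two_two {ι : Type*} [Fintype ι] (f : ι → ι → ι → ι → ℝ) :
    ∑ i, ∑ j, ∑ a, ∑ b, f i j a b = ∑ a, ∑ b, ∑ i, ∑ j, f i j a b := by
  have h : ∀ g : ι → ι → ℝ, ∑ i, ∑ j, g i j = ∑ z : ι × ι, g z.1 z.2 := fun g =>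
    (Fintype.sum_prod_type' g).symm
  simp only [h]
  exact Finset.sum_comm

/-! ### The first variation in terms of the reduced density -/

section FLRWVariation

variable {d : ℕ} {k : ℝ} {a F : ℝ → ℝ} {I : Set ℝ} {x : Chart d}

/-- The values of `-g_{00}`, `a²` and of the two curvature coefficients of an FLRW metric. -/
def flrwPoint (k : ℝ) (a F : ℝ → ℝ) (t : ℝ) : ℝ × ℝ × ℝ × ℝ :=
  (F t, sqScale a t,
    timeCurv (sqScale a t) (deriv (sqScale a) t) (deriv (deriv (sqScale a)) t) (F t) (deriv F t),
    spaceCurv k (sqScale a t) (deriv (sqScale a) t) (F t))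

/-- The Christoffel symbols of an FLRW metric at a point. -/
def flrwGamma (k : ℝ) (a F : ℝ → ℝ) (x : Chart d) : Fin (d + 1) → Tensor2 d :=
  fun b c e => christoffel (flrw k a F) b c e x

/-- The variation of the curvature of an FLRW metric in the direction of `h`. -/
def flrwCurvVar (k : ℝ) (a F : ℝ → ℝ) (h : MetricField d) (x : Chart d) : Tensor4 d :=
  curvVar (flrwGamma k a F x) (h x) (metricD h x) (metricD2 h x)

namespace GravityTheory

variable (L : GravityTheory d)

theorem transformMap_flrw (hI : AdmissibleOn I a F) (ht : x 0 ∈ I) (hx : InFLRWChart k x)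
    {M N : Matrix (Fin d) (Fin d) ℝ} (h : M * N = 1)
    (hM : ∀ l m, ∑ i, M i l * M i m = spaceMetric k l m x)
    (hN : ∀ l m, ∑ i, N l i * N m i = spaceInv k l m x) :
    transformMap (blockGL (one_mul 1) h) (invMetric (flrw k a F) x, riemann (flrw k a F) x)
      = canonicalPoint d (flrwPoint k a F (x 0)) := by
  rw [transformMap_apply, invMetric_flrw hI ht hx, riemann_flrw hI ht hx, transformInv_blockGL,
    transformCurv_blockGL, sum_frame_inv h hN, sum_frame_metric h hM]
  simp only [one_pow, one_mul]
  rfl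

theorem transformMap_canonicalPoint (hI : AdmissibleOn I a F) (ht : x 0 ∈ I)
    (hx : InFLRWChart k x) {M N : Matrix (Fin d) (Fin d) ℝ} (h : N * M = 1)
    (hM : ∀ l m, ∑ i, M i l * M i m = spaceMetric k l m x)
    (hN : ∀ l m, ∑ i, N l i * N m i = spaceInv k l m x) :
    transformMap (blockGL (one_mul 1) h) (canonicalPoint d (flrwPoint k a F (x 0)))
      = (invMetric (flrw k a F) x, riemann (flrw k a F) x) := by
  have h1 : (fun i j => ∑ l, ∑ m, N i l * N j m * kron l m) = fun i j => spaceInv k i j x := by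
    funext i j
    simp only [sum_mul_kron, hN]
  have h2 : (fun i j => ∑ l, ∑ m, M l i * M m j * kron l m) = fun i j => spaceMetric k i j x := by
    funext i j
    simp only [sum_mul_kron, hM]
  rw [invMetric_flrw hI ht hx, riemann_flrw hI ht hx, canonicalPoint, canonical_apply,
    transformMap_apply, transformInv_blockGL, transformCurv_blockGL, h1, h2]
  simp only [one_pow, one_mul]
  rfl

/-- The orthonormal frame and its inverse carry the FLRW pair to the canonical one and back, and the
domain is invariant. Being defined thus depends on time only. -/
theorem definedAt_flrw_iff (hI : AdmissibleOn I a F) (ht : x 0 ∈ I) (hx : InFLRWChart k x) :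
    L.DefinedAt (flrw k a F) x ↔ canonicalPoint d (flrwPoint k a F (x 0)) ∈ L.domain := by
  obtain ⟨M, N, h, hM, hN⟩ := exists_orthonormal_frame hx
  constructor
  · intro hdef
    rw [← transformMap_flrw hI ht hx h hM hN]
    exact L.transform_mem_domain _ _ _ hdef
  · intro hdef
    unfold DefinedAt
    rw [← transformMap_canonicalPoint hI ht hx (mul_eq_one_comm.1 h) hM hN]
    exact L.transform_mem_domain _ _ _ hdef

theorem eval_flrw (hI : AdmissibleOn I a F) (ht : x 0 ∈ I) (hx : InFLRWChart k x)
    (hdef : L.DefinedAt (flrw k a F) x) :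
    L.eval (flrw k a F) x = L.lagrangian (canonicalPoint d (flrwPoint k a F (x 0))) := by
  obtain ⟨M, N, h, hM, hN⟩ := exists_orthonormal_frame hx
  rw [← transformMap_flrw hI ht hx h hM hN]
  exact (L.lagrangian_transform _ _ _ hdef).symm

/-- The first variation on an FLRW background only depends on four traces of the variation. -/
theorem firstVariation_flrw (hd : 2 ≤ d) (hI : AdmissibleOn I a F) (ht : x 0 ∈ I)
    (hx : InFLRWChart k x) (hdef : L.DefinedAt (flrw k a F) x) {h : MetricField d}
    (hh : ∀ a b, ContDiffAt ℝ 2 (fun y => h y a b) x) (hhs : ∀ y a b, h y a b = h y b a) :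
    L.firstVariation (flrw k a F) h x = rho k x * fderiv ℝ L.reducedDensity
      (flrwPoint k a F (x 0)) (- h x 0 0,
        (∑ i : Fin d, ∑ j : Fin d, spaceInv k i j x * h x i.succ j.succ) / d,
        (∑ i : Fin d, ∑ j : Fin d,
          spaceInv k i j x * flrwCurvVar k a F h x 0 i.succ 0 j.succ) / d,
        (∑ i : Fin d, ∑ j : Fin d, ∑ l : Fin d, ∑ m : Fin d, spaceInv k i l x * spaceInv k j m x
          * flrwCurvVar k a F h x i.succ j.succ l.succ m.succ) / (d * (d - 1))) := by
  have hF := hI.lapse_pos _ ht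
  have hb := hI.sqScale_pos ht
  have hρ := rho_pos hx
  have hd0 : (d : ℝ) ≠ 0 := by positivity
  have hp := (L.definedAt_flrw_iff hI ht hx).1 hdef
  obtain ⟨M, N, hMN, hM, hN⟩ := exists_orthonormal_frame hx
  have hfr := transformMap_flrw hI ht hx hMN hM hN
  rw [L.firstVariation_eq (fun i j => (contDiffAt_flrw hI ht hx i j).of_le
      ENat.LEInfty.out)
    flrw_comm hh hhs (det_flrw_ne_zero hI ht hx) hdef, L.eval_flrw hI ht hx hdef]
  -- The derivative is transported to the canonical point, where it sees only four traces.
  rw [← L.fderiv_transformMap (blockGL (one_mul 1) hMN) hdef, hfr, transformMap_apply]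
  have hv1 := transformCurv_antisymm_left (blockGL (one_mul 1) hMN)
    (curvVar_antisymm_left (flrwGamma k a F x) (h x) (metricD h x) (metricD2 h x))
  have hv2 := transformCurv_antisymm_right (blockGL (one_mul 1) hMN)
    (curvVar_antisymm_right (flrwGamma k a F x) (h := h x) (hhs x) (metricD h x) (metricD2 h x))
  rw [show canonicalPoint d (flrwPoint k a F (x 0)) = canonical d _ from rfl] at hp ⊢
  erw [L.fderiv_canonical hd hp hv1 hv2]
  simp only [transformInv_blockGL_zero, sum_transformInv_blockGL hMN hM,
    sum_transformCurv_blockGL_time hMN hN, sum_transformCurv_blockGL_space hMN hN]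
  have hinv := invMetric_flrw hI ht hx
  have hinv' : ∀ i j, (flrw k a F x)⁻¹ i j = blockInv (fun i j => spaceInv k i j x)
      (-(F (x 0))⁻¹) (sqScale a (x 0))⁻¹ i j := fun i j => congrFun (congrFun hinv i) j
  have hu0 : invVar (invMetric (flrw k a F) x) (h x) 0 0 = (- h x 0 0) / F (x 0) ^ 2 := by
    rw [hinv]
    simp only [invVar, blockInv, Fin.sum_univ_succ, timeArr_zero, timeArr_succ,
      spaceArr_zero_left, spaceArr_zero_right, mul_zero, zero_mul, mul_one, add_zero,
      Finset.sum_const_zero]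
    field_simp
  -- The γ-trace of γ⁻¹ h γ⁻¹ is the γ⁻¹-trace of h.
  have hsum : ∀ c e : Fin d, ∑ l : Fin d, ∑ m : Fin d, spaceMetric k l m x
      * (spaceInv k l c x * h x c.succ e.succ * spaceInv k e m x)
      = spaceInv k c e x * h x c.succ e.succ := by
    intro c e
    have h1 : ∀ l, ∑ m : Fin d, spaceMetric k l m x
        * (spaceInv k l c x * h x c.succ e.succ * spaceInv k e m x)
        = h x c.succ e.succ * spaceInv k l c x * kron l e := by
      intro l
      rw [← sum_spaceMetric_mul_spaceInv hx l e, Finset.mul_sum]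
      exact Finset.sum_congr rfl fun m _ => by rw [spaceInv_comm e m]; ring
    simp only [h1]
    rw [sum_mul_kron', spaceInv_comm e c]; ring
  have hu1 : ∑ l : Fin d, ∑ m : Fin d, spaceMetric k l m x
      * invVar (invMetric (flrw k a F) x) (h x) l.succ m.succ
      = - (∑ i : Fin d, ∑ j : Fin d, spaceInv k i j x * h x i.succ j.succ)
        / sqScale a (x 0) ^ 2 := by
    have h1 : ∀ l m : Fin d, spaceMetric k l m x
        * invVar (invMetric (flrw k a F) x) (h x) l.succ m.succ
        = - ((sqScale a (x 0))⁻¹ ^ 2 * ∑ c : Fin d, ∑ e : Fin d, spaceMetric k l m x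
          * (spaceInv k l c x * h x c.succ e.succ * spaceInv k e m x)) := by
      intro l m
      rw [hinv]
      simp only [invVar, blockInv, Fin.sum_univ_succ, timeArr_zero, timeArr_succ,
        spaceArr_zero_left, spaceArr_zero_right, spaceArr_succ, mul_zero, zero_mul, add_zero,
        Finset.sum_const_zero, zero_add, Finset.mul_sum, mul_neg]
      congr 1
      exact Finset.sum_congr rfl fun _ _ => Finset.sum_congr rfl fun _ _ => by ring
    have h2 : ∀ (r : ℝ) (T : Fin d → Fin d → Fin d → Fin d → ℝ),
        ∑ l, ∑ m, (r * ∑ c, ∑ e, T l m c e) = r * ∑ c, ∑ e, ∑ l, ∑ m, T l m c e := by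
      intro r T
      rw [← sum_comm_two_two]; simp only [Finset.mul_sum]
    simp only [h1, Finset.sum_neg_distrib]
    erw [h2]
    simp only [hsum]
    field_simp
  have htr : ((flrw k a F x)⁻¹ * h x).trace = - h x 0 0 / F (x 0)
      + d * ((∑ i : Fin d, ∑ j : Fin d, spaceInv k i j x * h x i.succ j.succ) / d)
        / sqScale a (x 0) := by
    simp only [Matrix.trace, Matrix.diag_apply, Matrix.mul_apply, hinv', blockInv,
      Fin.sum_univ_succ, timeArr_zero, timeArr_succ, spaceArr_zero_left, spaceArr_zero_right,
      spaceArr_succ, mul_zero, zero_mul, mul_one, add_zero, zero_add, Finset.sum_const_zero,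
      mul_assoc, ← Finset.mul_sum]
    have : ∑ i : Fin d, ∑ j : Fin d, spaceInv k i j x * h x j.succ i.succ
        = ∑ i : Fin d, ∑ j : Fin d, spaceInv k i j x * h x i.succ j.succ :=
      Finset.sum_congr rfl fun i _ => Finset.sum_congr rfl fun j _ => by rw [hhs]
    rw [this]
    field_simp
  have hdet : Real.sqrt |(flrw k a F x).det|
      = rho k x * Real.sqrt (F (x 0) * sqScale a (x 0) ^ d) := by
    rw [det_flrw hx, abs_neg, abs_of_pos (by positivity), Real.sqrt_mul (by positivity),
      Real.sqrt_sq hρ.le, mul_comm]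
  have hred := L.fderiv_reducedDensity (X := (flrwPoint k a F (x 0)).2.2.1)
    (Y := (flrwPoint k a F (x 0)).2.2.2) hF hb hp
  rw [hu0, hu1, htr, hdet]
  -- The direction in which Λ is differentiated: f' = -h_{00} because g_{00} = -f, and b' is the
  -- mean of the spatial trace of h; X' and Y' are the normalised traces of the varied curvature.
  have := hred (- h x 0 0) ((∑ i : Fin d, ∑ j : Fin d, spaceInv k i j x * h x i.succ j.succ) / d)
        ((∑ i : Fin d, ∑ j : Fin d,
          spaceInv k i j x * flrwCurvVar k a F h x 0 i.succ 0 j.succ) / d)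
        ((∑ i : Fin d, ∑ j : Fin d, ∑ l : Fin d, ∑ m : Fin d, spaceInv k i l x * spaceInv k j m x
          * flrwCurvVar k a F h x i.succ j.succ l.succ m.succ) / (d * (d - 1)))
  refine Eq.trans ?_ (congrArg (fun r => rho k x * r) this).symm
  have e : ∀ S : ℝ, -S / sqScale a (x 0) ^ 2 / d = -(S / d) / sqScale a (x 0) ^ 2 := by
    intro S; ring
  rw [mul_assoc, e]
  rfl

end GravityTheory

end FLRWVariation

/-! ### Contractions of a constant symmetric array -/

section Contractions

variable {d : ℕ} {k : ℝ} {x : Chart d}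

/-- The spatial trace `γ^{ij} S_{ij}`. -/
def spaceTrace (k : ℝ) (S : Tensor2 d) (x : Chart d) : ℝ :=
  ∑ i : Fin d, ∑ j : Fin d, spaceInv k i j x * S i.succ j.succ

/-- The spatial vector `γ^{ij} S_{tj}`. -/
def shiftVec (k : ℝ) (S : Tensor2 d) (i : Fin d) (x : Chart d) : ℝ :=
  ∑ j : Fin d, spaceInv k i j x * S 0 j.succ

/-- The contraction `x^j S_{tj}`. -/
def shiftPos (S : Tensor2 d) (x : Chart d) : ℝ := ∑ j : Fin d, x j.succ * S 0 j.succ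

/-- The array `γ^{il} γ^{jm} S_{lm}`. -/
def spaceRaise (k : ℝ) (S : Tensor2 d) (i j : Fin d) (x : Chart d) : ℝ :=
  ∑ l : Fin d, ∑ m : Fin d, spaceInv k i l x * spaceInv k j m x * S l.succ m.succ

/-- The contraction `S_{ij} x^j`. -/
def posRow (S : Tensor2 d) (i : Fin d) (x : Chart d) : ℝ :=
  ∑ j : Fin d, S i.succ j.succ * x j.succ

/-- The spatial vector `γ^{ij} S_{jm} x^m`. -/
def posVec (k : ℝ) (S : Tensor2 d) (i : Fin d) (x : Chart d) : ℝ :=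
  ∑ j : Fin d, spaceInv k i j x * posRow S j x

/-- The contraction `x^i S_{ij} x^j`. -/
def posQuad (S : Tensor2 d) (x : Chart d) : ℝ := ∑ i : Fin d, x i.succ * posRow S i x

/-- The part `x^i f_i` of a first derivative. -/
def posDot (f : Fin (d + 1) → ℝ) (x : Chart d) : ℝ := ∑ i : Fin d, x i.succ * f i.succ

theorem sum_spaceInv_mul_spaceMetric_self (hx : InFLRWChart k x) :
    ∑ i : Fin d, ∑ j : Fin d, spaceInv k i j x * spaceMetric k i j x = d := by
  rw [← sum_kron_self]
  refine Finset.sum_congr rfl fun i _ => ?_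
  rw [← sum_spaceInv_mul_spaceMetric hx i i]
  exact Finset.sum_congr rfl fun j _ => by rw [spaceMetric_comm]

end Contractions

/-! ### Traces of the varied curvature -/

section Traces

variable {d : ℕ} {k : ℝ} {a F : ℝ → ℝ} {I : Set ℝ} {x : Chart d}

/-- The jet of a scalar multiple of a constant array. -/
theorem flrwCurvVar_smul {φ : Chart d → ℝ} (hφ : ContDiff ℝ 2 φ) (S : Tensor2 d) :
    flrwCurvVar k a F (fun y => φ y • Matrix.of S) x = curvVar (flrwGamma k a F x)
      (fun i j => φ x * S i j) (fun c i j => pd c φ x * S i j)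
      (fun c e i j => pd c (pd e φ) x * S i j) := by
  have h1 : ∀ y c i j, pd c (fun y => (φ y • Matrix.of S) i j) y = pd c φ y * S i j := by
    intro y c i j
    have hd := hφ.contDiffAt (x := y).differentiableAt (by norm_num)
    simp only [Matrix.smul_apply, Matrix.of_apply, smul_eq_mul]
    rw [pd_mul hd (differentiableAt_const _), pd_const]; ring
  have h2 : ∀ c e i j, pd c (pd e (fun y => (φ y • Matrix.of S) i j)) x
      = pd c (pd e φ) x * S i j := by
    intro c e i j
    have : pd e (fun y => (φ y • Matrix.of S) i j) = fun y => pd e φ y * S i j :=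
      funext fun y => h1 y e i j
    have hd := (contDiffAt_pd (hφ.contDiffAt (x := x)) (m := 1) (by norm_num) e).differentiableAt
      (by norm_num)
    rw [this, pd_mul hd (differentiableAt_const _), pd_const]; ring
  unfold flrwCurvVar
  congr 1
  · funext c i j; exact h1 x c i j
  · funext c e i j; exact h2 c e i j

theorem curvVar_flrwGamma_time (hI : AdmissibleOn I a F) (ht : x 0 ∈ I) (hx : InFLRWChart k x)
    {S : Tensor2 d} (hS : ∀ i j, S i j = S j i) (p : ℝ) (p₁ : Fin (d + 1) → ℝ) (p₂ : Tensor2 d)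
    (i j : Fin d) :
    curvVar (flrwGamma k a F x) (fun i j => p * S i j) (fun c i j => p₁ c * S i j)
      (fun c e i j => p₂ c e * S i j) 0 i.succ 0 j.succ
    = (1 / 2) * (p₂ i.succ 0 * S 0 j.succ + p₂ 0 j.succ * S 0 i.succ - p₂ 0 0 * S i.succ j.succ
        - p₂ i.succ j.succ * S 0 0)
      + hubble a (x 0) * p₁ 0 * S i.succ j.succ
      - (1 / 2) * lapseRate F (x 0) * (p₁ i.succ * S 0 j.succ + p₁ j.succ * S 0 i.succ
        - p₁ 0 * S i.succ j.succ)
      - spaceMetric k i j x * ((1 / 2) * expansion a F (x 0) * p₁ 0 * S 0 0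
        + k * (p₁ 0 * shiftPos S x - (1 / 2) * posDot p₁ x * S 0 0))
      - hubble a (x 0) ^ 2 * p * S i.succ j.succ
      + lapseRate F (x 0) * spaceMetric k i j x * p
        * (expansion a F (x 0) * S 0 0 + k * shiftPos S x) := by
  simp only [curvVar, curvLinear, lowChristoffel, flrwGamma, Fin.sum_univ_succ,
    christoffel_flrw_upper_time hI ht hx, christoffel_flrw_zero_zero_succ hI ht hx,
    christoffel_flrw_zero_succ_succ hI ht hx, christoffel_flrw_succ_zero_succ hI ht hx,
    christoffel_flrw_succ_succ_succ hI ht hx, timeArr_zero, timeArr_succ, spaceArr_zero_left,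
    spaceArr_zero_right, spaceArr_succ, mul_zero, zero_mul, add_zero, zero_add, sub_zero, mul_one,
    hS _ 0, Finset.sum_const_zero, zero_sub]
  have r1 : ∀ (i : Fin d) (f : Fin d → ℝ),
      ∑ m, f m * (hubble a (x 0) * kron i m) = hubble a (x 0) * f i := by
    intro i f
    rw [← sum_mul_kron i f, Finset.mul_sum]
    exact Finset.sum_congr rfl fun m _ => by ring
  have r2 : ∑ m : Fin d, 1 / 2 * (p₁ 0 * S 0 m.succ + p₁ 0 * S 0 m.succ - p₁ m.succ * S 0 0)
      * (k * x m.succ * spaceMetric k i j x)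
      = k * spaceMetric k i j x * (p₁ 0 * shiftPos S x - (1 / 2) * posDot p₁ x * S 0 0) := by
    simp only [shiftPos, posDot, Finset.mul_sum, Finset.sum_mul, ← Finset.sum_sub_distrib]
    exact Finset.sum_congr rfl fun m _ => by ring
  have r3 : ∑ m : Fin d, p * S 0 m.succ * -(k * x m.succ * spaceMetric k i j x * lapseRate F (x 0))
      = - (p * (k * spaceMetric k i j x * lapseRate F (x 0)) * shiftPos S x) := by
    simp only [shiftPos, Finset.mul_sum, ← Finset.sum_neg_distrib]
    exact Finset.sum_congr rfl fun m _ => by ring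
  have r4 : ∑ m : Fin d, ∑ n : Fin d, p * S m.succ n.succ
      * (hubble a (x 0) * kron j m * (hubble a (x 0) * kron i n))
      = hubble a (x 0) ^ 2 * p * S i.succ j.succ := by
    have : ∀ m n : Fin d, p * S m.succ n.succ
        * (hubble a (x 0) * kron j m * (hubble a (x 0) * kron i n))
        = hubble a (x 0) ^ 2 * p * kron j m * (S m.succ n.succ * kron i n) := fun m n => by ring
    simp only [this, ← Finset.mul_sum, sum_mul_kron]
    rw [hS i.succ, ← sum_kron_mul j (fun m => S m.succ i.succ), Finset.mul_sum]
    exact Finset.sum_congr rfl fun m _ => by ring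
  simp only [Finset.sum_add_distrib, Finset.sum_sub_distrib, r1, r2, r3, r4, hS j.succ i.succ]
  ring

/-- The contraction of a linearised Christoffel symbol with the vector `c^e` in
`Γ_{ij}^e = c^e γ_{ij}`. -/
def normalChristoffel (k K : ℝ) (S : Tensor2 d) (p₁ : Fin (d + 1) → ℝ) (x : Chart d)
    (i j : Fin d) : ℝ :=
  (1 / 2) * (K * (p₁ i.succ * S 0 j.succ + p₁ j.succ * S 0 i.succ - p₁ 0 * S i.succ j.succ)
    + k * (p₁ i.succ * posRow S j x + p₁ j.succ * posRow S i x - posDot p₁ x * S i.succ j.succ))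

/-- The contraction of a constant array with the vector `c^e` in `Γ_{ij}^e = c^e γ_{ij}`. -/
def normalQuad (k K : ℝ) (S : Tensor2 d) (x : Chart d) : ℝ :=
  K ^ 2 * S 0 0 + 2 * K * k * shiftPos S x + k ^ 2 * posQuad S x

/-- All symbols with two lower spatial indices have the form c^e γ_{ij} with the single vector c =
(K, k x). The varied symbols therefore enter only through their contraction with c, and the
quadratic part only through S(c, c). -/
theorem curvVar_flrwGamma_space (hI : AdmissibleOn I a F) (ht : x 0 ∈ I) (hx : InFLRWChart k x)
    {S : Tensor2 d} (hS : ∀ i j, S i j = S j i) (p : ℝ) (p₁ : Fin (d + 1) → ℝ) (p₂ : Tensor2 d)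
    (i j l m : Fin d) :
    curvVar (flrwGamma k a F x) (fun i j => p * S i j) (fun c i j => p₁ c * S i j)
      (fun c e i j => p₂ c e * S i j) i.succ j.succ l.succ m.succ
    = (1 / 2) * (p₂ j.succ l.succ * S i.succ m.succ + p₂ i.succ m.succ * S j.succ l.succ
        - p₂ i.succ l.succ * S j.succ m.succ - p₂ j.succ m.succ * S i.succ l.succ)
      + (normalChristoffel k (expansion a F (x 0)) S p₁ x i m * spaceMetric k j l x
        + normalChristoffel k (expansion a F (x 0)) S p₁ x j l * spaceMetric k i m x
        - normalChristoffel k (expansion a F (x 0)) S p₁ x j m * spaceMetric k i l x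
        - normalChristoffel k (expansion a F (x 0)) S p₁ x i l * spaceMetric k j m x)
      - p * normalQuad k (expansion a F (x 0)) S x * (spaceMetric k i m x * spaceMetric k j l x
        - spaceMetric k j m x * spaceMetric k i l x) := by
  set K := expansion a F (x 0) with hK
  have hΓ : ∀ (i j : Fin d) (e : Fin (d + 1)), flrwGamma k a F x i.succ j.succ e
      = (Fin.cons K (fun n => k * x n.succ) : Fin (d + 1) → ℝ) e * spaceMetric k i j x := by
    intro i j e
    cases e using Fin.cases with
    | zero => simp [flrwGamma, christoffel_flrw_upper_time hI ht hx, ← hK]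
    | succ n => simp [flrwGamma, christoffel_flrw_succ_succ_succ hI ht hx]
  set c : Fin (d + 1) → ℝ := Fin.cons K (fun n => k * x n.succ) with hc
  have hB : ∀ i j : Fin d, ∑ e, lowChristoffel (fun c i j => p₁ c * S i j) e i.succ j.succ * c e
      = normalChristoffel k K S p₁ x i j := by
    intro i j
    rw [Fin.sum_univ_succ]
    simp only [lowChristoffel, hc, Fin.cons_zero, Fin.cons_succ, normalChristoffel, posRow, posDot,
      Finset.mul_sum, Finset.sum_mul, hS _ 0]
    rw [← Finset.sum_add_distrib, ← Finset.sum_sub_distrib, mul_add, Finset.mul_sum, Finset.mul_sum]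
    congr 1
    · ring
    · exact Finset.sum_congr rfl fun n _ => by rw [hS i.succ, hS j.succ n.succ]; ring
  have hQ : ∑ m, ∑ n, S m n * (c m * c n) = normalQuad k K S x := by
    simp only [Fin.sum_univ_succ, hc, Fin.cons_zero, Fin.cons_succ, normalQuad, posQuad, posRow,
      shiftPos, Finset.sum_add_distrib, Finset.mul_sum, hS _ 0]
    rw [← add_assoc]
    congr 1
    · rw [add_assoc, ← Finset.sum_add_distrib]
      congr 1
      · ring
      · exact Finset.sum_congr rfl fun n _ => by ring
    · exact Finset.sum_congr rfl fun m _ => Finset.sum_congr rfl fun n _ => by ring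
  have h1 : ∀ i j l m : Fin d, ∑ e, lowChristoffel (fun c i j => p₁ c * S i j) e i.succ m.succ
      * (c e * spaceMetric k j l x) = normalChristoffel k K S p₁ x i m * spaceMetric k j l x := by
    intro i j l m
    rw [← hB, Finset.sum_mul]
    exact Finset.sum_congr rfl fun e _ => by ring
  have h2 : ∑ e, ∑ n, p * S e n * (c e * spaceMetric k i m x * (c n * spaceMetric k j l x)
      - c e * spaceMetric k j m x * (c n * spaceMetric k i l x))
      = p * normalQuad k K S x * (spaceMetric k i m x * spaceMetric k j l x
        - spaceMetric k j m x * spaceMetric k i l x) := by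
    rw [← hQ]
    simp only [Finset.mul_sum, Finset.sum_mul]
    exact Finset.sum_congr rfl fun e _ => Finset.sum_congr rfl fun n _ => by ring
  simp only [curvVar, curvLinear, hΓ, Finset.sum_add_distrib, Finset.sum_sub_distrib, h1]
  rw [h2]

theorem sum_spaceInv_flrwCurvVar_time (hI : AdmissibleOn I a F) (ht : x 0 ∈ I)
    (hx : InFLRWChart k x) {S : Tensor2 d} (hS : ∀ i j, S i j = S j i) (p : ℝ)
    (p₁ : Fin (d + 1) → ℝ) {p₂ : Tensor2 d} (hp : ∀ i j, p₂ i j = p₂ j i) :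
    ∑ i : Fin d, ∑ j : Fin d, spaceInv k i j x *
      curvVar (flrwGamma k a F x) (fun i j => p * S i j) (fun c i j => p₁ c * S i j)
        (fun c e i j => p₂ c e * S i j) 0 i.succ 0 j.succ
    = ∑ i : Fin d, shiftVec k S i x * p₂ 0 i.succ - (1 / 2) * spaceTrace k S x * p₂ 0 0
      - (1 / 2) * S 0 0 * spaceTrace k p₂ x
      + (hubble a (x 0) + lapseRate F (x 0) / 2) * spaceTrace k S x * p₁ 0
      - lapseRate F (x 0) * ∑ i : Fin d, shiftVec k S i x * p₁ i.succ
      - d * ((1 / 2) * expansion a F (x 0) * S 0 0 * p₁ 0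
        + k * (shiftPos S x * p₁ 0 - (1 / 2) * S 0 0 * posDot p₁ x))
      - hubble a (x 0) ^ 2 * spaceTrace k S x * p
      + lapseRate F (x 0) * d * p * (expansion a F (x 0) * S 0 0 + k * shiftPos S x) := by
  set N := lapseRate F (x 0)
  set K := expansion a F (x 0)
  set H := hubble a (x 0)
  have hW : ∀ f : Fin d → ℝ, ∑ i : Fin d, ∑ j : Fin d, spaceInv k i j x * (f i * S 0 j.succ)
      = ∑ i : Fin d, shiftVec k S i x * f i := by
    intro f
    simp only [shiftVec, Finset.sum_mul]
    exact Finset.sum_congr rfl fun i _ => Finset.sum_congr rfl fun j _ => by ring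
  have hW' : ∀ f : Fin d → ℝ, ∑ i : Fin d, ∑ j : Fin d, spaceInv k i j x * (f j * S 0 i.succ)
      = ∑ i : Fin d, shiftVec k S i x * f i := by
    intro f
    rw [← hW, Finset.sum_comm]
    exact Finset.sum_congr rfl fun i _ => Finset.sum_congr rfl fun j _ => by rw [spaceInv_comm]
  have hbody : ∀ i j : Fin d, spaceInv k i j x *
      curvVar (flrwGamma k a F x) (fun i j => p * S i j) (fun c i j => p₁ c * S i j)
        (fun c e i j => p₂ c e * S i j) 0 i.succ 0 j.succ
      = (1 / 2) * (spaceInv k i j x * (p₂ 0 i.succ * S 0 j.succ))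
        + (1 / 2) * (spaceInv k i j x * (p₂ 0 j.succ * S 0 i.succ))
        + (- (1 / 2) * p₂ 0 0 + H * p₁ 0 + (1 / 2) * N * p₁ 0 - H ^ 2 * p)
          * (spaceInv k i j x * S i.succ j.succ)
        - (1 / 2) * S 0 0 * (spaceInv k i j x * p₂ i.succ j.succ)
        - (1 / 2) * N * (spaceInv k i j x * (p₁ i.succ * S 0 j.succ))
        - (1 / 2) * N * (spaceInv k i j x * (p₁ j.succ * S 0 i.succ))
        + (N * p * (K * S 0 0 + k * shiftPos S x) - ((1 / 2) * K * p₁ 0 * S 0 0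
          + k * (p₁ 0 * shiftPos S x - (1 / 2) * posDot p₁ x * S 0 0)))
          * (spaceInv k i j x * spaceMetric k i j x) := by
    intro i j
    rw [curvVar_flrwGamma_time hI ht hx hS, hp i.succ 0]
    ring
  simp only [hbody, Finset.sum_add_distrib, Finset.sum_sub_distrib, ← Finset.mul_sum]
  rw [hW fun i => p₂ 0 i.succ, hW' fun i => p₂ 0 i.succ, hW fun i => p₁ i.succ,
    hW' fun i => p₁ i.succ, sum_spaceInv_mul_spaceMetric_self hx]
  simp only [spaceTrace]
  ring

/-- Symmetry of γ⁻¹ identifies the two gradient terms of each kind, which removes the factor one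
half. -/
theorem sum_spaceInv_normalChristoffel (K : ℝ) (S : Tensor2 d) (p₁ : Fin (d + 1) → ℝ) :
    ∑ i : Fin d, ∑ j : Fin d, spaceInv k i j x * normalChristoffel k K S p₁ x i j
    = K * (∑ i : Fin d, shiftVec k S i x * p₁ i.succ - (1 / 2) * p₁ 0 * spaceTrace k S x)
      + k * (∑ i : Fin d, posVec k S i x * p₁ i.succ
        - (1 / 2) * posDot p₁ x * spaceTrace k S x) := by
  have hW : ∀ f g : Fin d → ℝ, ∑ i : Fin d, ∑ j : Fin d, spaceInv k i j x * (f i * g j)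
      = ∑ i : Fin d, (∑ j : Fin d, spaceInv k i j x * g j) * f i := by
    intro f g
    simp only [Finset.sum_mul]
    exact Finset.sum_congr rfl fun i _ => Finset.sum_congr rfl fun j _ => by ring
  have hW' : ∀ f g : Fin d → ℝ, ∑ i : Fin d, ∑ j : Fin d, spaceInv k i j x * (f j * g i)
      = ∑ i : Fin d, (∑ j : Fin d, spaceInv k i j x * g j) * f i := by
    intro f g
    rw [← hW, Finset.sum_comm]
    exact Finset.sum_congr rfl fun i _ => Finset.sum_congr rfl fun j _ => by rw [spaceInv_comm]
  have hbody : ∀ i j : Fin d, spaceInv k i j x * normalChristoffel k K S p₁ x i j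
      = (1 / 2) * K * (spaceInv k i j x * (p₁ i.succ * S 0 j.succ))
        + (1 / 2) * K * (spaceInv k i j x * (p₁ j.succ * S 0 i.succ))
        + (1 / 2) * k * (spaceInv k i j x * (p₁ i.succ * posRow S j x))
        + (1 / 2) * k * (spaceInv k i j x * (p₁ j.succ * posRow S i x))
        - ((1 / 2) * K * p₁ 0 + (1 / 2) * k * posDot p₁ x)
          * (spaceInv k i j x * S i.succ j.succ) := by
    intro i j
    simp only [normalChristoffel]; ring
  simp only [hbody, Finset.sum_add_distrib, Finset.sum_sub_distrib, ← Finset.mul_sum]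
  rw [hW (fun i => p₁ i.succ) (fun i => S 0 i.succ), hW' (fun i => p₁ i.succ)
    (fun i => S 0 i.succ), hW (fun i => p₁ i.succ) (fun i => posRow S i x),
    hW' (fun i => p₁ i.succ) (fun i => posRow S i x)]
  simp only [spaceTrace, shiftVec, posVec]
  ring

/-- The double trace of a product of two arrays, with the two pairings of indices. -/
theorem sum_spaceInv_spaceInv_mul_straight (f g : Fin d → Fin d → ℝ) :
    ∑ i : Fin d, ∑ j : Fin d, ∑ l : Fin d, ∑ m : Fin d,
      spaceInv k i l x * spaceInv k j m x * (f i l * g j m)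
    = (∑ i : Fin d, ∑ l : Fin d, spaceInv k i l x * f i l)
      * ∑ j : Fin d, ∑ m : Fin d, spaceInv k j m x * g j m := by
  calc _ = ∑ i : Fin d, ∑ l : Fin d, ∑ j : Fin d, ∑ m : Fin d,
        spaceInv k i l x * spaceInv k j m x * (f i l * g j m) :=
        Finset.sum_congr rfl fun i _ => Finset.sum_comm
    _ = _ := by
      simp only [Finset.sum_mul]
      refine Finset.sum_congr rfl fun i _ => Finset.sum_congr rfl fun l _ => ?_
      simp only [Finset.mul_sum]
      exact Finset.sum_congr rfl fun j _ => Finset.sum_congr rfl fun m _ => by ring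

/-- When γ links the two inverse metrics crosswise, it cancels one of them and leaves a single
trace; paired straight it would give an extra factor d. -/
theorem sum_spaceInv_spaceInv_mul_spaceMetric (hx : InFLRWChart k x) (f : Fin d → Fin d → ℝ) :
    ∑ i : Fin d, ∑ j : Fin d, ∑ l : Fin d, ∑ m : Fin d,
      spaceInv k i l x * spaceInv k j m x * (f i m * spaceMetric k j l x)
    = ∑ i : Fin d, ∑ j : Fin d, spaceInv k i j x * f i j := by
  refine Finset.sum_congr rfl fun i _ => ?_
  calc _ = ∑ m : Fin d, ∑ j : Fin d, ∑ l : Fin d,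
        spaceInv k i l x * spaceInv k j m x * (f i m * spaceMetric k j l x) := by
        rw [Finset.sum_comm (γ := Fin d)]
        calc _ = ∑ l : Fin d, ∑ m : Fin d, ∑ j : Fin d,
            spaceInv k i l x * spaceInv k j m x * (f i m * spaceMetric k j l x) :=
            Finset.sum_congr rfl fun l _ => Finset.sum_comm
          _ = ∑ m : Fin d, ∑ l : Fin d, ∑ j : Fin d,
            spaceInv k i l x * spaceInv k j m x * (f i m * spaceMetric k j l x) := Finset.sum_comm
          _ = _ := Finset.sum_congr rfl fun m _ => Finset.sum_comm
    _ = _ := by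
      refine Finset.sum_congr rfl fun m _ => ?_
      have h : ∀ j : Fin d, ∑ l : Fin d,
          spaceInv k i l x * spaceInv k j m x * (f i m * spaceMetric k j l x)
          = f i m * spaceInv k j m x * kron i j := by
        intro j
        rw [← sum_spaceInv_mul_spaceMetric hx i j, Finset.mul_sum]
        exact Finset.sum_congr rfl fun l _ => by rw [spaceMetric_comm j l]; ring
      simp only [h, sum_mul_kron]
      ring

theorem sum_spaceInv_spaceInv_swap (f : Fin d → Fin d → Fin d → Fin d → ℝ) :
    ∑ i : Fin d, ∑ j : Fin d, ∑ l : Fin d, ∑ m : Fin d,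
      spaceInv k i l x * spaceInv k j m x * f j i m l
    = ∑ i : Fin d, ∑ j : Fin d, ∑ l : Fin d, ∑ m : Fin d,
      spaceInv k i l x * spaceInv k j m x * f i j l m := by
  rw [Finset.sum_comm]
  refine Finset.sum_congr rfl fun i _ => Finset.sum_congr rfl fun j _ => ?_
  rw [Finset.sum_comm]
  exact Finset.sum_congr rfl fun l _ => Finset.sum_congr rfl fun m _ => by ring

theorem sum_spaceInv_spaceInv_mul_cross (S f : Tensor2 d) (hf : ∀ i j, f i j = f j i) :
    ∑ i : Fin d, ∑ j : Fin d, ∑ l : Fin d, ∑ m : Fin d,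
      spaceInv k i l x * spaceInv k j m x * (f j.succ l.succ * S i.succ m.succ)
    = ∑ i : Fin d, ∑ j : Fin d, spaceRaise k S i j x * f i.succ j.succ := by
  simp only [spaceRaise, Finset.sum_mul]
  calc _ = ∑ j : Fin d, ∑ i : Fin d, ∑ l : Fin d, ∑ m : Fin d,
        spaceInv k i l x * spaceInv k j m x * (f j.succ l.succ * S i.succ m.succ) :=
        Finset.sum_comm
    _ = ∑ j : Fin d, ∑ l : Fin d, ∑ i : Fin d, ∑ m : Fin d,
        spaceInv k i l x * spaceInv k j m x * (f j.succ l.succ * S i.succ m.succ) :=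
        Finset.sum_congr rfl fun j _ => Finset.sum_comm
    _ = ∑ l : Fin d, ∑ j : Fin d, ∑ i : Fin d, ∑ m : Fin d,
        spaceInv k i l x * spaceInv k j m x * (f j.succ l.succ * S i.succ m.succ) :=
        Finset.sum_comm
    _ = _ := Finset.sum_congr rfl fun l _ => Finset.sum_congr rfl fun j _ =>
        Finset.sum_congr rfl fun i _ => Finset.sum_congr rfl fun m _ => by
          rw [spaceInv_comm i l, spaceInv_comm j m, spaceInv_comm m j, hf j.succ]; ring

/-- Crossed pairings give single traces and straight ones products of traces. The symbol terms
collect 1 + 1 - d - d = -2 (d - 1), and the quadratic term -(d - d²) = d (d - 1). -/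
theorem sum_spaceInv_flrwCurvVar_space (hI : AdmissibleOn I a F) (ht : x 0 ∈ I)
    (hx : InFLRWChart k x) {S : Tensor2 d} (hS : ∀ i j, S i j = S j i) (p : ℝ)
    (p₁ : Fin (d + 1) → ℝ) {p₂ : Tensor2 d} (hp : ∀ i j, p₂ i j = p₂ j i) :
    ∑ i : Fin d, ∑ j : Fin d, ∑ l : Fin d, ∑ m : Fin d, spaceInv k i l x * spaceInv k j m x *
      curvVar (flrwGamma k a F x) (fun i j => p * S i j) (fun c i j => p₁ c * S i j)
        (fun c e i j => p₂ c e * S i j) i.succ j.succ l.succ m.succ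
    = ∑ i : Fin d, ∑ j : Fin d, spaceRaise k S i j x * p₂ i.succ j.succ
      - spaceTrace k S x * spaceTrace k p₂ x
      - 2 * (d - 1) * (expansion a F (x 0) * (∑ i : Fin d, shiftVec k S i x * p₁ i.succ
          - (1 / 2) * p₁ 0 * spaceTrace k S x)
        + k * (∑ i : Fin d, posVec k S i x * p₁ i.succ
          - (1 / 2) * posDot p₁ x * spaceTrace k S x))
      + d * (d - 1) * p * normalQuad k (expansion a F (x 0)) S x := by
  set K := expansion a F (x 0)
  set B := normalChristoffel k K S p₁ x
  set Q := normalQuad k K S x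
  have hB := sum_spaceInv_normalChristoffel (k := k) (x := x) K S p₁
  have hd := sum_spaceInv_mul_spaceMetric_self hx
  have hbody : ∀ i j l m : Fin d, spaceInv k i l x * spaceInv k j m x *
      curvVar (flrwGamma k a F x) (fun i j => p * S i j) (fun c i j => p₁ c * S i j)
        (fun c e i j => p₂ c e * S i j) i.succ j.succ l.succ m.succ
      = (1 / 2) * (spaceInv k i l x * spaceInv k j m x * (p₂ j.succ l.succ * S i.succ m.succ))
      + (1 / 2) * (spaceInv k i l x * spaceInv k j m x * (p₂ i.succ m.succ * S j.succ l.succ))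
      - (1 / 2) * (spaceInv k i l x * spaceInv k j m x * (p₂ i.succ l.succ * S j.succ m.succ))
      - (1 / 2) * (spaceInv k i l x * spaceInv k j m x * (S i.succ l.succ * p₂ j.succ m.succ))
      + spaceInv k i l x * spaceInv k j m x * (B i m * spaceMetric k j l x)
      + spaceInv k i l x * spaceInv k j m x * (B j l * spaceMetric k i m x)
      - spaceInv k i l x * spaceInv k j m x * (spaceMetric k i l x * B j m)
      - spaceInv k i l x * spaceInv k j m x * (B i l * spaceMetric k j m x)
      - p * Q * (spaceInv k i l x * spaceInv k j m x
        * (spaceMetric k i m x * spaceMetric k j l x))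
      + p * Q * (spaceInv k i l x * spaceInv k j m x
        * (spaceMetric k i l x * spaceMetric k j m x)) := by
    intro i j l m
    rw [curvVar_flrwGamma_space hI ht hx hS]
    ring
  simp only [hbody, Finset.sum_add_distrib, Finset.sum_sub_distrib, ← Finset.mul_sum]
  have hcross := sum_spaceInv_spaceInv_mul_cross (k := k) (x := x) S p₂ hp
  rw [sum_spaceInv_spaceInv_swap (k := k) (x := x)
      fun i j l m => p₂ j.succ l.succ * S i.succ m.succ,
    sum_spaceInv_spaceInv_swap (k := k) (x := x) fun i j l m => B i m * spaceMetric k j l x,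
    hcross, sum_spaceInv_spaceInv_mul_spaceMetric hx, sum_spaceInv_spaceInv_mul_spaceMetric hx,
    sum_spaceInv_spaceInv_mul_straight (fun i l => p₂ i.succ l.succ) (fun j m => S j.succ m.succ),
    sum_spaceInv_spaceInv_mul_straight (fun i l => S i.succ l.succ) (fun j m => p₂ j.succ m.succ),
    sum_spaceInv_spaceInv_mul_straight (fun i l => spaceMetric k i l x) B,
    sum_spaceInv_spaceInv_mul_straight B (fun i l => spaceMetric k i l x),
    sum_spaceInv_spaceInv_mul_straight (fun i l => spaceMetric k i l x)
      (fun i l => spaceMetric k i l x), hB, hd]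
  simp only [spaceTrace]
  ring

end Traces

theorem clm_apply_quadruple (ℓ : ℝ × ℝ × ℝ × ℝ →L[ℝ] ℝ) (r s t u : ℝ) :
    ℓ (r, s, t, u) = r * ℓ (1, 0, 0, 0) + s * ℓ (0, 1, 0, 0) + t * ℓ (0, 0, 1, 0)
      + u * ℓ (0, 0, 0, 1) := by
  have : (r, s, t, u) = r • ((1 : ℝ), (0 : ℝ), (0 : ℝ), (0 : ℝ)) + s • (0, 1, 0, 0)
      + t • (0, 0, 1, 0) + u • (0, 0, 0, 1) := by simp
  rw [this]
  simp only [map_add, map_smul, smul_eq_mul]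

/-! ### The coefficients of the first variation -/

section Coefficients

variable {d : ℕ} {k : ℝ} {a F : ℝ → ℝ} {I : Set ℝ} {x : Chart d}

namespace GravityTheory

variable (L : GravityTheory d)

/-- The derivative of the reduced density with respect to `F` along an FLRW metric. -/
def lapseSlope (k : ℝ) (a F : ℝ → ℝ) (t : ℝ) : ℝ :=
  fderiv ℝ L.reducedDensity (flrwPoint k a F t) (1, 0, 0, 0)

/-- The derivative of the reduced density with respect to `a²` along an FLRW metric, divided by
the number of spatial dimensions. -/
def scaleSlope (k : ℝ) (a F : ℝ → ℝ) (t : ℝ) : ℝ :=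
  fderiv ℝ L.reducedDensity (flrwPoint k a F t) (0, 1, 0, 0) / d

/-- The derivative of the reduced density with respect to the coefficient of `R_{titj}` along an
FLRW metric, divided by the number of spatial dimensions. -/
def timeSlope (k : ℝ) (a F : ℝ → ℝ) (t : ℝ) : ℝ :=
  fderiv ℝ L.reducedDensity (flrwPoint k a F t) (0, 0, 1, 0) / d

/-- The derivative of the reduced density with respect to the coefficient of `R_{ijkl}` along an
FLRW metric, divided by `d (d - 1)`. -/
def spaceSlope (k : ℝ) (a F : ℝ → ℝ) (t : ℝ) : ℝ :=
  fderiv ℝ L.reducedDensity (flrwPoint k a F t) (0, 0, 0, 1) / (d * (d - 1))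

/-- The first variation on an FLRW background in the direction of a constant symmetric array times
a function. -/
theorem firstVariation_flrw_smul (hd : 2 ≤ d) (hI : AdmissibleOn I a F) (ht : x 0 ∈ I)
    (hx : InFLRWChart k x) (hdef : L.DefinedAt (flrw k a F) x) {S : Tensor2 d}
    (hS : ∀ i j, S i j = S j i) {φ : Chart d → ℝ} (hφ : ContDiff ℝ 2 φ) {p : ℝ}
    {p₁ : Fin (d + 1) → ℝ} {p₂ : Tensor2 d} (h0 : φ x = p) (h1 : ∀ c, pd c φ x = p₁ c)
    (h2 : ∀ c e, pd c (pd e φ) x = p₂ c e) :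
    L.firstVariation (flrw k a F) (fun y => φ y • Matrix.of S) x
    = rho k x * (- (p * S 0 0) * L.lapseSlope k a F (x 0)
      + p * spaceTrace k S x * L.scaleSlope k a F (x 0)
      + L.timeSlope k a F (x 0)
        * (∑ i : Fin d, shiftVec k S i x * p₂ 0 i.succ - (1 / 2) * spaceTrace k S x * p₂ 0 0
        - (1 / 2) * S 0 0 * spaceTrace k p₂ x
        + (hubble a (x 0) + lapseRate F (x 0) / 2) * spaceTrace k S x * p₁ 0
        - lapseRate F (x 0) * ∑ i : Fin d, shiftVec k S i x * p₁ i.succ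
        - d * ((1 / 2) * expansion a F (x 0) * S 0 0 * p₁ 0
          + k * (shiftPos S x * p₁ 0 - (1 / 2) * S 0 0 * posDot p₁ x))
        - hubble a (x 0) ^ 2 * spaceTrace k S x * p
        + lapseRate F (x 0) * d * p * (expansion a F (x 0) * S 0 0 + k * shiftPos S x))
      + L.spaceSlope k a F (x 0)
        * (∑ i : Fin d, ∑ j : Fin d, spaceRaise k S i j x * p₂ i.succ j.succ
        - spaceTrace k S x * spaceTrace k p₂ x
        - 2 * (d - 1) * (expansion a F (x 0) * (∑ i : Fin d, shiftVec k S i x * p₁ i.succ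
            - (1 / 2) * p₁ 0 * spaceTrace k S x)
          + k * (∑ i : Fin d, posVec k S i x * p₁ i.succ
            - (1 / 2) * posDot p₁ x * spaceTrace k S x))
        + d * (d - 1) * p * normalQuad k (expansion a F (x 0)) S x)) := by
  have hp : ∀ i j, p₂ i j = p₂ j i := by
    intro i j; rw [← h2, ← h2]; exact pd_pd_comm hφ.contDiffAt i j
  have hh : ∀ i j, ContDiffAt ℝ 2 (fun y => (φ y • Matrix.of S) i j) x := by
    intro i j
    simp only [Matrix.smul_apply, Matrix.of_apply, smul_eq_mul]
    exact hφ.contDiffAt.mul contDiffAt_const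
  rw [L.firstVariation_flrw hd hI ht hx hdef hh (fun y i j => by
    simp only [Matrix.smul_apply, Matrix.of_apply, hS i j]), flrwCurvVar_smul hφ S]
  simp only [h0, h1, h2]
  rw [sum_spaceInv_flrwCurvVar_time hI ht hx hS p p₁ hp,
    sum_spaceInv_flrwCurvVar_space hI ht hx hS p p₁ hp, clm_apply_quadruple]
  have e : ∑ i : Fin d, ∑ j : Fin d, spaceInv k i j x * (p * S i.succ j.succ)
      = p * spaceTrace k S x := by
    simp only [spaceTrace, Finset.mul_sum]
    exact Finset.sum_congr rfl fun i _ => Finset.sum_congr rfl fun j _ => by ring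
  have e' : ∀ i j, (p • Matrix.of S) i j = p * S i j := fun i j => rfl
  simp only [lapseSlope, scaleSlope, timeSlope, spaceSlope, e', e]
  ring

end GravityTheory

theorem contDiff_sub_coord {m : ℕ∞ω} (c : Fin (d + 1)) (x : Chart d) :
    ContDiff ℝ m (fun y : Chart d => y c - x c) := (contDiff_coord c).sub contDiff_const

theorem pd_sub_coord (y x : Chart d) (c e : Fin (d + 1)) :
    pd e (fun y : Chart d => y c - x c) y = if c = e then 1 else 0 := by
  rw [pd_sub (differentiableAt_coord c) (differentiableAt_const _), pd_const, pd_coord, sub_zero]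

theorem pd_sub_coord_mul (y x : Chart d) (c e b : Fin (d + 1)) :
    pd b (fun y : Chart d => (1 / 2) * ((y c - x c) * (y e - x e))) y
      = (1 / 2) * ((y c - x c) * (if e = b then 1 else 0)
        + (if c = b then 1 else 0) * (y e - x e)) := by
  have h : ∀ c, DifferentiableAt ℝ (fun y : Chart d => y c - x c) y := fun c =>
    (differentiableAt_coord c).sub_const _
  rw [pd_const_mul ((h c).fun_mul (h e)), pd_mul (h c) (h e), pd_sub_coord, pd_sub_coord]

theorem pd_pd_sub_coord_mul (x : Chart d) (c e b b' : Fin (d + 1)) :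
    pd b (pd b' (fun y : Chart d => (1 / 2) * ((y c - x c) * (y e - x e)))) x
      = (1 / 2) * ((if c = b then 1 else 0) * (if e = b' then 1 else 0)
        + (if c = b' then 1 else 0) * (if e = b then 1 else 0)) := by
  have h : ∀ c, DifferentiableAt ℝ (fun y : Chart d => y c - x c) x := fun c =>
    (differentiableAt_coord c).sub_const _
  have e1 : pd b' (fun y : Chart d => (1 / 2) * ((y c - x c) * (y e - x e)))
      = fun y => (1 / 2) * ((y c - x c) * (if e = b' then 1 else 0)
        + (if c = b' then 1 else 0) * (y e - x e)) :=
    funext fun y => pd_sub_coord_mul y x c e b'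
  rw [e1, pd_const_mul (((h c).mul_const _).fun_add ((h e).const_mul _)),
    pd_add ((h c).mul_const _) ((h e).const_mul _), pd_const_mul (h e), pd_sub_coord]
  rw [pd_mul (h c) (differentiableAt_const _), pd_const, pd_sub_coord]
  ring

namespace GravityTheory

variable (L : GravityTheory d)

/-- Constants, centred linear functions and half products of centred coordinates have 2-jets at the
centre concentrated in order 0, 1 and 2. They isolate the three coefficients of the variation. The
centre is the point of evaluation and moves with it when the coefficients are differentiated. -/
theorem firstVariation_flrw_const (hd : 2 ≤ d) (hI : AdmissibleOn I a F) (ht : x 0 ∈ I)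
    (hx : InFLRWChart k x) (hdef : L.DefinedAt (flrw k a F) x) {S : Tensor2 d}
    (hS : ∀ i j, S i j = S j i) :
    L.firstVariation (flrw k a F) (fun _ => Matrix.of S) x
    = rho k x * (- S 0 0 * L.lapseSlope k a F (x 0) + spaceTrace k S x * L.scaleSlope k a F (x 0)
      + L.timeSlope k a F (x 0) * (- hubble a (x 0) ^ 2 * spaceTrace k S x
        + lapseRate F (x 0) * d * (expansion a F (x 0) * S 0 0 + k * shiftPos S x))
      + L.spaceSlope k a F (x 0) * (d * (d - 1) * normalQuad k (expansion a F (x 0)) S x)) := by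
  have h := L.firstVariation_flrw_smul hd hI ht hx hdef hS (φ := fun _ => 1) contDiff_const
    (p := 1) (p₁ := fun _ => 0) (p₂ := fun _ _ => 0) rfl (fun c => pd_const 1 c) (fun c e => by
      have : pd e (fun _ : Chart d => (1 : ℝ)) = fun _ => 0 := funext fun y => pd_const 1 e
      rw [this, pd_const])
  simp only [one_smul] at h
  rw [h]
  simp [posDot, spaceTrace]

theorem firstVariation_flrw_linear (hd : 2 ≤ d) (hI : AdmissibleOn I a F) (ht : x 0 ∈ I)
    (hx : InFLRWChart k x) (hdef : L.DefinedAt (flrw k a F) x) {S : Tensor2 d}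
    (hS : ∀ i j, S i j = S j i) (c : Fin (d + 1)) {p₁ : Fin (d + 1) → ℝ}
    (hp : ∀ e, (if c = e then 1 else 0) = p₁ e) :
    L.firstVariation (flrw k a F) (fun y => (y c - x c) • Matrix.of S) x
    = rho k x * (L.timeSlope k a F (x 0) *
        ((hubble a (x 0) + lapseRate F (x 0) / 2) * spaceTrace k S x * p₁ 0
        - lapseRate F (x 0) * ∑ i : Fin d, shiftVec k S i x * p₁ i.succ
        - d * ((1 / 2) * expansion a F (x 0) * S 0 0 * p₁ 0
          + k * (shiftPos S x * p₁ 0 - (1 / 2) * S 0 0 * posDot p₁ x)))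
      + L.spaceSlope k a F (x 0) *
        (- (2 * (d - 1)) * (expansion a F (x 0) * (∑ i : Fin d, shiftVec k S i x * p₁ i.succ
            - (1 / 2) * p₁ 0 * spaceTrace k S x)
          + k * (∑ i : Fin d, posVec k S i x * p₁ i.succ
            - (1 / 2) * posDot p₁ x * spaceTrace k S x)))) := by
  have h := L.firstVariation_flrw_smul hd hI ht hx hdef hS (contDiff_sub_coord c x)
    (p := 0) (p₁ := p₁) (p₂ := fun _ _ => 0) (sub_self _)
    (fun e => (pd_sub_coord x x c e).trans (hp e)) (fun b e => by
      have : pd e (fun y : Chart d => y c - x c) = fun _ => if c = e then (1 : ℝ) else 0 :=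
        funext fun y => pd_sub_coord y x c e
      rw [this, pd_const])
  rw [h]
  simp only [spaceTrace, mul_zero, Finset.sum_const_zero, zero_mul]
  ring

theorem firstVariation_flrw_quadratic (hd : 2 ≤ d) (hI : AdmissibleOn I a F) (ht : x 0 ∈ I)
    (hx : InFLRWChart k x) (hdef : L.DefinedAt (flrw k a F) x) {S : Tensor2 d}
    (hS : ∀ i j, S i j = S j i) (c e : Fin (d + 1)) {p₂ : Tensor2 d}
    (hp : ∀ b b', (1 / 2) * ((if c = b then 1 else 0) * (if e = b' then 1 else 0)
        + (if c = b' then 1 else 0) * (if e = b then 1 else 0)) = p₂ b b') :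
    L.firstVariation (flrw k a F)
      (fun y => ((1 / 2) * ((y c - x c) * (y e - x e))) • Matrix.of S) x
    = rho k x * (L.timeSlope k a F (x 0) *
        (∑ i : Fin d, shiftVec k S i x * p₂ 0 i.succ - (1 / 2) * spaceTrace k S x * p₂ 0 0
        - (1 / 2) * S 0 0 * spaceTrace k p₂ x)
      + L.spaceSlope k a F (x 0) *
        (∑ i : Fin d, ∑ j : Fin d, spaceRaise k S i j x * p₂ i.succ j.succ
        - spaceTrace k S x * spaceTrace k p₂ x)) := by
  have h := L.firstVariation_flrw_smul hd hI ht hx hdef hS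
    (contDiff_const.mul ((contDiff_sub_coord c x).mul (contDiff_sub_coord e x)))
    (p := 0) (p₁ := fun _ => 0) (p₂ := p₂) (by simp)
    (fun b => (pd_sub_coord_mul x x c e b).trans (by simp))
    (fun b b' => (pd_pd_sub_coord_mul x c e b b').trans (hp b b'))
  rw [h]
  simp only [posDot, mul_zero, Finset.sum_const_zero, zero_mul]
  ring

end GravityTheory

end Coefficients

/-! ### Spatial divergences -/

section Divergence

variable {d : ℕ} {k : ℝ} {x : Chart d} {S : Tensor2 d}

/-- With this and the next lemmas the contractions become polynomials in the coordinates, which are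
easy to differentiate. -/
theorem posVec_eq (i : Fin d) (y : Chart d) :
    posVec k S i y = posRow S i y - k * (y i.succ * posQuad S y) := by
  have : ∀ j : Fin d, spaceInv k i j y * posRow S j y
      = kron i j * posRow S j y - k * y i.succ * (y j.succ * posRow S j y) := by
    intro j; simp only [spaceInv]; ring
  simp only [posVec, this, Finset.sum_sub_distrib, sum_kron_mul, ← Finset.mul_sum]
  simp only [posQuad]; ring

theorem sum_spaceInv_mul_succ (i j : Fin d) (y : Chart d) :
    ∑ m : Fin d, spaceInv k j m y * S i.succ m.succ
      = S i.succ j.succ - k * (y j.succ * posRow S i y) := by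
  have : ∀ m : Fin d, spaceInv k j m y * S i.succ m.succ
      = kron j m * S i.succ m.succ - k * y j.succ * (S i.succ m.succ * y m.succ) := by
    intro m; simp only [spaceInv]; ring
  simp only [this, Finset.sum_sub_distrib, sum_kron_mul (f := fun m => S i.succ m.succ),
    ← Finset.mul_sum]
  simp only [posRow]; ring

theorem spaceTrace_eq (y : Chart d) :
    spaceTrace k S y = ∑ i : Fin d, S i.succ i.succ - k * posQuad S y := by
  simp only [spaceTrace, sum_spaceInv_mul_succ, Finset.sum_sub_distrib, posQuad, Finset.mul_sum]

theorem spaceRaise_eq (hS : ∀ i j, S i j = S j i) (i j : Fin d) (y : Chart d) :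
    spaceRaise k S i j y = S i.succ j.succ - k * (y i.succ * posRow S j y)
      - k * (y j.succ * posRow S i y) + k ^ 2 * (y i.succ * y j.succ * posQuad S y) := by
  have h1 : ∀ l : Fin d, ∑ m : Fin d, spaceInv k i l y * spaceInv k j m y * S l.succ m.succ
      = spaceInv k i l y * (S j.succ l.succ) - k * y j.succ * (spaceInv k i l y * posRow S l y) := by
    intro l
    simp only [mul_assoc, ← Finset.mul_sum, sum_spaceInv_mul_succ]
    rw [hS l.succ]; ring
  simp only [spaceRaise, h1, Finset.sum_sub_distrib, ← Finset.mul_sum, sum_spaceInv_mul_succ]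
  have := posVec_eq (k := k) (S := S) i y
  rw [posVec] at this
  rw [this, hS j.succ]; ring

theorem spaceRaise_comm (hS : ∀ i j, S i j = S j i) (i j : Fin d) (y : Chart d) :
    spaceRaise k S i j y = spaceRaise k S j i y := by
  rw [spaceRaise_eq hS, spaceRaise_eq hS, hS i.succ]; ring

theorem contDiff_shiftPos {m : ℕ∞ω} : ContDiff ℝ m (shiftPos S) :=
  ContDiff.sum fun i _ => (contDiff_coord i.succ).mul contDiff_const

theorem contDiff_posRow {m : ℕ∞ω} (i : Fin d) : ContDiff ℝ m (posRow S i) :=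
  ContDiff.sum fun j _ => contDiff_const.mul (contDiff_coord j.succ)

theorem contDiff_posQuad {m : ℕ∞ω} : ContDiff ℝ m (posQuad S) :=
  ContDiff.sum fun i _ => (contDiff_coord i.succ).mul (contDiff_posRow i)

theorem contDiff_spaceTrace {m : ℕ∞ω} : ContDiff ℝ m (spaceTrace k S) :=
  ContDiff.sum fun i _ => ContDiff.sum fun j _ => (contDiff_spaceInv i j).mul contDiff_const

theorem contDiff_shiftVec {m : ℕ∞ω} (i : Fin d) : ContDiff ℝ m (shiftVec k S i) :=
  ContDiff.sum fun j _ => (contDiff_spaceInv i j).mul contDiff_const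

theorem contDiff_posVec {m : ℕ∞ω} (i : Fin d) : ContDiff ℝ m (posVec k S i) :=
  ContDiff.sum fun j _ => (contDiff_spaceInv i j).mul (contDiff_posRow j)

theorem contDiff_spaceRaise {m : ℕ∞ω} (i j : Fin d) : ContDiff ℝ m (spaceRaise k S i j) :=
  ContDiff.sum fun l _ => ContDiff.sum fun n _ =>
    ((contDiff_spaceInv i l).mul (contDiff_spaceInv j n)).mul contDiff_const

theorem differentiableAt_of_contDiff {f : Chart d → ℝ} (hf : ContDiff ℝ 1 f) :
    DifferentiableAt ℝ f x := hf.contDiffAt.differentiableAt (by norm_num)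

theorem pd_succ_posRow (i l : Fin d) : pd l.succ (posRow S i) x = S i.succ l.succ := by
  have h : (posRow S i) = fun y : Chart d => ∑ j : Fin d, S i.succ j.succ * y j.succ := rfl
  rw [h, pd_sum fun j _ => (differentiableAt_coord _).const_mul _]
  simp only [pd_const_mul (differentiableAt_coord _), pd_succ_coord]
  exact sum_mul_kron' l fun j => S i.succ j.succ

theorem pd_succ_posQuad (hS : ∀ i j, S i j = S j i) (l : Fin d) :
    pd l.succ (posQuad S) x = 2 * posRow S l x := by
  have hd := fun i => differentiableAt_of_contDiff (x := x) (contDiff_posRow (S := S) i)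
  have h : (posQuad S) = fun y : Chart d => ∑ i : Fin d, y i.succ * posRow S i y := rfl
  rw [h, pd_sum fun i _ => (differentiableAt_coord _).fun_mul (hd i)]
  simp only [pd_mul (differentiableAt_coord _) (hd _), pd_succ_coord, pd_succ_posRow,
    Finset.sum_add_distrib, sum_kron_mul']
  have : ∑ i : Fin d, x i.succ * S i.succ l.succ = posRow S l x :=
    Finset.sum_congr rfl fun i _ => by rw [hS i.succ]; ring
  rw [this]; ring

theorem pd_succ_spaceTrace (hS : ∀ i j, S i j = S j i) (l : Fin d) :
    pd l.succ (spaceTrace k S) x = - (2 * k) * posRow S l x := by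
  have hd := differentiableAt_of_contDiff (x := x) (contDiff_posQuad (S := S))
  have h : spaceTrace k S = fun y : Chart d => ∑ i : Fin d, S i.succ i.succ - k * posQuad S y :=
    funext fun y => spaceTrace_eq y
  rw [h, pd_sub (differentiableAt_const _) (hd.const_mul _), pd_const, pd_const_mul hd,
    pd_succ_posQuad hS]
  ring

/-- Since ρ = √det γ, this is the density form of a spatial divergence; the logarithmic gradient of
ρ is k times the lowered position vector. -/
theorem sum_pd_rho_mul (hx : InFLRWChart k x) {f : Fin d → Chart d → ℝ}
    (hf : ∀ i, DifferentiableAt ℝ (f i) x) :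
    ∑ i : Fin d, pd i.succ (fun y => rho k y * f i y) x
      = rho k x * (k * ∑ i : Fin d, lowPos k i x * f i x + ∑ i : Fin d, pd i.succ (f i) x) := by
  simp only [pd_mul (differentiableAt_rho hx) (hf _), pd_succ_rho hx, Finset.sum_add_distrib,
    Finset.mul_sum, mul_add]
  rw [add_comm]
  congr 1
  exact Finset.sum_congr rfl fun i _ => by ring

theorem sum_lowPos_mul_spaceInv (hx : InFLRWChart k x) (j : Fin d) :
    ∑ i : Fin d, lowPos k i x * spaceInv k i j x = x j.succ := by
  rw [← sum_spaceInv_mul_lowPos hx j]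
  exact Finset.sum_congr rfl fun i _ => by rw [spaceInv_comm]; ring

theorem sum_pd_spaceInv (j : Fin d) : ∑ i : Fin d, pd i.succ (spaceInv k i j) x
    = - k * (d + 1) * x j.succ := by
  simp only [pd_succ_spaceInv, mul_add, Finset.sum_add_distrib]
  have h1 : ∑ i : Fin d, -k * (kron i i * x j.succ) = - k * d * x j.succ := by
    rw [← sum_kron_self, Finset.mul_sum, Finset.sum_mul]
    exact Finset.sum_congr rfl fun i _ => by ring
  have h2 : ∑ i : Fin d, -k * (x i.succ * kron j i) = - k * x j.succ := by
    rw [← Finset.mul_sum, sum_mul_kron]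
  rw [h1, h2]; ring

/-- This is ρ times the Laplacian of the coordinate x^j: the coordinate functions are eigenfunctions
on the constant-curvature space, with eigenvalue -d k. -/
theorem sum_pd_rho_spaceInv (hx : InFLRWChart k x) (j : Fin d) :
    ∑ i : Fin d, pd i.succ (fun y => rho k y * spaceInv k i j y) x
      = - (d * k) * (rho k x * x j.succ) := by
  rw [sum_pd_rho_mul hx fun i => differentiableAt_spaceInv i j, sum_lowPos_mul_spaceInv hx,
    sum_pd_spaceInv]
  ring

theorem sum_pd_rho_shiftVec (hx : InFLRWChart k x) :
    ∑ i : Fin d, pd i.succ (fun y => rho k y * shiftVec k S i y) x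
      = - (d * k) * (rho k x * shiftPos S x) := by
  have h : ∀ i : Fin d, (fun y => rho k y * shiftVec k S i y)
      = fun y => ∑ j : Fin d, rho k y * spaceInv k i j y * S 0 j.succ := by
    intro i; funext y; simp only [shiftVec, Finset.mul_sum, mul_assoc]
  have hd : ∀ i j : Fin d, DifferentiableAt ℝ (fun y => rho k y * spaceInv k i j y) x :=
    fun i j => (differentiableAt_rho hx).fun_mul (differentiableAt_spaceInv i j)
  simp only [h, pd_sum fun j _ => (hd _ j).mul_const _, pd_mul (hd _ _) (differentiableAt_const _),
    pd_const, mul_zero, zero_add]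
  rw [Finset.sum_comm]
  simp only [← Finset.sum_mul, sum_pd_rho_spaceInv hx, shiftPos, Finset.mul_sum]
  exact Finset.sum_congr rfl fun j _ => by ring

/-- The derivative falls either on ρ γ⁻¹, giving the Laplacian of the coordinates contracted with S
x, or on S x itself, giving the trace of S. -/
theorem sum_pd_rho_posVec (hx : InFLRWChart k x) (hS : ∀ i j, S i j = S j i) :
    ∑ i : Fin d, pd i.succ (fun y => rho k y * posVec k S i y) x
      = rho k x * (spaceTrace k S x - d * k * posQuad S x) := by
  have h : ∀ i : Fin d, (fun y => rho k y * posVec k S i y)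
      = fun y => ∑ j : Fin d, rho k y * spaceInv k i j y * posRow S j y := by
    intro i; funext y; simp only [posVec, Finset.mul_sum, mul_assoc]
  have hd : ∀ i j : Fin d, DifferentiableAt ℝ (fun y => rho k y * spaceInv k i j y) x :=
    fun i j => (differentiableAt_rho hx).fun_mul (differentiableAt_spaceInv i j)
  have hr := fun i => differentiableAt_of_contDiff (x := x) (contDiff_posRow (S := S) i)
  simp only [h, pd_sum fun j _ => (hd _ j).fun_mul (hr j), pd_mul (hd _ _) (hr _),
    pd_succ_posRow, Finset.sum_add_distrib]
  rw [Finset.sum_comm (f := fun i j => pd (Fin.succ i) _ x * _)]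
  simp only [← Finset.sum_mul, sum_pd_rho_spaceInv hx, mul_assoc, ← Finset.mul_sum]
  have e : ∑ i : Fin d, ∑ j : Fin d, spaceInv k i j x * S j.succ i.succ = spaceTrace k S x :=
    Finset.sum_congr rfl fun i _ => Finset.sum_congr rfl fun j _ => by rw [hS]
  rw [e]
  simp only [posQuad]; ring

/-- The divergence of the spatial part of the quadratic coefficient. -/
theorem sum_pd_rho_spaceRaise (hx : InFLRWChart k x) (hS : ∀ i j, S i j = S j i) (j : Fin d) :
    ∑ i : Fin d, pd i.succ (fun y => rho k y
        * (spaceRaise k S i j y - spaceInv k i j y * spaceTrace k S y)) x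
      = k * (d - 1) * (rho k x * (x j.succ * spaceTrace k S x - posVec k S j x)) := by
  have hU := fun i => differentiableAt_of_contDiff (x := x)
    (contDiff_spaceRaise (k := k) (S := S) i j)
  have hσ := differentiableAt_of_contDiff (x := x) (contDiff_spaceTrace (k := k) (S := S))
  have hγ := fun i => differentiableAt_spaceInv (k := k) (x := x) i j
  have hr := fun i => differentiableAt_of_contDiff (x := x) (contDiff_posRow (S := S) i)
  have hq := differentiableAt_of_contDiff (x := x) (contDiff_posQuad (S := S))
  have hc := fun i : Fin d => differentiableAt_coord (x := x) i.succ
  rw [sum_pd_rho_mul hx fun i => (hU i).fun_sub ((hγ i).fun_mul hσ)]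
  -- The gradient of ρ contracts through γ^{il} to the position vector, which leaves the difference
  -- that also appears in the answer.
  have e1 : ∑ i : Fin d, lowPos k i x * (spaceRaise k S i j x - spaceInv k i j x
      * spaceTrace k S x) = posVec k S j x - x j.succ * spaceTrace k S x := by
    simp only [mul_sub, Finset.sum_sub_distrib, ← mul_assoc, ← Finset.sum_mul,
      sum_lowPos_mul_spaceInv hx]
    congr 1
    have : ∀ i : Fin d, lowPos k i x * spaceRaise k S i j x
        = ∑ l : Fin d, lowPos k i x * spaceInv k i l x
          * ∑ m : Fin d, spaceInv k j m x * S l.succ m.succ := by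
      intro i
      simp only [spaceRaise, Finset.mul_sum]
      exact Finset.sum_congr rfl fun l _ => Finset.sum_congr rfl fun m _ => by ring
    simp only [this]
    rw [Finset.sum_comm]
    simp only [← Finset.sum_mul, sum_lowPos_mul_spaceInv hx, sum_spaceInv_mul_succ, posVec_eq,
      mul_sub, Finset.sum_sub_distrib]
    congr 1
    · exact Finset.sum_congr rfl fun l _ => by rw [hS]; ring
    · simp only [posQuad, Finset.mul_sum]
      exact Finset.sum_congr rfl fun l _ => by ring
  have e2 : ∑ i : Fin d, pd i.succ (spaceRaise k S i j) x
      = - k * ((d + 2) * posRow S j x + (∑ i : Fin d, S i.succ i.succ) * x j.succ)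
        + k ^ 2 * (d + 3) * (x j.succ * posQuad S x) := by
    have h : ∀ i : Fin d, pd i.succ (spaceRaise k S i j) x
        = - k * (x i.succ * S j.succ i.succ + posRow S j x)
          - k * (x j.succ * S i.succ i.succ + kron j i * posRow S i x)
          + k ^ 2 * (x i.succ * x j.succ * (2 * posRow S i x)
            + (x i.succ * kron j i + x j.succ) * posQuad S x) := by
      intro i
      have h : spaceRaise k S i j = fun y => S i.succ j.succ - k * (y i.succ * posRow S j y)
          - k * (y j.succ * posRow S i y) + k ^ 2 * (y i.succ * y j.succ * posQuad S y) :=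
        funext fun y => spaceRaise_eq hS i j y
      have d1 := ((hc i).fun_mul (hr j)).const_mul k
      have d2 := ((hc j).fun_mul (hr i)).const_mul k
      have d3 := (((hc i).fun_mul (hc j)).fun_mul hq).const_mul (k ^ 2)
      rw [h, pd_add (((differentiableAt_const _).fun_sub d1).fun_sub d2) d3,
        pd_sub ((differentiableAt_const _).fun_sub d1) d2, pd_sub (differentiableAt_const _) d1,
        pd_const, pd_const_mul ((hc i).fun_mul (hr j)), pd_const_mul ((hc j).fun_mul (hr i)),
        pd_const_mul (((hc i).fun_mul (hc j)).fun_mul hq), pd_mul (hc i) (hr j),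
        pd_mul (hc j) (hr i), pd_mul ((hc i).fun_mul (hc j)) hq, pd_mul (hc i) (hc j),
        pd_succ_posRow, pd_succ_posRow, pd_succ_posQuad hS, pd_succ_coord, pd_succ_coord]
      have : kron i i = (1 : ℝ) := by simp [kron]
      rw [this]
      ring
    have h' : ∀ i : Fin d, pd i.succ (spaceRaise k S i j) x
        = - k * (S j.succ i.succ * x i.succ) - k * posRow S j x - k * x j.succ * S i.succ i.succ
          - k * (kron j i * posRow S i x) + k ^ 2 * x j.succ * 2 * (x i.succ * posRow S i x)
          + k ^ 2 * posQuad S x * (kron j i * x i.succ) + k ^ 2 * (x j.succ * posQuad S x) := by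
      intro i; rw [h]; ring
    simp only [h', Finset.sum_add_distrib, Finset.sum_sub_distrib, ← Finset.mul_sum, sum_kron_mul,
      Finset.sum_const, Finset.card_univ, Fintype.card_fin, nsmul_eq_mul]
    have a1 : ∑ i : Fin d, S j.succ i.succ * x i.succ = posRow S j x := rfl
    have a2 : ∑ i : Fin d, x i.succ * posRow S i x = posQuad S x := rfl
    rw [a1, a2]
    ring
  have e3 : ∑ i : Fin d, pd i.succ (fun y => spaceInv k i j y * spaceTrace k S y) x
      = - k * (d + 1) * x j.succ * spaceTrace k S x - 2 * k * posVec k S j x := by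
    simp only [pd_mul (hγ _) hσ, pd_succ_spaceTrace hS, Finset.sum_add_distrib, ← Finset.sum_mul,
      sum_pd_spaceInv]
    have : ∑ i : Fin d, spaceInv k i j x * (-(2 * k) * posRow S i x)
        = - (2 * k) * posVec k S j x := by
      simp only [posVec, Finset.mul_sum]
      exact Finset.sum_congr rfl fun i _ => by rw [spaceInv_comm]; ring
    rw [this]; ring
  have e4 : ∑ i : Fin d, pd i.succ (fun y => spaceRaise k S i j y
      - spaceInv k i j y * spaceTrace k S y) x
      = ∑ i : Fin d, pd i.succ (spaceRaise k S i j) x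
        - ∑ i : Fin d, pd i.succ (fun y => spaceInv k i j y * spaceTrace k S y) x := by
    rw [← Finset.sum_sub_distrib]
    exact Finset.sum_congr rfl fun i _ => pd_sub (hU i) ((hγ i).fun_mul hσ) _
  rw [e1, e4, e2, e3, posVec_eq, spaceTrace_eq]
  ring

end Divergence

/-! ### The field equations on FLRW metrics -/

section FieldEquations

variable {d : ℕ} {k : ℝ} {a F : ℝ → ℝ} {I : Set ℝ} {x : Chart d} {t : ℝ}

namespace GravityTheory

variable (L : GravityTheory d)

/-- The points at which the reduced density is defined. -/
def reducedDomain : Set (ℝ × ℝ × ℝ × ℝ) :=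
  {p | 0 < p.1 ∧ 0 < p.2.1 ∧ canonicalPoint d p ∈ L.domain}

theorem eventually_mem_reducedDomain {p : ℝ × ℝ × ℝ × ℝ} (hp : p ∈ L.reducedDomain) :
    ∀ᶠ q in 𝓝 p, q ∈ L.reducedDomain := by
  obtain ⟨hf, hb, hp⟩ := hp
  have hc : ContinuousAt (canonicalPoint d) p := by
    have h1 : ContinuousAt (fun q : ℝ × ℝ × ℝ × ℝ => q.2.1⁻¹) p :=
      ContinuousAt.inv₀ (by fun_prop) hb.ne'
    have h2 : ContinuousAt (fun q : ℝ × ℝ × ℝ × ℝ => (q.2.2.1, q.2.2.2)) p := by fun_prop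
    exact (canonical d).continuous.continuousAt.comp
      ((continuousAt_fst.inv₀ hf.ne').neg.prodMk (h1.prodMk h2))
  filter_upwards [continuousAt_fst.eventually (lt_mem_nhds hf),
    (continuousAt_fst.comp continuousAt_snd).eventually (lt_mem_nhds hb),
    hc.eventually (L.isOpen_domain.mem_nhds hp)] with q h1 h2 h3
  exact ⟨h1, h2, h3⟩

theorem isOpen_reducedDomain : IsOpen L.reducedDomain :=
  isOpen_iff_mem_nhds.2 fun _ hp => L.eventually_mem_reducedDomain hp

theorem contDiffAt_reducedDensity_of_mem {p : ℝ × ℝ × ℝ × ℝ} (hp : p ∈ L.reducedDomain) :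
    ContDiffAt ℝ ∞ L.reducedDensity p := L.contDiffAt_reducedDensity hp.1 hp.2.1 hp.2.2

theorem definedAt_flrw_iff_mem (hI : AdmissibleOn I a F) (ht : x 0 ∈ I) (hx : InFLRWChart k x) :
    L.DefinedAt (flrw k a F) x ↔ flrwPoint k a F (x 0) ∈ L.reducedDomain := by
  rw [L.definedAt_flrw_iff hI ht hx]
  exact ⟨fun h => ⟨hI.lapse_pos _ ht, hI.sqScale_pos ht, h⟩, fun h => h.2.2⟩

end GravityTheory

theorem contDiffAt_flrwPoint (hI : AdmissibleOn I a F) (ht : t ∈ I) :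
    ContDiffAt ℝ ∞ (flrwPoint k a F) t := by
  have hF := hI.contDiffAt_lapse ht
  have hb := hI.contDiffAt_sqScale ht
  have hF1 := AdmissibleOn.contDiffAt_deriv hF
  have hb1 := AdmissibleOn.contDiffAt_deriv hb
  have hb2 := AdmissibleOn.contDiffAt_deriv hb1
  have hFp := (hI.lapse_pos _ ht).ne'
  have hbp := (hI.sqScale_pos ht).ne'
  refine hF.prodMk (hb.prodMk (ContDiffAt.prodMk ?_ ?_))
  · exact (((hb2.neg.div_const 2)).add ((hb1.pow 2).div (contDiffAt_const.mul hb)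
      (by positivity))).add ((hb1.mul hF1).div (contDiffAt_const.mul hF) (by positivity))
  · exact (contDiffAt_const.mul hb).add ((hb1.pow 2).div (contDiffAt_const.mul hF) (by positivity))

namespace GravityTheory

variable (L : GravityTheory d)

theorem contDiffAt_fderiv_flrwPoint (hI : AdmissibleOn I a F) (ht : t ∈ I)
    (hp : flrwPoint k a F t ∈ L.reducedDomain) (v : ℝ × ℝ × ℝ × ℝ) :
    ContDiffAt ℝ ∞ (fun s => fderiv ℝ L.reducedDensity (flrwPoint k a F s) v) t :=
  (ContDiffAt.comp (g := fderiv ℝ L.reducedDensity) t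
    ((L.contDiffAt_reducedDensity_of_mem hp).fderiv_right (m := ∞) (by simp))
    (contDiffAt_flrwPoint hI ht)).clm_apply contDiffAt_const

theorem contDiffAt_timeSlope (hI : AdmissibleOn I a F) (ht : t ∈ I)
    (hp : flrwPoint k a F t ∈ L.reducedDomain) : ContDiffAt ℝ ∞ (L.timeSlope k a F) t :=
  (L.contDiffAt_fderiv_flrwPoint hI ht hp _).div_const _

theorem contDiffAt_spaceSlope (hI : AdmissibleOn I a F) (ht : t ∈ I)
    (hp : flrwPoint k a F t ∈ L.reducedDomain) : ContDiffAt ℝ ∞ (L.spaceSlope k a F) t :=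
  (L.contDiffAt_fderiv_flrwPoint hI ht hp _).div_const _

/-- The domain is open and the FLRW point varies continuously, so the closed forms of the
coefficients hold near x and can be differentiated there. -/
theorem eventually_definedAt (hI : AdmissibleOn I a F) (ht : x 0 ∈ I)
    (hx : InFLRWChart k x) (hdef : L.DefinedAt (flrw k a F) x) :
    ∀ᶠ y in 𝓝 x, y 0 ∈ I ∧ InFLRWChart k y ∧ L.DefinedAt (flrw k a F) y := by
  have h := (L.definedAt_flrw_iff_mem hI ht hx).1 hdef
  have hc : ContinuousAt (fun y : Chart d => flrwPoint k a F (y 0)) x :=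
    ContinuousAt.comp (g := flrwPoint k a F) (contDiffAt_flrwPoint hI ht).continuousAt
      (continuous_apply 0).continuousAt
  filter_upwards [eventually_inFLRWChart hI ht hx,
    hc.eventually (L.eventually_mem_reducedDomain h)] with y h1 h2
  exact ⟨h1.1, h1.2, (L.definedAt_flrw_iff_mem hI h1.1 h1.2).2 h2⟩

variable {S : Tensor2 d}

theorem firstVariation_flrw_linear_time (hd : 2 ≤ d) (hI : AdmissibleOn I a F) (ht : x 0 ∈ I)
    (hx : InFLRWChart k x) (hdef : L.DefinedAt (flrw k a F) x) (hS : ∀ i j, S i j = S j i) :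
    L.firstVariation (flrw k a F) (fun y => (y 0 - x 0) • Matrix.of S) x
    = (L.timeSlope k a F (x 0) * (hubble a (x 0) + lapseRate F (x 0) / 2)
        + (d - 1) * (L.spaceSlope k a F (x 0) * expansion a F (x 0)))
        * (rho k x * spaceTrace k S x)
      - (1 / 2) * d * S 0 0 * (expansion a F (x 0) * L.timeSlope k a F (x 0)) * rho k x
      - d * k * L.timeSlope k a F (x 0) * (rho k x * shiftPos S x) := by
  rw [L.firstVariation_flrw_linear hd hI ht hx hdef hS 0 fun e => rfl]
  simp [posDot, (Fin.succ_ne_zero _).symm]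
  ring

theorem firstVariation_flrw_linear_space (hd : 2 ≤ d) (hI : AdmissibleOn I a F) (ht : x 0 ∈ I)
    (hx : InFLRWChart k x) (hdef : L.DefinedAt (flrw k a F) x) (hS : ∀ i j, S i j = S j i)
    (i : Fin d) :
    L.firstVariation (flrw k a F) (fun y => (y i.succ - x i.succ) • Matrix.of S) x
    = - (L.timeSlope k a F (x 0) * lapseRate F (x 0)
        + 2 * (d - 1) * (L.spaceSlope k a F (x 0) * expansion a F (x 0)))
        * (rho k x * shiftVec k S i x)
      + (1 / 2) * d * k * S 0 0 * L.timeSlope k a F (x 0) * (rho k x * x i.succ)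
      - 2 * (d - 1) * k * L.spaceSlope k a F (x 0)
        * (rho k x * posVec k S i x - (1 / 2) * (rho k x * (x i.succ * spaceTrace k S x))) := by
  rw [L.firstVariation_flrw_linear hd hI ht hx hdef hS i.succ fun e => rfl]
  simp [posDot, Fin.succ_ne_zero]
  ring

theorem firstVariation_flrw_quadratic_time (hd : 2 ≤ d) (hI : AdmissibleOn I a F) (ht : x 0 ∈ I)
    (hx : InFLRWChart k x) (hdef : L.DefinedAt (flrw k a F) x) (hS : ∀ i j, S i j = S j i) :
    L.firstVariation (flrw k a F)
      (fun y => ((1 / 2) * ((y 0 - x 0) * (y 0 - x 0))) • Matrix.of S) x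
    = - (1 / 2) * L.timeSlope k a F (x 0) * (rho k x * spaceTrace k S x) := by
  rw [L.firstVariation_flrw_quadratic hd hI ht hx hdef hS 0 0 fun b b' => rfl]
  simp [spaceTrace, (Fin.succ_ne_zero _).symm]
  ring

theorem firstVariation_flrw_quadratic_mixed (hd : 2 ≤ d) (hI : AdmissibleOn I a F)
    (ht : x 0 ∈ I) (hx : InFLRWChart k x) (hdef : L.DefinedAt (flrw k a F) x)
    (hS : ∀ i j, S i j = S j i) (i : Fin d) :
    L.firstVariation (flrw k a F)
      (fun y => ((1 / 2) * ((y 0 - x 0) * (y i.succ - x i.succ))) • Matrix.of S) x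
    = (1 / 2) * L.timeSlope k a F (x 0) * (rho k x * shiftVec k S i x) := by
  rw [L.firstVariation_flrw_quadratic hd hI ht hx hdef hS 0 i.succ fun b b' => rfl]
  simp [spaceTrace, (Fin.succ_ne_zero _).symm, Fin.succ_ne_zero]
  ring

theorem firstVariation_flrw_quadratic_space (hd : 2 ≤ d) (hI : AdmissibleOn I a F)
    (ht : x 0 ∈ I) (hx : InFLRWChart k x) (hdef : L.DefinedAt (flrw k a F) x)
    (hS : ∀ i j, S i j = S j i) (i j : Fin d) :
    L.firstVariation (flrw k a F)
      (fun y => ((1 / 2) * ((y i.succ - x i.succ) * (y j.succ - x j.succ))) • Matrix.of S) x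
    = - (1 / 2) * S 0 0 * L.timeSlope k a F (x 0) * (rho k x * spaceInv k i j x)
      + L.spaceSlope k a F (x 0) * (rho k x
        * (spaceRaise k S i j x - spaceInv k i j x * spaceTrace k S x)) := by
  rw [L.firstVariation_flrw_quadratic hd hI ht hx hdef hS i.succ j.succ
    (p₂ := fun b b' => (1 / 2) * ((if i.succ = b then 1 else 0) * (if j.succ = b' then 1 else 0)
        + (if i.succ = b' then 1 else 0) * (if j.succ = b then 1 else 0))) fun b b' => rfl]
  -- The symmetrised pair of Kronecker symbols extracts the (i, j) entry of a symmetric array.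
  have h : ∀ f : Fin d → Fin d → ℝ, (∀ l m, f l m = f m l) → ∑ l : Fin d, ∑ m : Fin d, f l m *
      ((1 / 2) * ((if i = l then 1 else 0) * (if j = m then 1 else 0)
        + (if i = m then 1 else 0) * (if j = l then 1 else 0))) = f i j := by
    intro f hf
    have : ∀ l m, f l m * ((1 / 2) * ((if i = l then 1 else 0) * (if j = m then 1 else 0)
        + (if i = m then 1 else 0) * (if j = l then 1 else 0)))
        = (1 / 2) * (kron i l * (kron j m * f l m)) + (1 / 2) * (kron j l * (kron i m * f l m)) := by
      intro l m; simp only [kron]; ring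
    simp only [this, Finset.sum_add_distrib, ← Finset.mul_sum, sum_kron_mul]
    rw [hf j i]; ring
  simp only [Fin.succ_inj, Fin.succ_ne_zero, if_false, zero_mul, mul_zero, add_zero,
    Finset.sum_const_zero, spaceTrace]
  rw [h (fun l m => spaceRaise k S l m x) fun l m => spaceRaise_comm hS l m x,
    h (fun l m => spaceInv k l m x) fun l m => spaceInv_comm l m]
  ring

end GravityTheory

end FieldEquations

/-! ### The Euler–Lagrange expression -/

section EulerLagrange

variable {d : ℕ} {k : ℝ} {a F : ℝ → ℝ} {I : Set ℝ} {x : Chart d} {t : ℝ}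

theorem differentiableAt_of_contDiffAt {E : Type*} [NormedAddCommGroup E] [NormedSpace ℝ E]
    {f : E → ℝ} {y : E} (hf : ContDiffAt ℝ ∞ f y) : DifferentiableAt ℝ f y :=
  hf.differentiableAt (by simp)

theorem pd_zero_rho_mul {s : Chart d → ℝ} (hx : InFLRWChart k x) (hs : DifferentiableAt ℝ s x)
    (h0 : pd 0 s x = 0) : pd 0 (fun y => rho k y * s y) x = 0 := by
  rw [pd_mul (differentiableAt_rho hx) hs, h0, pd_zero_rho hx]; ring

theorem pd_zero_posQuad (S : Tensor2 d) : pd 0 (posQuad S) x = 0 := by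
  have hr := fun i => differentiableAt_of_contDiff (x := x) (contDiff_posRow (S := S) i)
  have h1 : ∀ i, pd 0 (posRow S i) x = 0 := by
    intro i
    have h : (posRow S i) = fun y : Chart d => ∑ j : Fin d, S i.succ j.succ * y j.succ := rfl
    rw [h, pd_sum fun j _ => (differentiableAt_coord _).const_mul _]
    simp [pd_const_mul (differentiableAt_coord _), pd_zero_coord]
  have h : (posQuad S) = fun y : Chart d => ∑ i : Fin d, y i.succ * posRow S i y := rfl
  rw [h, pd_sum fun i _ => (differentiableAt_coord _).fun_mul (hr i)]
  simp [pd_mul (differentiableAt_coord _) (hr _), pd_zero_coord, h1]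

theorem pd_zero_spaceTrace (S : Tensor2 d) : pd 0 (spaceTrace k S) x = 0 := by
  have hd := differentiableAt_of_contDiff (x := x) (contDiff_posQuad (S := S))
  have h : spaceTrace k S = fun y : Chart d => ∑ i : Fin d, S i.succ i.succ - k * posQuad S y :=
    funext fun y => spaceTrace_eq y
  rw [h, pd_sub (differentiableAt_const _) (hd.const_mul _), pd_const, pd_const_mul hd,
    pd_zero_posQuad]
  ring

theorem pd_zero_shiftPos (S : Tensor2 d) : pd 0 (shiftPos S) x = 0 := by
  have h : (shiftPos S) = fun y : Chart d => ∑ j : Fin d, y j.succ * S 0 j.succ := rfl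
  rw [h, pd_sum fun j _ => (differentiableAt_coord _).mul_const _]
  simp [pd_mul (differentiableAt_coord _) (differentiableAt_const _), pd_const, pd_zero_coord]

theorem pd_zero_shiftVec (S : Tensor2 d) (i : Fin d) : pd 0 (shiftVec k S i) x = 0 := by
  have h : shiftVec k S i = fun y : Chart d => ∑ j : Fin d, spaceInv k i j y * S 0 j.succ := rfl
  rw [h, pd_sum fun j _ => (differentiableAt_spaceInv i j).mul_const _]
  simp [pd_mul (differentiableAt_spaceInv _ _) (differentiableAt_const _), pd_const,
    pd_zero_spaceInv]

namespace GravityTheory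

variable (L : GravityTheory d) {S : Tensor2 d}

/-- The coefficient of `∂_c φ` in the first variation in the direction `φ S`. -/
def linearCoeff (g : MetricField d) (S : Tensor2 d) (c : Fin (d + 1)) (x : Chart d) : ℝ :=
  L.firstVariation g (fun y => (y c - x c) • Matrix.of S) x

/-- The symmetric coefficient of `∂_c ∂_e φ` in the first variation in the direction `φ S`. -/
def quadraticCoeff (g : MetricField d) (S : Tensor2 d) (c e : Fin (d + 1)) (x : Chart d) : ℝ :=
  L.firstVariation g (fun y => ((1 / 2) * ((y c - x c) * (y e - x e))) • Matrix.of S) x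

theorem linearCoeff_zero_eventuallyEq (hd : 2 ≤ d) (hI : AdmissibleOn I a F) (ht : x 0 ∈ I)
    (hx : InFLRWChart k x) (hdef : L.DefinedAt (flrw k a F) x) (hS : ∀ i j, S i j = S j i) :
    L.linearCoeff (flrw k a F) S 0 =ᶠ[𝓝 x] fun y =>
      (L.timeSlope k a F (y 0) * (hubble a (y 0) + lapseRate F (y 0) / 2)
        + (d - 1) * (L.spaceSlope k a F (y 0) * expansion a F (y 0)))
        * (rho k y * spaceTrace k S y)
      - (1 / 2) * d * S 0 0 * (expansion a F (y 0) * L.timeSlope k a F (y 0)) * rho k y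
      - d * k * L.timeSlope k a F (y 0) * (rho k y * shiftPos S y) := by
  filter_upwards [L.eventually_definedAt hI ht hx hdef] with y hy
  exact L.firstVariation_flrw_linear_time hd hI hy.1 hy.2.1 hy.2.2 hS

theorem linearCoeff_succ_eventuallyEq (hd : 2 ≤ d) (hI : AdmissibleOn I a F) (ht : x 0 ∈ I)
    (hx : InFLRWChart k x) (hdef : L.DefinedAt (flrw k a F) x) (hS : ∀ i j, S i j = S j i)
    (i : Fin d) :
    L.linearCoeff (flrw k a F) S i.succ =ᶠ[𝓝 x] fun y =>
      - (L.timeSlope k a F (y 0) * lapseRate F (y 0)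
        + 2 * (d - 1) * (L.spaceSlope k a F (y 0) * expansion a F (y 0)))
        * (rho k y * shiftVec k S i y)
      + (1 / 2) * d * k * S 0 0 * L.timeSlope k a F (y 0) * (rho k y * y i.succ)
      - 2 * (d - 1) * k * L.spaceSlope k a F (y 0)
        * (rho k y * posVec k S i y - (1 / 2) * (rho k y * (y i.succ * spaceTrace k S y))) := by
  filter_upwards [L.eventually_definedAt hI ht hx hdef] with y hy
  exact L.firstVariation_flrw_linear_space hd hI hy.1 hy.2.1 hy.2.2 hS i

theorem quadraticCoeff_zero_zero_eventuallyEq (hd : 2 ≤ d) (hI : AdmissibleOn I a F)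
    (ht : x 0 ∈ I) (hx : InFLRWChart k x) (hdef : L.DefinedAt (flrw k a F) x)
    (hS : ∀ i j, S i j = S j i) :
    L.quadraticCoeff (flrw k a F) S 0 0 =ᶠ[𝓝 x] fun y =>
      - (1 / 2) * (L.timeSlope k a F (y 0) * (rho k y * spaceTrace k S y)) := by
  filter_upwards [L.eventually_definedAt hI ht hx hdef] with y hy
  rw [← mul_assoc]
  exact L.firstVariation_flrw_quadratic_time hd hI hy.1 hy.2.1 hy.2.2 hS

theorem quadraticCoeff_zero_succ_eventuallyEq (hd : 2 ≤ d) (hI : AdmissibleOn I a F)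
    (ht : x 0 ∈ I) (hx : InFLRWChart k x) (hdef : L.DefinedAt (flrw k a F) x)
    (hS : ∀ i j, S i j = S j i) (i : Fin d) :
    L.quadraticCoeff (flrw k a F) S 0 i.succ =ᶠ[𝓝 x] fun y =>
      (1 / 2) * (L.timeSlope k a F (y 0) * (rho k y * shiftVec k S i y)) := by
  filter_upwards [L.eventually_definedAt hI ht hx hdef] with y hy
  rw [← mul_assoc]
  exact L.firstVariation_flrw_quadratic_mixed hd hI hy.1 hy.2.1 hy.2.2 hS i

theorem quadraticCoeff_comm (g : MetricField d) (c e : Fin (d + 1)) :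
    L.quadraticCoeff g S c e = L.quadraticCoeff g S e c := by
  funext y
  simp only [quadraticCoeff, mul_comm (_ - y c) (_ - y e)]

theorem quadraticCoeff_succ_succ_eventuallyEq (hd : 2 ≤ d) (hI : AdmissibleOn I a F)
    (ht : x 0 ∈ I) (hx : InFLRWChart k x) (hdef : L.DefinedAt (flrw k a F) x)
    (hS : ∀ i j, S i j = S j i) (i j : Fin d) :
    L.quadraticCoeff (flrw k a F) S i.succ j.succ =ᶠ[𝓝 x] fun y =>
      - (1 / 2) * S 0 0 * (L.timeSlope k a F (y 0) * (rho k y * spaceInv k i j y))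
      + L.spaceSlope k a F (y 0) * (rho k y
        * (spaceRaise k S i j y - spaceInv k i j y * spaceTrace k S y)) := by
  filter_upwards [L.eventually_definedAt hI ht hx hdef] with y hy
  rw [← mul_assoc]
  exact L.firstVariation_flrw_quadratic_space hd hI hy.1 hy.2.1 hy.2.2 hS i j

theorem contDiffAt_linearCoeff (hd : 2 ≤ d) (hI : AdmissibleOn I a F) (ht : x 0 ∈ I)
    (hx : InFLRWChart k x) (hdef : L.DefinedAt (flrw k a F) x) (hS : ∀ i j, S i j = S j i)
    (c : Fin (d + 1)) : ContDiffAt ℝ ∞ (L.linearCoeff (flrw k a F) S c) x := by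
  have hp := (L.definedAt_flrw_iff_mem hI ht hx).1 hdef
  have hα := contDiffAt_time (L.contDiffAt_timeSlope hI ht hp)
  have hδ := contDiffAt_time (L.contDiffAt_spaceSlope hI ht hp)
  have hH := contDiffAt_time (hI.contDiffAt_hubble ht)
  have hN := contDiffAt_time (hI.contDiffAt_lapseRate ht)
  have hK := contDiffAt_time (hI.contDiffAt_expansion ht)
  have hρ := contDiffAt_rho (m := ∞) hx
  have hσ := (contDiff_spaceTrace (k := k) (S := S) (m := ∞)).contDiffAt (x := x)
  have hw := (contDiff_shiftPos (S := S) (m := ∞)).contDiffAt (x := x)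
  cases c using Fin.cases with
  | zero =>
    refine ContDiffAt.congr_of_eventuallyEq ?_
      (L.linearCoeff_zero_eventuallyEq hd hI ht hx hdef hS)
    exact ((((hα.mul (hH.add (hN.div_const 2))).add (contDiffAt_const.mul (hδ.mul hK))).mul
      (hρ.mul hσ)).sub ((contDiffAt_const.mul (hK.mul hα)).mul hρ)).sub
      ((contDiffAt_const.mul hα).mul (hρ.mul hw))
  | succ i =>
    have hW := (contDiff_shiftVec (k := k) (S := S) (m := ∞) i).contDiffAt (x := x)
    have hV := (contDiff_posVec (k := k) (S := S) (m := ∞) i).contDiffAt (x := x)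
    have hc := (contDiff_coord (m := ∞) i.succ).contDiffAt (x := x)
    refine ContDiffAt.congr_of_eventuallyEq ?_
      (L.linearCoeff_succ_eventuallyEq hd hI ht hx hdef hS i)
    exact ((((hα.mul hN).add (contDiffAt_const.mul (hδ.mul hK))).neg.mul (hρ.mul hW)).add
      ((contDiffAt_const.mul hα).mul (hρ.mul hc))).sub ((contDiffAt_const.mul hδ).mul
      ((hρ.mul hV).sub (contDiffAt_const.mul (hρ.mul (hc.mul hσ)))))

theorem contDiffAt_quadraticCoeff (hd : 2 ≤ d) (hI : AdmissibleOn I a F) (ht : x 0 ∈ I)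
    (hx : InFLRWChart k x) (hdef : L.DefinedAt (flrw k a F) x) (hS : ∀ i j, S i j = S j i)
    (c e : Fin (d + 1)) : ContDiffAt ℝ ∞ (L.quadraticCoeff (flrw k a F) S c e) x := by
  have hp := (L.definedAt_flrw_iff_mem hI ht hx).1 hdef
  have hα := contDiffAt_time (L.contDiffAt_timeSlope hI ht hp)
  have hδ := contDiffAt_time (L.contDiffAt_spaceSlope hI ht hp)
  have hρ := contDiffAt_rho (m := ∞) hx
  have hσ := (contDiff_spaceTrace (k := k) (S := S) (m := ∞)).contDiffAt (x := x)
  have hW := fun i => (contDiff_shiftVec (k := k) (S := S) (m := ∞) i).contDiffAt (x := x)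
  have hmix : ∀ i : Fin d, ContDiffAt ℝ ∞ (L.quadraticCoeff (flrw k a F) S 0 i.succ) x := by
    intro i
    refine ContDiffAt.congr_of_eventuallyEq ?_
      (L.quadraticCoeff_zero_succ_eventuallyEq hd hI ht hx hdef hS i)
    exact contDiffAt_const.mul (hα.mul (hρ.mul (hW i)))
  cases c using Fin.cases with
  | zero =>
    cases e using Fin.cases with
    | zero =>
      refine ContDiffAt.congr_of_eventuallyEq ?_
        (L.quadraticCoeff_zero_zero_eventuallyEq hd hI ht hx hdef hS)
      exact contDiffAt_const.mul (hα.mul (hρ.mul hσ))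
    | succ i => exact hmix i
  | succ i =>
    cases e using Fin.cases with
    | zero => rw [quadraticCoeff_comm]; exact hmix i
    | succ j =>
      have hU := (contDiff_spaceRaise (k := k) (S := S) (m := ∞) i j).contDiffAt (x := x)
      have hγ := (contDiff_spaceInv (k := k) (m := ∞) i j).contDiffAt (x := x)
      refine ContDiffAt.congr_of_eventuallyEq ?_
        (L.quadraticCoeff_succ_succ_eventuallyEq hd hI ht hx hdef hS i j)
      exact (contDiffAt_const.mul (hα.mul (hρ.mul hγ))).add
        (hδ.mul (hρ.mul (hU.sub (hγ.mul hσ))))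

/-- The flux `B^c - ∂_e C^{ce}` whose divergence enters the Euler-Lagrange expression. -/
def flux (g : MetricField d) (S : Tensor2 d) (c : Fin (d + 1)) (x : Chart d) : ℝ :=
  L.linearCoeff g S c x - ∑ e, pd e (L.quadraticCoeff g S c e) x

/-- The divergence of the mixed second-order coefficient is -½ d k α ρ times x^j S_{0j}, which
removes half of that term from the linear coefficient. -/
theorem flux_zero (hd : 2 ≤ d) (hI : AdmissibleOn I a F) (ht : x 0 ∈ I)
    (hx : InFLRWChart k x) (hdef : L.DefinedAt (flrw k a F) x) (hS : ∀ i j, S i j = S j i) :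
    L.flux (flrw k a F) S 0 x
    = (L.timeSlope k a F (x 0) * (hubble a (x 0) + lapseRate F (x 0) / 2)
        + (d - 1) * (L.spaceSlope k a F (x 0) * expansion a F (x 0))
        + (1 / 2) * deriv (L.timeSlope k a F) (x 0)) * (rho k x * spaceTrace k S x)
      - (1 / 2) * d * S 0 0 * (expansion a F (x 0) * L.timeSlope k a F (x 0)) * rho k x
      - (1 / 2) * d * k * L.timeSlope k a F (x 0) * (rho k x * shiftPos S x) := by
  have hp := (L.definedAt_flrw_iff_mem hI ht hx).1 hdef
  have hα := differentiableAt_of_contDiffAt (L.contDiffAt_timeSlope hI ht hp)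
  have hσ := differentiableAt_of_contDiff (x := x) (contDiff_spaceTrace (k := k) (S := S))
  have hρ := differentiableAt_rho hx
  have hW := fun i => differentiableAt_of_contDiff (x := x) (contDiff_shiftVec (k := k) (S := S) i)
  rw [flux, (L.linearCoeff_zero_eventuallyEq hd hI ht hx hdef hS).self_of_nhds, Fin.sum_univ_succ,
    pd_congr (L.quadraticCoeff_zero_zero_eventuallyEq hd hI ht hx hdef hS),
    pd_const_mul ((differentiableAt_time hα).fun_mul (hρ.fun_mul hσ)),
    pd_zero_mul_space hα (hρ.fun_mul hσ), pd_zero_rho_mul hx hσ (pd_zero_spaceTrace S)]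
  have h : ∀ i : Fin d, pd i.succ (L.quadraticCoeff (flrw k a F) S 0 i.succ) x
      = (1 / 2) * L.timeSlope k a F (x 0)
        * pd i.succ (fun y => rho k y * shiftVec k S i y) x := by
    intro i
    rw [pd_congr (L.quadraticCoeff_zero_succ_eventuallyEq hd hI ht hx hdef hS i),
      pd_const_mul ((differentiableAt_time hα).fun_mul (hρ.fun_mul (hW i))),
      pd_succ_mul_space hα (hρ.fun_mul (hW i))]
    ring
  simp only [h, ← Finset.mul_sum, sum_pd_rho_shiftVec hx]
  ring

/-- The divergences of ρ γ⁻¹ and of the raised array cancel the terms S_{00} x^i and x^i tr S of the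
linear coefficient, and halve the term in γ⁻¹ S x. -/
theorem flux_succ (hd : 2 ≤ d) (hI : AdmissibleOn I a F) (ht : x 0 ∈ I)
    (hx : InFLRWChart k x) (hdef : L.DefinedAt (flrw k a F) x) (hS : ∀ i j, S i j = S j i)
    (i : Fin d) :
    L.flux (flrw k a F) S i.succ x
    = - (L.timeSlope k a F (x 0) * lapseRate F (x 0)
        + 2 * (d - 1) * (L.spaceSlope k a F (x 0) * expansion a F (x 0))
        + (1 / 2) * deriv (L.timeSlope k a F) (x 0)) * (rho k x * shiftVec k S i x)
      - k * (d - 1) * L.spaceSlope k a F (x 0) * (rho k x * posVec k S i x) := by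
  have hp := (L.definedAt_flrw_iff_mem hI ht hx).1 hdef
  have hα := differentiableAt_of_contDiffAt (L.contDiffAt_timeSlope hI ht hp)
  have hδ := differentiableAt_of_contDiffAt (L.contDiffAt_spaceSlope hI ht hp)
  have hσ := differentiableAt_of_contDiff (x := x) (contDiff_spaceTrace (k := k) (S := S))
  have hρ := differentiableAt_rho hx
  have hW := differentiableAt_of_contDiff (x := x) (contDiff_shiftVec (k := k) (S := S) i)
  have hγ := fun j => differentiableAt_spaceInv (k := k) (x := x) i j
  have hU := fun j => differentiableAt_of_contDiff (x := x)
    (contDiff_spaceRaise (k := k) (S := S) i j)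
  rw [flux, (L.linearCoeff_succ_eventuallyEq hd hI ht hx hdef hS i).self_of_nhds,
    Fin.sum_univ_succ, quadraticCoeff_comm,
    pd_congr (L.quadraticCoeff_zero_succ_eventuallyEq hd hI ht hx hdef hS i),
    pd_const_mul ((differentiableAt_time hα).fun_mul (hρ.fun_mul hW)),
    pd_zero_mul_space hα (hρ.fun_mul hW), pd_zero_rho_mul hx hW (pd_zero_shiftVec S i)]
  have h : ∀ j : Fin d, pd j.succ (L.quadraticCoeff (flrw k a F) S i.succ j.succ) x
      = - (1 / 2) * S 0 0 * L.timeSlope k a F (x 0)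
        * pd j.succ (fun y => rho k y * spaceInv k j i y) x
        + L.spaceSlope k a F (x 0) * pd j.succ (fun y => rho k y
          * (spaceRaise k S j i y - spaceInv k j i y * spaceTrace k S y)) x := by
    intro j
    have e1 : (fun y => rho k y * spaceInv k j i y) = fun y => rho k y * spaceInv k i j y :=
      funext fun y => by rw [spaceInv_comm]
    have e2 : (fun y => rho k y * (spaceRaise k S j i y - spaceInv k j i y * spaceTrace k S y))
        = fun y => rho k y * (spaceRaise k S i j y - spaceInv k i j y * spaceTrace k S y) :=
      funext fun y => by rw [spaceInv_comm, spaceRaise_comm hS]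
    have d1 := hρ.fun_mul (hγ j)
    have d2 := hρ.fun_mul ((hU j).fun_sub ((hγ j).fun_mul hσ))
    rw [pd_congr (L.quadraticCoeff_succ_succ_eventuallyEq hd hI ht hx hdef hS i j), e1, e2,
      pd_add (((differentiableAt_time hα).fun_mul d1).const_mul _)
        ((differentiableAt_time hδ).fun_mul d2),
      pd_const_mul ((differentiableAt_time hα).fun_mul d1), pd_succ_mul_space hα d1,
      pd_succ_mul_space hδ d2]
    ring
  simp only [h, Finset.sum_add_distrib, ← Finset.mul_sum, sum_pd_rho_spaceInv hx,
    sum_pd_rho_spaceRaise hx hS]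
  ring

/-- The Euler-Lagrange expression contracted with a constant symmetric array. -/
def eulerLagrange (g : MetricField d) (S : Tensor2 d) (x : Chart d) : ℝ :=
  L.firstVariation g (fun _ => Matrix.of S) x - ∑ c, pd c (L.linearCoeff g S c) x
    + ∑ c, ∑ e, pd c (pd e (L.quadraticCoeff g S c e)) x

theorem fieldEquations_eq_eulerLagrange (g : MetricField d) (i j : Fin (d + 1)) (x : Chart d) :
    L.fieldEquations g i j x = L.eulerLagrange g (symUnit i j) x := rfl

/-- The coefficient of the spatial trace in the field equations. -/
def spatialEquation (k : ℝ) (a F : ℝ → ℝ) (t : ℝ) : ℝ :=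
  L.scaleSlope k a F t - L.timeSlope k a F t * hubble a t ^ 2
    + k * (d - 1) * L.spaceSlope k a F t
    - deriv (fun s => L.timeSlope k a F s * (hubble a s + lapseRate F s / 2)
        + (d - 1) * (L.spaceSlope k a F s * expansion a F s)
        + (1 / 2) * deriv (L.timeSlope k a F) s) t

/-- The coefficient of the time component in the field equations. -/
def constraintEquation (k : ℝ) (a F : ℝ → ℝ) (t : ℝ) : ℝ :=
  - L.lapseSlope k a F t + d * L.timeSlope k a F t * lapseRate F t * expansion a F t
    + d * (d - 1) * L.spaceSlope k a F t * expansion a F t ^ 2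
    + (1 / 2) * d * deriv (fun s => expansion a F s * L.timeSlope k a F s) t

/-- Writing A - ∂_c (B^c - ∂_e C^{ce}) allows one divergence at a time, so the cancellations in the
flux occur before the second derivative is taken. -/
theorem eulerLagrange_eq_flux (hd : 2 ≤ d) (hI : AdmissibleOn I a F) (ht : x 0 ∈ I)
    (hx : InFLRWChart k x) (hdef : L.DefinedAt (flrw k a F) x) (hS : ∀ i j, S i j = S j i) :
    L.eulerLagrange (flrw k a F) S x = L.firstVariation (flrw k a F) (fun _ => Matrix.of S) x
      - ∑ c, pd c (L.flux (flrw k a F) S c) x := by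
  have hB := fun c => differentiableAt_of_contDiffAt
    (L.contDiffAt_linearCoeff hd hI ht hx hdef hS c)
  have hC : ∀ c e, DifferentiableAt ℝ (pd e (L.quadraticCoeff (flrw k a F) S c e)) x := fun c e =>
    differentiableAt_of_contDiffAt (contDiffAt_pd
      (L.contDiffAt_quadraticCoeff hd hI ht hx hdef hS c e) (by simp) e)
  have h : ∀ c, pd c (L.flux (flrw k a F) S c) x = pd c (L.linearCoeff (flrw k a F) S c) x
      - ∑ e, pd c (pd e (L.quadraticCoeff (flrw k a F) S c e)) x := by
    intro c
    have : L.flux (flrw k a F) S c = fun y => L.linearCoeff (flrw k a F) S c y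
        - ∑ e, pd e (L.quadraticCoeff (flrw k a F) S c e) y := rfl
    rw [this, pd_sub (hB c) (DifferentiableAt.fun_sum fun e _ => hC c e),
      pd_sum fun e _ => hC c e]
  simp only [h, Finset.sum_sub_distrib, eulerLagrange]
  ring

/-- The field equations on an FLRW background. -/
theorem eulerLagrange_flrw (hd : 2 ≤ d) (hI : AdmissibleOn I a F) (ht : x 0 ∈ I)
    (hx : InFLRWChart k x) (hdef : L.DefinedAt (flrw k a F) x) (hS : ∀ i j, S i j = S j i) :
    L.eulerLagrange (flrw k a F) S x
      = rho k x * spaceTrace k S x * L.spatialEquation k a F (x 0)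
        + rho k x * S 0 0 * L.constraintEquation k a F (x 0) := by
  have hp := (L.definedAt_flrw_iff_mem hI ht hx).1 hdef
  have cα := L.contDiffAt_timeSlope hI ht hp
  have cδ := L.contDiffAt_spaceSlope hI ht hp
  have cH := hI.contDiffAt_hubble ht
  have cN := hI.contDiffAt_lapseRate ht
  have cK := hI.contDiffAt_expansion ht
  have hα := differentiableAt_of_contDiffAt cα
  have hδ := differentiableAt_of_contDiffAt cδ
  have hP : DifferentiableAt ℝ (fun s => L.timeSlope k a F s * (hubble a s + lapseRate F s / 2)
        + (d - 1) * (L.spaceSlope k a F s * expansion a F s)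
        + (1 / 2) * deriv (L.timeSlope k a F) s) (x 0) :=
    differentiableAt_of_contDiffAt (((cα.mul (cH.add (cN.div_const 2))).add
      (contDiffAt_const.mul (cδ.mul cK))).add
      (contDiffAt_const.mul (AdmissibleOn.contDiffAt_deriv cα)))
  have hQ : DifferentiableAt ℝ (fun s => expansion a F s * L.timeSlope k a F s) (x 0) :=
    differentiableAt_of_contDiffAt (cK.mul cα)
  have hR : DifferentiableAt ℝ (fun s => - (L.timeSlope k a F s * lapseRate F s
        + 2 * (d - 1) * (L.spaceSlope k a F s * expansion a F s)
        + (1 / 2) * deriv (L.timeSlope k a F) s)) (x 0) :=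
    differentiableAt_of_contDiffAt (((cα.mul cN).add
      (contDiffAt_const.mul (cδ.mul cK))).add
      (contDiffAt_const.mul (AdmissibleOn.contDiffAt_deriv cα))).neg
  have hρ := differentiableAt_rho hx
  have hσ := differentiableAt_of_contDiff (x := x) (contDiff_spaceTrace (k := k) (S := S))
  have hw := differentiableAt_of_contDiff (x := x) (contDiff_shiftPos (S := S))
  have hW := fun i => differentiableAt_of_contDiff (x := x) (contDiff_shiftVec (k := k) (S := S) i)
  have hV := fun i => differentiableAt_of_contDiff (x := x) (contDiff_posVec (k := k) (S := S) i)
  have h0 : pd 0 (L.flux (flrw k a F) S 0) x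
      = deriv (fun s => L.timeSlope k a F s * (hubble a s + lapseRate F s / 2)
        + (d - 1) * (L.spaceSlope k a F s * expansion a F s)
        + (1 / 2) * deriv (L.timeSlope k a F) s) (x 0) * (rho k x * spaceTrace k S x)
      - (1 / 2) * d * S 0 0 * (deriv (fun s => expansion a F s * L.timeSlope k a F s) (x 0)
        * rho k x)
      - (1 / 2) * d * k * (deriv (L.timeSlope k a F) (x 0) * (rho k x * shiftPos S x)) := by
    -- Time and space dependence are separated, so that each term is a function of time times a
    -- spatial factor with zero time derivative.
    have hev : L.flux (flrw k a F) S 0 =ᶠ[𝓝 x] fun y =>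
        (fun s => L.timeSlope k a F s * (hubble a s + lapseRate F s / 2)
          + (d - 1) * (L.spaceSlope k a F s * expansion a F s)
          + (1 / 2) * deriv (L.timeSlope k a F) s) (y 0) * (rho k y * spaceTrace k S y)
        - (1 / 2) * d * S 0 0 * ((fun s => expansion a F s * L.timeSlope k a F s) (y 0) * rho k y)
        - (1 / 2) * d * k * (L.timeSlope k a F (y 0) * (rho k y * shiftPos S y)) := by
      filter_upwards [L.eventually_definedAt hI ht hx hdef] with y hy
      rw [L.flux_zero hd hI hy.1 hy.2.1 hy.2.2 hS]
      ring
    have d1 := (differentiableAt_time hP).fun_mul (hρ.fun_mul hσ)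
    have d2 := (differentiableAt_time hQ).fun_mul hρ
    have d3 := (differentiableAt_time hα).fun_mul (hρ.fun_mul hw)
    rw [pd_congr hev, pd_sub (d1.fun_sub (d2.const_mul _)) (d3.const_mul _),
      pd_sub d1 (d2.const_mul _), pd_const_mul d2, pd_const_mul d3,
      pd_zero_mul_space hP (hρ.fun_mul hσ), pd_zero_mul_space hQ hρ,
      pd_zero_mul_space hα (hρ.fun_mul hw), pd_zero_rho_mul hx hσ (pd_zero_spaceTrace S),
      pd_zero_rho_mul hx hw (pd_zero_shiftPos S), pd_zero_rho hx]
    ring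
  have h1 : ∀ i : Fin d, pd i.succ (L.flux (flrw k a F) S i.succ) x
      = - (L.timeSlope k a F (x 0) * lapseRate F (x 0)
        + 2 * (d - 1) * (L.spaceSlope k a F (x 0) * expansion a F (x 0))
        + (1 / 2) * deriv (L.timeSlope k a F) (x 0))
          * pd i.succ (fun y => rho k y * shiftVec k S i y) x
      - k * (d - 1) * L.spaceSlope k a F (x 0)
          * pd i.succ (fun y => rho k y * posVec k S i y) x := by
    intro i
    have hev : L.flux (flrw k a F) S i.succ =ᶠ[𝓝 x] fun y =>
        (fun s => - (L.timeSlope k a F s * lapseRate F s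
          + 2 * (d - 1) * (L.spaceSlope k a F s * expansion a F s)
          + (1 / 2) * deriv (L.timeSlope k a F) s)) (y 0) * (rho k y * shiftVec k S i y)
        - k * (d - 1) * (L.spaceSlope k a F (y 0) * (rho k y * posVec k S i y)) := by
      filter_upwards [L.eventually_definedAt hI ht hx hdef] with y hy
      rw [L.flux_succ hd hI hy.1 hy.2.1 hy.2.2 hS]
      ring
    have d1 := (differentiableAt_time hR).fun_mul (hρ.fun_mul (hW i))
    have d2 := (differentiableAt_time hδ).fun_mul (hρ.fun_mul (hV i))
    rw [pd_congr hev, pd_sub d1 (d2.const_mul _), pd_const_mul d2,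
      pd_succ_mul_space hR (hρ.fun_mul (hW i)), pd_succ_mul_space hδ (hρ.fun_mul (hV i))]
    ring
  rw [L.eulerLagrange_eq_flux hd hI ht hx hdef hS, Fin.sum_univ_succ, h0,
    L.firstVariation_flrw_const hd hI ht hx hdef hS]
  -- The mixed components cancel: in units of d k ρ x^j S_{0j} the undifferentiated part gives α N +
  -- 2 (d - 1) δ K, with N = F'/(2F), the time flux gives ½ α', and the space flux gives minus their
  -- sum. The terms in x S x also cancel, leaving k (d - 1) δ tr S.
  simp only [h1, Finset.sum_sub_distrib, ← Finset.mul_sum, sum_pd_rho_shiftVec hx,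
    sum_pd_rho_posVec hx hS, spatialEquation, constraintEquation, normalQuad]
  ring

end GravityTheory

end EulerLagrange

/-! ### Derivatives along curves -/

section Curves

variable {E : Type*} [NormedAddCommGroup E] [NormedSpace ℝ E] {g : E → ℝ} {γ γ₁ γ₂ : ℝ → E} {t : ℝ}

theorem contDiffAt_deriv_curve (hγ : ContDiffAt ℝ ∞ γ t) : ContDiffAt ℝ ∞ (deriv γ) t := by
  have h1 : ContDiffAt ℝ ∞ (fun s => fderiv ℝ γ s 1) t :=
    (hγ.fderiv_right (m := ∞) (by simp)).clm_apply contDiffAt_const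
  exact h1

theorem hasDerivAt_comp_curve (hg : ContDiffAt ℝ ∞ g (γ t)) (hγ : ContDiffAt ℝ ∞ γ t) :
    HasDerivAt (fun s => g (γ s)) (fderiv ℝ g (γ t) (deriv γ t)) t :=
  (differentiableAt_of_contDiffAt hg).hasFDerivAt.comp_hasDerivAt t
    (hγ.differentiableAt (by simp)).hasDerivAt

theorem deriv_deriv_comp_curve (hg : ∀ᶠ q in 𝓝 (γ t), ContDiffAt ℝ ∞ g q)
    (hγ : ∀ᶠ s in 𝓝 t, ContDiffAt ℝ ∞ γ s) :
    deriv (deriv (fun s => g (γ s))) t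
      = fderiv ℝ (fderiv ℝ g) (γ t) (deriv γ t) (deriv γ t)
        + fderiv ℝ g (γ t) (deriv (deriv γ) t) := by
  have hγt := hγ.self_of_nhds
  have hgt := hg.self_of_nhds
  have hev : deriv (fun s => g (γ s)) =ᶠ[𝓝 t] fun s => fderiv ℝ g (γ s) (deriv γ s) := by
    filter_upwards [hγ, hγt.continuousAt.eventually hg] with s h1 h2
    exact (hasDerivAt_comp_curve h2 h1).deriv
  have h1 : HasDerivAt (fun s => fderiv ℝ g (γ s)) (fderiv ℝ (fderiv ℝ g) (γ t) (deriv γ t)) t :=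
    ((hgt.fderiv_right (m := ∞) (by simp)).differentiableAt (by simp)).hasFDerivAt.comp_hasDerivAt
      t (hγt.differentiableAt (by simp)).hasDerivAt
  have h2 : HasDerivAt (deriv γ) (deriv (deriv γ) t) t :=
    ((contDiffAt_deriv_curve hγt).differentiableAt (by simp)).hasDerivAt
  rw [hev.deriv_eq]
  exact (h1.clm_apply h2).deriv

/-- The Hessian term depends only on the position and velocity, which agree, so only the difference
of accelerations survives, linearly. This isolates the highest derivatives of a in α''. -/
theorem deriv_deriv_comp_curve_sub (hg : ∀ᶠ q in 𝓝 (γ₁ t), ContDiffAt ℝ ∞ g q)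
    (h₁ : ∀ᶠ s in 𝓝 t, ContDiffAt ℝ ∞ γ₁ s) (h₂ : ∀ᶠ s in 𝓝 t, ContDiffAt ℝ ∞ γ₂ s)
    (h0 : γ₁ t = γ₂ t) (h1 : deriv γ₁ t = deriv γ₂ t) :
    deriv (deriv (fun s => g (γ₁ s))) t - deriv (deriv (fun s => g (γ₂ s))) t
      = fderiv ℝ g (γ₁ t) (deriv (deriv γ₁) t - deriv (deriv γ₂) t) := by
  rw [deriv_deriv_comp_curve hg h₁, deriv_deriv_comp_curve (h0 ▸ hg) h₂, h0, h1, map_sub]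
  ring

theorem fderiv_fderiv_apply {p : E} (hg : ContDiffAt ℝ ∞ g p) (u v : E) :
    fderiv ℝ (fun q => fderiv ℝ g q u) p v = fderiv ℝ (fderiv ℝ g) p v u := by
  have h1 : DifferentiableAt ℝ (fderiv ℝ g) p :=
    (hg.fderiv_right (m := ∞) (by simp)).differentiableAt (by simp)
  rw [fderiv_clm_apply h1 (differentiableAt_const u)]
  simp

/-- Symmetry of the second derivative; it supplies Λ_XY = Λ_YX in the cancellation of b'''. -/
theorem fderiv_fderiv_comm {p : E} (hg : ContDiffAt ℝ ∞ g p) (u v : E) :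
    fderiv ℝ (fun q => fderiv ℝ g q u) p v = fderiv ℝ (fun q => fderiv ℝ g q v) p u := by
  rw [fderiv_fderiv_apply hg, fderiv_fderiv_apply hg]
  exact ((hg.of_le (m := 2) ENat.LEInfty.out).isSymmSndFDerivAt (by simp)) v u

/-- A directional derivative computed along a curve. -/
theorem fderiv_eq_of_hasDerivAt {p v : E} {D : ℝ} (hg : DifferentiableAt ℝ g p)
    (h : HasDerivAt (fun s : ℝ => g (p + s • v)) D 0) : fderiv ℝ g p v = D := by
  have h1 : HasDerivAt (fun s : ℝ => p + s • v) v 0 := by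
    simpa using ((hasDerivAt_id (0 : ℝ)).smul_const v).const_add p
  have h2 : HasDerivAt (fun s : ℝ => g (p + s • v)) (fderiv ℝ g p v) 0 := by
    refine HasFDerivAt.comp_hasDerivAt (l := g) (0 : ℝ) ?_ h1
    simpa using hg.hasFDerivAt
  exact h2.unique h

end Curves

/-! ### Jets of the squared scale factor and of the lapse -/

section Jets

variable {k : ℝ} {a F a₁ a₂ F₁ F₂ : ℝ → ℝ} {I : Set ℝ} {t : ℝ}

/-- The jet of `a²` and `F` on which the curvature of an FLRW metric depends. -/
def flrwJet (a F : ℝ → ℝ) (t : ℝ) : ℝ × ℝ × ℝ × ℝ × ℝ :=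
  (sqScale a t, deriv (sqScale a) t, deriv (deriv (sqScale a)) t, F t, deriv F t)

/-- The jets `(b, b₁, b₂, f, f₁)` are mapped to the points `(f, b, X, Y)`. -/
def jetMap (k : ℝ) (j : ℝ × ℝ × ℝ × ℝ × ℝ) : ℝ × ℝ × ℝ × ℝ :=
  (j.2.2.2.1, j.1, timeCurv j.1 j.2.1 j.2.2.1 j.2.2.2.1 j.2.2.2.2,
    spaceCurv k j.1 j.2.1 j.2.2.2.1)

theorem jetMap_flrwJet (t : ℝ) : jetMap k (flrwJet a F t) = flrwPoint k a F t := rfl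

theorem contDiffAt_jetMap {j : ℝ × ℝ × ℝ × ℝ × ℝ} (hb : j.1 ≠ 0) (hf : j.2.2.2.1 ≠ 0) :
    ContDiffAt ℝ ∞ (jetMap k) j := by
  have c1 : ContDiffAt ℝ ∞ (fun j : ℝ × ℝ × ℝ × ℝ × ℝ => j.1) j := by fun_prop
  have c2 : ContDiffAt ℝ ∞ (fun j : ℝ × ℝ × ℝ × ℝ × ℝ => j.2.1) j := by fun_prop
  have c3 : ContDiffAt ℝ ∞ (fun j : ℝ × ℝ × ℝ × ℝ × ℝ => j.2.2.1) j := by fun_prop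
  have c4 : ContDiffAt ℝ ∞ (fun j : ℝ × ℝ × ℝ × ℝ × ℝ => j.2.2.2.1) j := by fun_prop
  have c5 : ContDiffAt ℝ ∞ (fun j : ℝ × ℝ × ℝ × ℝ × ℝ => j.2.2.2.2) j := by fun_prop
  refine c4.prodMk (c1.prodMk (ContDiffAt.prodMk ?_ ?_))
  · exact (((c3.neg.div_const 2)).add ((c2.pow 2).div (contDiffAt_const.mul c1)
      (by positivity))).add ((c2.mul c5).div (contDiffAt_const.mul c4) (by positivity))
  · exact (contDiffAt_const.mul c1).add ((c2.pow 2).div (contDiffAt_const.mul c4) (by positivity))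

theorem hasDerivAt_flrwJet (hI : AdmissibleOn I a F) (ht : t ∈ I) :
    HasDerivAt (flrwJet a F) (deriv (sqScale a) t, deriv (deriv (sqScale a)) t,
      deriv (deriv (deriv (sqScale a))) t, deriv F t, deriv (deriv F) t) t := by
  have h : ∀ {f : ℝ → ℝ}, ContDiffAt ℝ ∞ f t → HasDerivAt f (deriv f t) t := fun hf =>
    (differentiableAt_of_contDiffAt hf).hasDerivAt
  have cb := hI.contDiffAt_sqScale ht
  have cF := hI.contDiffAt_lapse ht
  have cb1 := contDiffAt_deriv_curve cb
  exact (h cb).prodMk ((h cb1).prodMk ((h (contDiffAt_deriv_curve cb1)).prodMk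
    ((h cF).prodMk (h (contDiffAt_deriv_curve cF)))))

theorem contDiffAt_flrwJet (hI : AdmissibleOn I a F) (ht : t ∈ I) :
    ContDiffAt ℝ ∞ (flrwJet a F) t := by
  have cb := hI.contDiffAt_sqScale ht
  have cF := hI.contDiffAt_lapse ht
  have cb1 := contDiffAt_deriv_curve cb
  exact cb.prodMk (cb1.prodMk ((contDiffAt_deriv_curve cb1).prodMk
    (cF.prodMk (contDiffAt_deriv_curve cF))))

theorem AdmissibleOn.deriv_sqScale (hI : AdmissibleOn I a F) (ht : t ∈ I) :
    deriv (sqScale a) t = 2 * a t * deriv a t := by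
  have ca := hI.contDiffOn_scale.contDiffAt (hI.isOpen.mem_nhds ht)
  have := ((differentiableAt_of_contDiffAt ca).hasDerivAt.fun_pow 2).deriv
  rw [show sqScale a = fun s => a s ^ 2 from rfl, this]
  simp

theorem AdmissibleOn.deriv_deriv_sqScale (hI : AdmissibleOn I a F) (ht : t ∈ I) :
    deriv (deriv (sqScale a)) t = 2 * (deriv a t ^ 2 + a t * deriv (deriv a) t) := by
  have ca := hI.contDiffOn_scale.contDiffAt (hI.isOpen.mem_nhds ht)
  have hev : deriv (sqScale a) =ᶠ[𝓝 t] fun s => 2 * a s * deriv a s := by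
    filter_upwards [hI.isOpen.mem_nhds ht] with s hs
    exact hI.deriv_sqScale hs
  have h := (((differentiableAt_of_contDiffAt ca).hasDerivAt.const_mul 2).fun_mul
    (differentiableAt_of_contDiffAt (contDiffAt_deriv_curve ca)).hasDerivAt).deriv
  rw [hev.deriv_eq, h]; ring

theorem AdmissibleOn.deriv_lapseRate (hI : AdmissibleOn I a F) (ht : t ∈ I) :
    deriv (lapseRate F) t = deriv (deriv F) t / (2 * F t) - deriv F t ^ 2 / (2 * F t ^ 2) := by
  have hF := hI.contDiffAt_lapse ht
  have hp := hI.lapse_pos t ht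
  have := (differentiableAt_of_contDiffAt (contDiffAt_deriv_curve hF)).hasDerivAt.fun_div
    ((differentiableAt_of_contDiffAt hF).hasDerivAt.const_mul 2) (by positivity)
  refine this.deriv.trans ?_
  field_simp

theorem SameTwoJet.deriv_deriv {f₁ f₂ : ℝ → ℝ} (h : SameTwoJet f₁ f₂ t) :
    deriv (deriv f₁) t = deriv (deriv f₂) t := by
  have := h.2.2
  simpa only [iteratedDeriv_succ, iteratedDeriv_zero] using this

theorem flrwJet_eq_of_sameTwoJet (h₁ : AdmissibleOn I a₁ F₁) (h₂ : AdmissibleOn I a₂ F₂)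
    (ht : t ∈ I) (ha : SameTwoJet a₁ a₂ t) (hF : SameTwoJet F₁ F₂ t) :
    flrwJet a₁ F₁ t = flrwJet a₂ F₂ t := by
  simp only [flrwJet, h₁.deriv_sqScale ht, h₂.deriv_sqScale ht, h₁.deriv_deriv_sqScale ht,
    h₂.deriv_deriv_sqScale ht, sqScale, ha.1, ha.2.1, ha.deriv_deriv, hF.1, hF.2.1]

end Jets

/-! ### The order of the field equations -/

section Order

variable {d : ℕ} {k : ℝ} {a F a₁ a₂ F₁ F₂ : ℝ → ℝ} {I : Set ℝ} {t : ℝ}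

theorem hubble_eq_of_flrwJet_eq (hj : flrwJet a₁ F₁ t = flrwJet a₂ F₂ t) :
    hubble a₁ t = hubble a₂ t ∧ lapseRate F₁ t = lapseRate F₂ t
      ∧ expansion a₁ F₁ t = expansion a₂ F₂ t := by
  simp only [flrwJet, Prod.mk.injEq] at hj
  obtain ⟨h1, h2, h3, h4, h5⟩ := hj
  simp only [hubble, lapseRate, expansion, h1, h2, h3, h4, h5, and_self]

theorem deriv_hubble_eq_of_flrwJet_eq (h₁ : AdmissibleOn I a₁ F₁) (h₂ : AdmissibleOn I a₂ F₂)
    (ht : t ∈ I) (hj : flrwJet a₁ F₁ t = flrwJet a₂ F₂ t)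
    (hF : deriv (deriv F₁) t = deriv (deriv F₂) t) :
    deriv (hubble a₁) t = deriv (hubble a₂) t ∧ deriv (lapseRate F₁) t = deriv (lapseRate F₂) t
      ∧ deriv (expansion a₁ F₁) t = deriv (expansion a₂ F₂) t := by
  simp only [flrwJet, Prod.mk.injEq] at hj
  obtain ⟨h1, h2, h3, h4, h5⟩ := hj
  simp only [h₁.deriv_hubble ht, h₂.deriv_hubble ht, h₁.deriv_lapseRate ht, h₂.deriv_lapseRate ht,
    h₁.deriv_expansion ht, h₂.deriv_expansion ht, h1, h2, h3, h4, h5, hF, and_self]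

namespace GravityTheory

variable (L : GravityTheory d)

theorem spatialEquation_eq (hI : AdmissibleOn I a F) (ht : t ∈ I)
    (hp : flrwPoint k a F t ∈ L.reducedDomain) :
    L.spatialEquation k a F t = L.scaleSlope k a F t - L.timeSlope k a F t * hubble a t ^ 2
      + k * (d - 1) * L.spaceSlope k a F t
      - (deriv (L.timeSlope k a F) t * (hubble a t + lapseRate F t / 2)
        + L.timeSlope k a F t * (deriv (hubble a) t + deriv (lapseRate F) t / 2)
        + (d - 1) * (deriv (L.spaceSlope k a F) t * expansion a F t
          + L.spaceSlope k a F t * deriv (expansion a F) t)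
        + (1 / 2) * deriv (deriv (L.timeSlope k a F)) t) := by
  have cα := L.contDiffAt_timeSlope hI ht hp
  have hα := (differentiableAt_of_contDiffAt cα).hasDerivAt
  have hTimeSlope := (differentiableAt_of_contDiffAt (contDiffAt_deriv_curve cα)).hasDerivAt
  have hδ := (differentiableAt_of_contDiffAt (L.contDiffAt_spaceSlope hI ht hp)).hasDerivAt
  have hH := (differentiableAt_of_contDiffAt (hI.contDiffAt_hubble ht)).hasDerivAt
  have hN := (differentiableAt_of_contDiffAt (hI.contDiffAt_lapseRate ht)).hasDerivAt
  have hK := (differentiableAt_of_contDiffAt (hI.contDiffAt_expansion ht)).hasDerivAt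
  have h := (((hα.fun_mul (hH.fun_add (hN.div_const 2))).fun_add
    ((hδ.fun_mul hK).const_mul (d - 1 : ℝ))).fun_add (hTimeSlope.const_mul (1 / 2))).deriv
  rw [spatialEquation, h]

theorem constraintEquation_eq (hI : AdmissibleOn I a F) (ht : t ∈ I)
    (hp : flrwPoint k a F t ∈ L.reducedDomain) :
    L.constraintEquation k a F t = - L.lapseSlope k a F t
      + d * L.timeSlope k a F t * lapseRate F t * expansion a F t
      + d * (d - 1) * L.spaceSlope k a F t * expansion a F t ^ 2
      + (1 / 2) * d * (deriv (expansion a F) t * L.timeSlope k a F t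
        + expansion a F t * deriv (L.timeSlope k a F) t) := by
  have hα := (differentiableAt_of_contDiffAt (L.contDiffAt_timeSlope hI ht hp)).hasDerivAt
  have hK := (differentiableAt_of_contDiffAt (hI.contDiffAt_expansion ht)).hasDerivAt
  rw [constraintEquation, (hK.fun_mul hα).deriv]

theorem slopes_eq_of_flrwJet_eq (hj : flrwJet a₁ F₁ t = flrwJet a₂ F₂ t) :
    L.lapseSlope k a₁ F₁ t = L.lapseSlope k a₂ F₂ t
      ∧ L.scaleSlope k a₁ F₁ t = L.scaleSlope k a₂ F₂ t
      ∧ L.timeSlope k a₁ F₁ t = L.timeSlope k a₂ F₂ t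
      ∧ L.spaceSlope k a₁ F₁ t = L.spaceSlope k a₂ F₂ t := by
  have : flrwPoint k a₁ F₁ t = flrwPoint k a₂ F₂ t := by
    rw [← jetMap_flrwJet, hj, jetMap_flrwJet]
  simp only [lapseSlope, scaleSlope, timeSlope, spaceSlope, this, and_self]

/-- Apart from α', assumed equal, every term except δ' and α'' depends on the 2-jets only. -/
theorem spatialEquation_sub (h₁ : AdmissibleOn I a₁ F₁) (h₂ : AdmissibleOn I a₂ F₂)
    (ht : t ∈ I) (hj : flrwJet a₁ F₁ t = flrwJet a₂ F₂ t)
    (hF : deriv (deriv F₁) t = deriv (deriv F₂) t)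
    (hp : flrwPoint k a₁ F₁ t ∈ L.reducedDomain)
    (hα : deriv (L.timeSlope k a₁ F₁) t = deriv (L.timeSlope k a₂ F₂) t) :
    L.spatialEquation k a₁ F₁ t - L.spatialEquation k a₂ F₂ t
      = - ((d - 1) * expansion a₁ F₁ t
        * (deriv (L.spaceSlope k a₁ F₁) t - deriv (L.spaceSlope k a₂ F₂) t)
        + (1 / 2) * (deriv (deriv (L.timeSlope k a₁ F₁)) t
          - deriv (deriv (L.timeSlope k a₂ F₂)) t)) := by
  have hp₂ : flrwPoint k a₂ F₂ t ∈ L.reducedDomain := by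
    rwa [← jetMap_flrwJet, ← hj, jetMap_flrwJet]
  obtain ⟨e1, e2, e3⟩ := hubble_eq_of_flrwJet_eq hj
  obtain ⟨e4, e5, e6⟩ := deriv_hubble_eq_of_flrwJet_eq h₁ h₂ ht hj hF
  obtain ⟨-, e7, e8, e9⟩ := L.slopes_eq_of_flrwJet_eq (k := k) hj
  rw [L.spatialEquation_eq h₁ ht hp, L.spatialEquation_eq h₂ ht hp₂, e1, e2, e3, e4, e5, e6, e7, e8,
    e9, hα]
  ring

/-- The constraint contains no derivative of a slope beyond α', so it is of second order as soon as
α' is. -/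
theorem constraintEquation_congr (h₁ : AdmissibleOn I a₁ F₁) (h₂ : AdmissibleOn I a₂ F₂)
    (ht : t ∈ I) (hj : flrwJet a₁ F₁ t = flrwJet a₂ F₂ t)
    (hF : deriv (deriv F₁) t = deriv (deriv F₂) t)
    (hp : flrwPoint k a₁ F₁ t ∈ L.reducedDomain)
    (hα : deriv (L.timeSlope k a₁ F₁) t = deriv (L.timeSlope k a₂ F₂) t) :
    L.constraintEquation k a₁ F₁ t = L.constraintEquation k a₂ F₂ t := by
  have hp₂ : flrwPoint k a₂ F₂ t ∈ L.reducedDomain := by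
    rwa [← jetMap_flrwJet, ← hj, jetMap_flrwJet]
  obtain ⟨e1, e2, e3⟩ := hubble_eq_of_flrwJet_eq hj
  obtain ⟨e4, e5, e6⟩ := deriv_hubble_eq_of_flrwJet_eq h₁ h₂ ht hj hF
  obtain ⟨e0, e7, e8, e9⟩ := L.slopes_eq_of_flrwJet_eq (k := k) hj
  rw [L.constraintEquation_eq h₁ ht hp, L.constraintEquation_eq h₂ ht hp₂, e0, e2, e3, e6, e8,
    e9, hα]

/-- A derivative of the reduced density as a function of the jet. -/
def jetSlope (k : ℝ) (u : ℝ × ℝ × ℝ × ℝ) (c : ℝ) (j : ℝ × ℝ × ℝ × ℝ × ℝ) : ℝ :=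
  fderiv ℝ L.reducedDensity (jetMap k j) u / c

theorem contDiffAt_fderiv_reducedDensity {p : ℝ × ℝ × ℝ × ℝ} (hp : p ∈ L.reducedDomain)
    (u : ℝ × ℝ × ℝ × ℝ) : ContDiffAt ℝ ∞ (fun q => fderiv ℝ L.reducedDensity q u) p :=
  ((L.contDiffAt_reducedDensity_of_mem hp).fderiv_right (m := ∞) (by simp)).clm_apply
    contDiffAt_const

theorem contDiffAt_jetSlope {j : ℝ × ℝ × ℝ × ℝ × ℝ} (hj : jetMap k j ∈ L.reducedDomain)
    (u : ℝ × ℝ × ℝ × ℝ) (c : ℝ) : ContDiffAt ℝ ∞ (L.jetSlope k u c) j :=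
  (ContDiffAt.comp (g := fun q => fderiv ℝ L.reducedDensity q u) j
    (L.contDiffAt_fderiv_reducedDensity hj u)
    (contDiffAt_jetMap hj.2.1.ne' hj.1.ne')).div_const c

theorem eventually_contDiffAt_jetSlope {j : ℝ × ℝ × ℝ × ℝ × ℝ}
    (hj : jetMap k j ∈ L.reducedDomain) (u : ℝ × ℝ × ℝ × ℝ) (c : ℝ) :
    ∀ᶠ q in 𝓝 j, ContDiffAt ℝ ∞ (L.jetSlope k u c) q := by
  filter_upwards [(contDiffAt_jetMap hj.2.1.ne' hj.1.ne').continuousAt.eventually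
    (L.eventually_mem_reducedDomain hj)] with q hq
  exact L.contDiffAt_jetSlope hq u c

/-- Among the four arguments of Λ only X contains b'', affinely with coefficient -½. -/
theorem fderiv_jetSlope {j : ℝ × ℝ × ℝ × ℝ × ℝ} (hj : jetMap k j ∈ L.reducedDomain)
    (u : ℝ × ℝ × ℝ × ℝ) (c r : ℝ) :
    fderiv ℝ (L.jetSlope k u c) j (0, 0, r, 0, 0)
      = - r / 2 * fderiv ℝ (fun q => fderiv ℝ L.reducedDensity q u) (jetMap k j) (0, 0, 1, 0)
        / c := by
  refine fderiv_eq_of_hasDerivAt (differentiableAt_of_contDiffAt (L.contDiffAt_jetSlope hj u c)) ?_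
  have hline : HasDerivAt (fun s : ℝ => jetMap k (j + s • ((0, 0, r, 0, 0) : ℝ × ℝ × ℝ × ℝ × ℝ)))
      ((- r / 2) • ((0, 0, 1, 0) : ℝ × ℝ × ℝ × ℝ)) 0 := by
    have e : (fun s : ℝ => jetMap k (j + s • ((0, 0, r, 0, 0) : ℝ × ℝ × ℝ × ℝ × ℝ)))
        = fun s : ℝ => jetMap k j + s • ((- r / 2) • ((0, 0, 1, 0) : ℝ × ℝ × ℝ × ℝ)) := by
      funext s
      simp only [jetMap, timeCurv, Prod.smul_mk, smul_eq_mul, mul_zero, Prod.fst_add, Prod.snd_add,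
        add_zero, Prod.mk_add_mk, mul_one]
      congr 3
      ring
    rw [e]
    exact (((hasDerivAt_id (0 : ℝ)).smul_const _).const_add (jetMap k j)).congr_deriv (one_smul ℝ _)
  have h := HasFDerivAt.comp_hasDerivAt (l := fun q => fderiv ℝ L.reducedDensity q u) (0 : ℝ)
    (by
      simp only [zero_smul, add_zero]
      exact (differentiableAt_of_contDiffAt
        (L.contDiffAt_fderiv_reducedDensity hj u)).hasFDerivAt) hline
  refine (h.div_const c).congr_deriv ?_
  rw [map_smul, smul_eq_mul]

theorem deriv_jetSlope (hI : AdmissibleOn I a F) (ht : t ∈ I)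
    (hp : flrwPoint k a F t ∈ L.reducedDomain) (u : ℝ × ℝ × ℝ × ℝ) (c : ℝ) :
    deriv (fun s => L.jetSlope k u c (flrwJet a F s)) t
      = fderiv ℝ (L.jetSlope k u c) (flrwJet a F t) (deriv (flrwJet a F) t) :=
  (hasDerivAt_comp_curve (L.contDiffAt_jetSlope (j := flrwJet a F t) hp u c) (contDiffAt_flrwJet hI ht)).deriv

theorem timeSlope_eq_jetSlope : L.timeSlope k a F
    = fun s => L.jetSlope k (0, 0, 1, 0) d (flrwJet a F s) := rfl

theorem spaceSlope_eq_jetSlope : L.spaceSlope k a F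
    = fun s => L.jetSlope k (0, 0, 0, 1) (d * (d - 1)) (flrwJet a F s) := rfl

/-- The second derivative of the reduced density with respect to the coefficient of `R_{titj}`. -/
def curvHessian (p : ℝ × ℝ × ℝ × ℝ) : ℝ :=
  fderiv ℝ (fun q => fderiv ℝ L.reducedDensity q (0, 0, 1, 0)) p (0, 0, 1, 0)

/-- Two FLRW metrics that agree to third order. -/
theorem spatialEquation_sub_of_threeJet (h₁ : AdmissibleOn I a₁ F₁) (h₂ : AdmissibleOn I a₂ F₂)
    (ht : t ∈ I) (hj : flrwJet a₁ F₁ t = flrwJet a₂ F₂ t)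
    (hj' : deriv (flrwJet a₁ F₁) t = deriv (flrwJet a₂ F₂) t) {r : ℝ}
    (hj'' : deriv (deriv (flrwJet a₁ F₁)) t - deriv (deriv (flrwJet a₂ F₂)) t = (0, 0, r, 0, 0))
    (hp : flrwPoint k a₁ F₁ t ∈ L.reducedDomain) :
    L.spatialEquation k a₁ F₁ t - L.spatialEquation k a₂ F₂ t
      = r / (4 * d) * L.curvHessian (flrwPoint k a₁ F₁ t) := by
  have hp₂ : flrwPoint k a₂ F₂ t ∈ L.reducedDomain := by
    rwa [← jetMap_flrwJet, ← hj, jetMap_flrwJet]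
  have hF : deriv (deriv F₁) t = deriv (deriv F₂) t := by
    have := hj'
    rw [(hasDerivAt_flrwJet h₁ ht).deriv, (hasDerivAt_flrwJet h₂ ht).deriv] at this
    simp only [Prod.mk.injEq] at this
    exact this.2.2.2.2
  have hα : deriv (L.timeSlope k a₁ F₁) t = deriv (L.timeSlope k a₂ F₂) t := by
    rw [timeSlope_eq_jetSlope, timeSlope_eq_jetSlope, L.deriv_jetSlope h₁ ht hp,
      L.deriv_jetSlope h₂ ht hp₂, hj, hj']
  have hδ : deriv (L.spaceSlope k a₁ F₁) t = deriv (L.spaceSlope k a₂ F₂) t := by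
    rw [spaceSlope_eq_jetSlope, spaceSlope_eq_jetSlope, L.deriv_jetSlope h₁ ht hp,
      L.deriv_jetSlope h₂ ht hp₂, hj, hj']
  have hev : ∀ {a F : ℝ → ℝ}, AdmissibleOn I a F → ∀ᶠ s in 𝓝 t, ContDiffAt ℝ ∞ (flrwJet a F) s := by
    intro a F h
    filter_upwards [h.isOpen.mem_nhds ht] with s hs
    exact contDiffAt_flrwJet h hs
  -- α' and δ' agree because they involve only first derivatives of the jet; α'' is the only place
  -- where the fourth derivative of a² enters.
  have h2 := deriv_deriv_comp_curve_sub (L.eventually_contDiffAt_jetSlope (k := k)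
    (j := flrwJet a₁ F₁ t) hp (0, 0, 1, 0) d) (hev h₁) (hev h₂) hj hj'
  rw [hj'', L.fderiv_jetSlope (j := flrwJet a₁ F₁ t) hp] at h2
  rw [L.spatialEquation_sub h₁ h₂ ht hj hF hp hα, hδ, timeSlope_eq_jetSlope, timeSlope_eq_jetSlope,
    h2, curvHessian, jetMap_flrwJet]
  ring

end GravityTheory

end Order

/-! ### Vanishing Hessian and cancellation of third derivatives -/

section Frozen

variable {d : ℕ} {k : ℝ} {a F a₁ a₂ F₁ F₂ : ℝ → ℝ} {I : Set ℝ} {t : ℝ}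

/-- The part of the jet on which the spatial curvature depends. -/
def shortJet (a F : ℝ → ℝ) (t : ℝ) : ℝ × ℝ × ℝ := (sqScale a t, deriv (sqScale a) t, F t)

/-- The point `(f, b, X, Y)` with a given coefficient `X` of `R_{titj}`. -/
def frozenMap (k X : ℝ) (j : ℝ × ℝ × ℝ) : ℝ × ℝ × ℝ × ℝ :=
  (j.2.2, j.1, X, spaceCurv k j.1 j.2.1 j.2.2)

theorem contDiffAt_frozenMap {X : ℝ} {j : ℝ × ℝ × ℝ} (hf : j.2.2 ≠ 0) :
    ContDiffAt ℝ ∞ (frozenMap k X) j := by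
  have c1 : ContDiffAt ℝ ∞ (fun j : ℝ × ℝ × ℝ => j.1) j := by fun_prop
  have c2 : ContDiffAt ℝ ∞ (fun j : ℝ × ℝ × ℝ => j.2.1) j := by fun_prop
  have c3 : ContDiffAt ℝ ∞ (fun j : ℝ × ℝ × ℝ => j.2.2) j := by fun_prop
  exact c3.prodMk (c1.prodMk (contDiffAt_const.prodMk ((contDiffAt_const.mul c1).add
    ((c2.pow 2).div (contDiffAt_const.mul c3) (by positivity)))))

theorem hasDerivAt_shortJet (hI : AdmissibleOn I a F) (ht : t ∈ I) :
    HasDerivAt (shortJet a F) (deriv (sqScale a) t, deriv (deriv (sqScale a)) t, deriv F t) t := by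
  have h : ∀ {f : ℝ → ℝ}, ContDiffAt ℝ ∞ f t → HasDerivAt f (deriv f t) t := fun hf =>
    (differentiableAt_of_contDiffAt hf).hasDerivAt
  have cb := hI.contDiffAt_sqScale ht
  exact (h cb).prodMk ((h (contDiffAt_deriv_curve cb)).prodMk (h (hI.contDiffAt_lapse ht)))

theorem contDiffAt_shortJet (hI : AdmissibleOn I a F) (ht : t ∈ I) :
    ContDiffAt ℝ ∞ (shortJet a F) t := by
  have cb := hI.contDiffAt_sqScale ht
  exact cb.prodMk ((contDiffAt_deriv_curve cb).prodMk (hI.contDiffAt_lapse ht))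

theorem deriv_deriv_shortJet (hI : AdmissibleOn I a F) (ht : t ∈ I) :
    deriv (deriv (shortJet a F)) t = (deriv (deriv (sqScale a)) t,
      deriv (deriv (deriv (sqScale a))) t, deriv (deriv F) t) := by
  have hev : deriv (shortJet a F) =ᶠ[𝓝 t] fun s =>
      (deriv (sqScale a) s, deriv (deriv (sqScale a)) s, deriv F s) := by
    filter_upwards [hI.isOpen.mem_nhds ht] with s hs
    exact (hasDerivAt_shortJet hI hs).deriv
  have h : ∀ {f : ℝ → ℝ}, ContDiffAt ℝ ∞ f t → HasDerivAt f (deriv f t) t := fun hf =>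
    (differentiableAt_of_contDiffAt hf).hasDerivAt
  have cb := contDiffAt_deriv_curve (hI.contDiffAt_sqScale ht)
  rw [hev.deriv_eq]
  exact ((h cb).prodMk ((h (contDiffAt_deriv_curve cb)).prodMk
    (h (contDiffAt_deriv_curve (hI.contDiffAt_lapse ht))))).deriv

namespace GravityTheory

variable (L : GravityTheory d)

/-- The derivative of the reduced density with respect to the coefficient of `R_{titj}` at a given
value of this coefficient, divided by the number of spatial dimensions. -/
def frozenSlope (k X : ℝ) (j : ℝ × ℝ × ℝ) : ℝ :=
  fderiv ℝ L.reducedDensity (frozenMap k X j) (0, 0, 1, 0) / d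

theorem eventually_contDiffAt_frozenSlope {X : ℝ} {j : ℝ × ℝ × ℝ}
    (hj : frozenMap k X j ∈ L.reducedDomain) :
    ∀ᶠ q in 𝓝 j, ContDiffAt ℝ ∞ (L.frozenSlope k X) q := by
  filter_upwards [(contDiffAt_frozenMap hj.1.ne').continuousAt.eventually
    (L.eventually_mem_reducedDomain hj)] with q hq
  exact (ContDiffAt.comp (g := fun q => fderiv ℝ L.reducedDensity q (0, 0, 1, 0)) q
    (L.contDiffAt_fderiv_reducedDensity hq _) (contDiffAt_frozenMap hq.1.ne')).div_const _

/-- With X held fixed, b' enters only through Y = k b + b'²/(4f), and ∂Y/∂b' = b'/(2f). -/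
theorem fderiv_frozenSlope {X : ℝ} {j : ℝ × ℝ × ℝ} (hj : frozenMap k X j ∈ L.reducedDomain)
    (r : ℝ) :
    fderiv ℝ (L.frozenSlope k X) j (0, r, 0) = r * (j.2.1 / (2 * j.2.2))
      * fderiv ℝ (fun q => fderiv ℝ L.reducedDensity q (0, 0, 1, 0)) (frozenMap k X j)
        (0, 0, 0, 1) / d := by
  have hf : j.2.2 ≠ 0 := hj.1.ne'
  refine fderiv_eq_of_hasDerivAt (differentiableAt_of_contDiffAt
    (L.eventually_contDiffAt_frozenSlope hj).self_of_nhds) ?_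
  have hline : HasDerivAt (fun s : ℝ => frozenMap k X (j + s • ((0, r, 0) : ℝ × ℝ × ℝ)))
      ((r * (j.2.1 / (2 * j.2.2))) • ((0, 0, 0, 1) : ℝ × ℝ × ℝ × ℝ)) 0 := by
    have e : (fun s : ℝ => frozenMap k X (j + s • ((0, r, 0) : ℝ × ℝ × ℝ)))
        = fun s : ℝ => (j.2.2, j.1, X, k * j.1 + (j.2.1 + s * r) ^ 2 / (4 * j.2.2)) := by
      funext s
      simp [frozenMap, spaceCurv]
    have h1 : HasDerivAt (fun s : ℝ => k * j.1 + (j.2.1 + s * r) ^ 2 / (4 * j.2.2))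
        (r * (j.2.1 / (2 * j.2.2))) 0 := by
      have h := (((((hasDerivAt_id (0 : ℝ)).mul_const r).const_add j.2.1).fun_pow 2).div_const
        (4 * j.2.2)).const_add (k * j.1)
      refine h.congr_deriv ?_
      simp only [id_eq, zero_mul, add_zero]
      field_simp
      norm_num
      ring
    rw [e]
    refine ((hasDerivAt_const _ _).prodMk ((hasDerivAt_const _ _).prodMk
      ((hasDerivAt_const _ _).prodMk h1))).congr_deriv ?_
    simp
  have h := HasFDerivAt.comp_hasDerivAt
    (l := fun q => fderiv ℝ L.reducedDensity q (0, 0, 1, 0)) (0 : ℝ)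
    (by
      simp only [zero_smul, add_zero]
      exact (differentiableAt_of_contDiffAt
        (L.contDiffAt_fderiv_reducedDensity hj _)).hasFDerivAt) hline
  refine (h.div_const _).congr_deriv ?_
  rw [map_smul, smul_eq_mul]

/-- If the Hessian in the direction of `R_{titj}` vanishes, then `R_{titj}` can be frozen in the
slope. -/
theorem timeSlope_eventuallyEq_frozenSlope (hI : AdmissibleOn I a F) (ht : t ∈ I)
    (hp : flrwPoint k a F t ∈ L.reducedDomain)
    (hX : ∀ p ∈ L.reducedDomain, k * p.2.1 ≤ p.2.2.2 → L.curvHessian p = 0) :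
    L.timeSlope k a F =ᶠ[𝓝 t] fun s =>
      L.frozenSlope k (flrwPoint k a F t).2.2.1 (shortJet a F s) := by
  set p₀ := flrwPoint k a F t with hp₀
  -- The product carries the sup distance, so the ball is a box: replacing only the X coordinate by
  -- another in its interval stays in the domain.
  obtain ⟨ε, hε, hball⟩ := Metric.isOpen_iff.1 L.isOpen_reducedDomain p₀ hp
  filter_upwards [hI.isOpen.mem_nhds ht, (contDiffAt_flrwPoint (k := k) hI ht).continuousAt.eventually
    (Metric.ball_mem_nhds p₀ hε)] with s hs hsb
  set p := flrwPoint k a F s with hpd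
  have hdist : ∀ q : ℝ × ℝ × ℝ × ℝ, q ∈ Metric.ball p₀ ε ↔ dist q.1 p₀.1 < ε
      ∧ dist q.2.1 p₀.2.1 < ε ∧ dist q.2.2.1 p₀.2.2.1 < ε ∧ dist q.2.2.2 p₀.2.2.2 < ε := by
    intro q
    rw [Metric.mem_ball, Prod.dist_eq, Prod.dist_eq, Prod.dist_eq, max_lt_iff, max_lt_iff,
      max_lt_iff]
  obtain ⟨m1, m2, m3, m4⟩ := (hdist p).1 hsb
  have hmem : ∀ X ∈ Metric.ball p₀.2.2.1 ε, (p.1, p.2.1, X, p.2.2.2) ∈ L.reducedDomain :=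
    fun X hX' => hball ((hdist _).2 ⟨m1, m2, hX', m4⟩)
  -- Y - k b = b'²/(4F) ≥ 0 on FLRW metrics, and moving X does not affect it, so the Hessian
  -- vanishes along the whole segment.
  have hY : k * p.2.1 ≤ p.2.2.2 := by
    have hF := hI.lapse_pos s hs
    have : 0 ≤ deriv (sqScale a) s ^ 2 / (4 * F s) := by positivity
    simp only [hpd, flrwPoint, spaceCurv]
    linarith
  have hder : ∀ X ∈ Metric.ball p₀.2.2.1 ε, HasDerivAt
      (fun X => fderiv ℝ L.reducedDensity (p.1, p.2.1, X, p.2.2.2) (0, 0, 1, 0)) 0 X := by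
    intro X hX'
    have hm := hmem X hX'
    have h1 : HasDerivAt (fun X : ℝ => ((p.1, p.2.1, X, p.2.2.2) : ℝ × ℝ × ℝ × ℝ)) (0, 0, 1, 0) X :=
      (hasDerivAt_const _ _).prodMk ((hasDerivAt_const _ _).prodMk
        ((hasDerivAt_id _).prodMk (hasDerivAt_const _ _)))
    have h2 := HasFDerivAt.comp_hasDerivAt
      (l := fun q => fderiv ℝ L.reducedDensity q (0, 0, 1, 0)) X
      (differentiableAt_of_contDiffAt (L.contDiffAt_fderiv_reducedDensity hm _)).hasFDerivAt h1
    exact h2.congr_deriv (hX _ hm hY)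
  -- On the interval of X values the slope is constant, so X(s) may be replaced by its value at t.
  have hconst := Metric.isOpen_ball.is_const_of_deriv_eq_zero
    (convex_ball p₀.2.2.1 ε).isPreconnected
    (fun X hX' => (hder X hX').differentiableAt.differentiableWithinAt)
    (fun X hX' => (hder X hX').deriv) m3 (Metric.mem_ball_self hε)
  exact congrArg (fun r => r / (d : ℝ)) hconst

/-- If the Hessian in the direction of `R_{titj}` vanishes, then the field equations are of second
order. -/
theorem equations_eq_of_curvHessian (hd : 2 ≤ d) (h₁ : AdmissibleOn I a₁ F₁)
    (h₂ : AdmissibleOn I a₂ F₂) (ht : t ∈ I) (hj : flrwJet a₁ F₁ t = flrwJet a₂ F₂ t)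
    (hF : deriv (deriv F₁) t = deriv (deriv F₂) t)
    (hp : flrwPoint k a₁ F₁ t ∈ L.reducedDomain)
    (hX : ∀ p ∈ L.reducedDomain, k * p.2.1 ≤ p.2.2.2 → L.curvHessian p = 0) :
    L.spatialEquation k a₁ F₁ t = L.spatialEquation k a₂ F₂ t
      ∧ L.constraintEquation k a₁ F₁ t = L.constraintEquation k a₂ F₂ t := by
  have hpt : flrwPoint k a₁ F₁ t = flrwPoint k a₂ F₂ t := by
    rw [← jetMap_flrwJet, hj, jetMap_flrwJet]
  have hp₂ : flrwPoint k a₂ F₂ t ∈ L.reducedDomain := hpt ▸ hp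
  obtain ⟨j1, j2, j3, j4, j5⟩ : _ ∧ _ ∧ _ ∧ _ ∧ _ := by
    simpa only [flrwJet, Prod.mk.injEq] using hj
  have hs : shortJet a₁ F₁ t = shortJet a₂ F₂ t := by simp only [shortJet, j1, j2, j4]
  have hs' : deriv (shortJet a₁ F₁) t = deriv (shortJet a₂ F₂) t := by
    rw [(hasDerivAt_shortJet h₁ ht).deriv, (hasDerivAt_shortJet h₂ ht).deriv, j2, j3, j5]
  set r := deriv (deriv (deriv (sqScale a₁))) t - deriv (deriv (deriv (sqScale a₂))) t with hr
  -- The short jet contains b' but not b'', so its second derivative reaches only the third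
  -- derivative r of a² and the second derivative of F.
  have hs'' : deriv (deriv (shortJet a₁ F₁)) t - deriv (deriv (shortJet a₂ F₂)) t = (0, r, 0) := by
    rw [deriv_deriv_shortJet h₁ ht, deriv_deriv_shortJet h₂ ht, j3, hF]
    simp [hr]
  set X := (flrwPoint k a₁ F₁ t).2.2.1 with hXdef
  have hfr : frozenMap k X (shortJet a₁ F₁ t) = flrwPoint k a₁ F₁ t := rfl
  have e₁ : L.timeSlope k a₁ F₁ =ᶠ[𝓝 t] fun s => L.frozenSlope k X (shortJet a₁ F₁ s) :=
    L.timeSlope_eventuallyEq_frozenSlope h₁ ht hp hX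
  have e₂ : L.timeSlope k a₂ F₂ =ᶠ[𝓝 t] fun s => L.frozenSlope k X (shortJet a₂ F₂ s) := by
    rw [hXdef, hpt]
    exact L.timeSlope_eventuallyEq_frozenSlope h₂ ht hp₂ hX
  have hsm := L.eventually_contDiffAt_frozenSlope (k := k) (X := X) (j := shortJet a₁ F₁ t) hp
  have hα : deriv (L.timeSlope k a₁ F₁) t = deriv (L.timeSlope k a₂ F₂) t := by
    rw [e₁.deriv_eq, e₂.deriv_eq,
      (hasDerivAt_comp_curve hsm.self_of_nhds (contDiffAt_shortJet h₁ ht)).deriv,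
      (hasDerivAt_comp_curve (hs ▸ hsm.self_of_nhds) (contDiffAt_shortJet h₂ ht)).deriv, hs, hs']
  have hev : ∀ {a F : ℝ → ℝ}, AdmissibleOn I a F → ∀ᶠ s in 𝓝 t, ContDiffAt ℝ ∞ (shortJet a F) s := by
    intro a F h
    filter_upwards [h.isOpen.mem_nhds ht] with s hs
    exact contDiffAt_shortJet h hs
  have hTimeSlope : deriv (deriv (L.timeSlope k a₁ F₁)) t - deriv (deriv (L.timeSlope k a₂ F₂)) t
      = r * expansion a₁ F₁ t * fderiv ℝ (fun q => fderiv ℝ L.reducedDensity q (0, 0, 1, 0))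
        (flrwPoint k a₁ F₁ t) (0, 0, 0, 1) / d := by
    rw [e₁.deriv.deriv_eq, e₂.deriv.deriv_eq,
      deriv_deriv_comp_curve_sub hsm (hev h₁) (hev h₂) hs hs', hs'',
      L.fderiv_frozenSlope (X := X) (j := shortJet a₁ F₁ t) hp]
    rfl
  -- The third derivative enters δ' through X, as -½ Λ_YX; the mixed derivative is then turned into
  -- the one occurring in α''.
  have hδ : deriv (L.spaceSlope k a₁ F₁) t - deriv (L.spaceSlope k a₂ F₂) t
      = - r / 2 * fderiv ℝ (fun q => fderiv ℝ L.reducedDensity q (0, 0, 1, 0))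
        (flrwPoint k a₁ F₁ t) (0, 0, 0, 1) / (d * (d - 1)) := by
    have hjd : deriv (flrwJet a₁ F₁) t - deriv (flrwJet a₂ F₂) t = (0, 0, r, 0, 0) := by
      rw [(hasDerivAt_flrwJet h₁ ht).deriv, (hasDerivAt_flrwJet h₂ ht).deriv, j2, j3, j5, hF]
      simp [hr, Prod.ext_iff]
    rw [spaceSlope_eq_jetSlope, spaceSlope_eq_jetSlope, L.deriv_jetSlope h₁ ht hp,
      L.deriv_jetSlope h₂ ht hp₂, ← hj, ← map_sub, hjd,
      L.fderiv_jetSlope (j := flrwJet a₁ F₁ t) hp, jetMap_flrwJet,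
      fderiv_fderiv_comm (L.contDiffAt_reducedDensity_of_mem hp)]
  refine ⟨?_, L.constraintEquation_congr h₁ h₂ ht hj hF hp hα⟩
  have h := L.spatialEquation_sub h₁ h₂ ht hj hF hp hα
  rw [hTimeSlope, hδ] at h
  have hd' : (2 : ℝ) ≤ d := by exact_mod_cast hd
  have hd0 : (d : ℝ) ≠ 0 := by positivity
  have hd1 : (d : ℝ) - 1 ≠ 0 := by linarith
  -- The contributions (d - 1) K · (-r/2) Λ_XY/(d (d - 1)) and ½ r K Λ_XY/d add to zero.
  rw [← sub_eq_zero, h]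
  field_simp
  ring

end GravityTheory

end Frozen

theorem symUnit_symm {d : ℕ} (i j l m : Fin (d + 1)) : symUnit i j l m = symUnit i j m l := by
  simp only [symUnit, Matrix.smul_apply, Matrix.add_apply, Matrix.single_apply, smul_eq_mul]
  rw [add_comm]
  simp only [and_comm]

/-! ### The reduced Lagrangian -/

section Reduced

variable {d : ℕ} {k : ℝ} {x : Chart d} {t : ℝ}

namespace GravityTheory

variable (L : GravityTheory d)

theorem deriv_deriv_reducedDensity_line {f b Y c s : ℝ} (hp : (f, b, c * s, Y) ∈ L.reducedDomain) :
    deriv (deriv (fun r => L.reducedDensity (f, b, c * r, Y))) s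
      = c ^ 2 * L.curvHessian (f, b, c * s, Y) := by
  have hγ : ∀ r : ℝ, HasDerivAt (fun r : ℝ => ((f, b, c * r, Y) : ℝ × ℝ × ℝ × ℝ))
      (c • ((0, 0, 1, 0) : ℝ × ℝ × ℝ × ℝ)) r := by
    intro r
    refine ((hasDerivAt_const _ _).prodMk ((hasDerivAt_const _ _).prodMk
      (((hasDerivAt_id r).const_mul c).prodMk (hasDerivAt_const _ _)))).congr_deriv ?_
    simp
  have hd : deriv (fun r : ℝ => ((f, b, c * r, Y) : ℝ × ℝ × ℝ × ℝ))
      = fun _ => c • ((0, 0, 1, 0) : ℝ × ℝ × ℝ × ℝ) := funext fun r => (hγ r).deriv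
  have hsm : ∀ r : ℝ, ContDiffAt ℝ ∞ (fun r : ℝ => ((f, b, c * r, Y) : ℝ × ℝ × ℝ × ℝ)) r := by
    intro r
    exact contDiffAt_const.prodMk (contDiffAt_const.prodMk
      ((contDiffAt_const.mul contDiffAt_id).prodMk contDiffAt_const))
  have h := deriv_deriv_comp_curve (γ := fun r : ℝ => ((f, b, c * r, Y) : ℝ × ℝ × ℝ × ℝ)) (t := s)
    ((L.eventually_mem_reducedDomain hp).mono fun q hq => L.contDiffAt_reducedDensity_of_mem hq)
    (Eventually.of_forall hsm)
  rw [h, hd]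
  simp only [deriv_const, map_zero, add_zero, map_smul, smul_apply, smul_eq_mul, curvHessian,
    fderiv_fderiv_apply (L.contDiffAt_reducedDensity_of_mem hp)]
  ring

/-- Rescale time by √f: the Lagrangian is invariant, X becomes X/f, and the factor √f comes from the
volume density. -/
theorem reducedDensity_scale {f b X Y : ℝ} (hp : (f, b, X, Y) ∈ L.reducedDomain) :
    (1, b, f⁻¹ * X, Y) ∈ L.reducedDomain ∧
      L.reducedDensity (f, b, X, Y) = Real.sqrt f * L.reducedDensity (1, b, f⁻¹ * X, Y) := by
  obtain ⟨hf, hb, hp⟩ := hp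
  simp only at hf hb
  obtain ⟨A, hA⟩ := canonical_scale_time (d := d) (Real.sqrt_pos.2 hf).ne' (-f⁻¹) b⁻¹ X Y
  have e : canonical d (Real.sqrt f ^ 2 * -f⁻¹, b⁻¹, (Real.sqrt f)⁻¹ ^ 2 * X, Y)
      = canonicalPoint d (1, b, f⁻¹ * X, Y) := by
    simp only [canonicalPoint]
    rw [inv_pow, Real.sq_sqrt hf.le, mul_neg, mul_inv_cancel₀ hf.ne', inv_one]
  rw [e] at hA
  have hA' : transformMap A (canonicalPoint d (f, b, X, Y))
      = canonicalPoint d (1, b, f⁻¹ * X, Y) := hA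
  refine ⟨⟨one_pos, hb, ?_⟩, ?_⟩
  · rw [← hA']
    exact L.transform_mem_domain A _ _ hp
  · have h : L.lagrangian (canonicalPoint d (1, b, f⁻¹ * X, Y))
        = L.lagrangian (canonicalPoint d (f, b, X, Y)) := by
      rw [← hA']
      exact L.lagrangian_transform A _ _ hp
    simp only [reducedDensity, h, one_mul, Real.sqrt_mul hf.le, mul_assoc]

/-- Differentiating the scaling law twice in X; both sides agree for X in a neighbourhood, by
openness of the domain. -/
theorem curvHessian_scale {f b X Y : ℝ} (hp : (f, b, X, Y) ∈ L.reducedDomain) :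
    L.curvHessian (f, b, X, Y)
      = Real.sqrt f * ((f⁻¹) ^ 2 * L.curvHessian (1, b, f⁻¹ * X, Y)) := by
  have hp' : (f, b, 1 * X, Y) ∈ L.reducedDomain := by rwa [one_mul]
  have h1 := L.deriv_deriv_reducedDensity_line hp'
  rw [one_pow, one_mul, one_mul] at h1
  rw [← h1, ← L.deriv_deriv_reducedDensity_line (L.reducedDensity_scale hp).1]
  have hev : (fun r => L.reducedDensity (f, b, 1 * r, Y)) =ᶠ[𝓝 X]
      fun r => Real.sqrt f * L.reducedDensity (1, b, f⁻¹ * r, Y) := by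
    have hc : ContinuousAt (fun r : ℝ => ((f, b, r, Y) : ℝ × ℝ × ℝ × ℝ)) X := by fun_prop
    filter_upwards [hc.eventually (L.eventually_mem_reducedDomain hp)] with r hr
    rw [one_mul, (L.reducedDensity_scale hr).2]
  rw [hev.deriv.deriv_eq]
  have e1 : deriv (fun r => Real.sqrt f * L.reducedDensity (1, b, f⁻¹ * r, Y))
      = fun r => Real.sqrt f * deriv (fun r => L.reducedDensity (1, b, f⁻¹ * r, Y)) r :=
    funext fun r => deriv_const_mul_field _
  rw [e1, deriv_const_mul_field]

end GravityTheory

/-- The scale factor with a given jet at the time `t`. -/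
def scalePoly (t q q' q'' : ℝ) (s : ℝ) : ℝ := q + q' * (s - t) + q'' / 2 * (s - t) ^ 2

theorem contDiff_scalePoly (t q q' q'' : ℝ) : ContDiff ℝ ∞ (scalePoly t q q' q'') := by
  unfold scalePoly; fun_prop

theorem hasDerivAt_scalePoly (t q q' q'' s : ℝ) :
    HasDerivAt (scalePoly t q q' q'') (q' + q'' * (s - t)) s := by
  have h := (((((hasDerivAt_id s).sub_const t).const_mul q').const_add q).fun_add
    ((((hasDerivAt_id s).sub_const t).fun_pow 2).const_mul (q'' / 2)))
  refine h.congr_deriv ?_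
  simp
  ring

theorem scalePoly_self (t q q' q'' : ℝ) : scalePoly t q q' q'' t = q := by simp [scalePoly]

theorem deriv_scalePoly_self (t q q' q'' : ℝ) : deriv (scalePoly t q q' q'') t = q' := by
  simp [(hasDerivAt_scalePoly t q q' q'' t).deriv]

theorem deriv_deriv_scalePoly_self (t q q' q'' : ℝ) :
    deriv (deriv (scalePoly t q q' q'')) t = q'' := by
  have h : deriv (scalePoly t q q' q'') = fun s => q' + q'' * (s - t) :=
    funext fun s => (hasDerivAt_scalePoly t q q' q'' s).deriv
  rw [h]
  simp

theorem admissibleOn_scalePoly (t q q' q'' : ℝ) :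
    AdmissibleOn {s | 0 < scalePoly t q q' q'' s} (scalePoly t q q' q'') (fun _ => 1) where
  isOpen := isOpen_lt continuous_const (contDiff_scalePoly t q q' q'').continuous
  contDiffOn_scale := (contDiff_scalePoly t q q' q'').contDiffOn
  contDiffOn_lapse := contDiffOn_const
  scale_pos := fun _ hs => hs
  lapse_pos := fun _ _ => one_pos

theorem flrwPoint_scalePoly (k t : ℝ) {q : ℝ} (hq : 0 < q) (q' q'' : ℝ) :
    flrwPoint k (scalePoly t q q' q'') (fun _ => 1) t
      = (1, q ^ 2, - q * q'', q ^ 2 * (k + q' ^ 2)) := by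
  have ht : t ∈ {s | 0 < scalePoly t q q' q'' s} := by
    simpa [scalePoly_self] using hq
  have hI := admissibleOn_scalePoly t q q' q''
  simp only [flrwPoint, hI.deriv_sqScale ht, hI.deriv_deriv_sqScale ht, sqScale, scalePoly_self,
    deriv_scalePoly_self, deriv_deriv_scalePoly_self, timeCurv, spaceCurv, deriv_const]
  refine Prod.ext rfl (Prod.ext rfl (Prod.ext ?_ ?_))
  · simp only []
    field_simp
    ring
  · simp only []
    ring

namespace GravityTheory

variable (L : GravityTheory d)

theorem definedAt_comovingJet_iff (hx : InFLRWChart k x) {q : ℝ} (hq : 0 < q) (q' q'' : ℝ) :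
    L.DefinedAt (comovingJet k (x 0) q q' q'') x
      ↔ (1, q ^ 2, - q * q'', q ^ 2 * (k + q' ^ 2)) ∈ L.reducedDomain := by
  rw [← flrwPoint_scalePoly k (x 0) hq]
  exact L.definedAt_flrw_iff_mem (admissibleOn_scalePoly (x 0) q q' q'')
    (by simpa [scalePoly_self] using hq) hx

theorem reducedLagrangian_eq (hx : InFLRWChart k x) {q : ℝ} (hq : 0 < q) {q' q'' : ℝ}
    (hp : (1, q ^ 2, - q * q'', q ^ 2 * (k + q' ^ 2)) ∈ L.reducedDomain) :
    L.reducedLagrangian k x q q' q'' = (Real.sqrt (1 * (q ^ 2) ^ d))⁻¹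
      * L.reducedDensity (1, q ^ 2, - q * q'', q ^ 2 * (k + q' ^ 2)) := by
  have hpos : 0 < Real.sqrt (1 * (q ^ 2) ^ d) := Real.sqrt_pos.2 (by positivity)
  have h := L.eval_flrw (admissibleOn_scalePoly (x 0) q q' q'')
    (by simpa [scalePoly_self] using hq) hx ((L.definedAt_comovingJet_iff hx hq q' q'').2 hp)
  rw [flrwPoint_scalePoly k (x 0) hq] at h
  rw [reducedDensity, inv_mul_cancel_left₀ hpos.ne']
  exact h

/-- At F = 1 only X = -a ä contains ä, linearly, so the chain rule gives the factor (-a)²; the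
volume factor does not involve ä. -/
theorem iteratedDeriv_reducedLagrangian (hx : InFLRWChart k x) {q : ℝ} (hq : 0 < q) {q' q'' : ℝ}
    (hp : (1, q ^ 2, - q * q'', q ^ 2 * (k + q' ^ 2)) ∈ L.reducedDomain) :
    iteratedDeriv 2 (fun s : ℝ => L.reducedLagrangian k x q q' s) q''
      = (Real.sqrt (1 * (q ^ 2) ^ d))⁻¹ * ((- q) ^ 2
        * L.curvHessian (1, q ^ 2, - q * q'', q ^ 2 * (k + q' ^ 2))) := by
  have hev : (fun s : ℝ => L.reducedLagrangian k x q q' s) =ᶠ[𝓝 q''] fun s =>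
      (Real.sqrt (1 * (q ^ 2) ^ d))⁻¹
        * L.reducedDensity (1, q ^ 2, - q * s, q ^ 2 * (k + q' ^ 2)) := by
    have hc : ContinuousAt (fun r : ℝ => ((1, q ^ 2, - q * r, q ^ 2 * (k + q' ^ 2)) :
      ℝ × ℝ × ℝ × ℝ)) q'' := by fun_prop
    filter_upwards [hc.eventually (L.eventually_mem_reducedDomain hp)] with r hr
    exact L.reducedLagrangian_eq hx hq hr
  simp only [iteratedDeriv_succ, iteratedDeriv_zero]
  rw [hev.deriv.deriv_eq]
  have e1 : ∀ (c : ℝ) (f : ℝ → ℝ), deriv (deriv fun s => c * f s) q''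
      = c * deriv (deriv f) q'' := by
    intro c f
    have : deriv (fun s => c * f s) = fun s => c * deriv f s :=
      funext fun r => deriv_const_mul_field _
    rw [this, deriv_const_mul_field]
  rw [e1, L.deriv_deriv_reducedDensity_line hp]

/-- The prefactors of the Hessian are nonzero, and the condition is independent of the point x, so
it can be tested at the origin of the chart. -/
theorem reducedLagrangianLinear_iff : L.ReducedLagrangianLinear k
    ↔ ∀ q q' q'' : ℝ, 0 < q → (1, q ^ 2, - q * q'', q ^ 2 * (k + q' ^ 2)) ∈ L.reducedDomain →
      L.curvHessian (1, q ^ 2, - q * q'', q ^ 2 * (k + q' ^ 2)) = 0 := by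
  constructor
  · intro h q q' q'' hq hp
    have hx : InFLRWChart k (0 : Chart d) := by simp [InFLRWChart, radiusSq]
    have h1 := h 0 q q' q'' hx hq ((L.definedAt_comovingJet_iff hx hq q' q'').2 hp)
    rw [L.iteratedDeriv_reducedLagrangian hx hq hp] at h1
    have hpos : 0 < Real.sqrt (1 * (q ^ 2) ^ d) := Real.sqrt_pos.2 (by positivity)
    rcases mul_eq_zero.1 h1 with h2 | h2
    · exact absurd h2 (inv_ne_zero hpos.ne')
    · exact (mul_eq_zero.1 h2).resolve_left (pow_ne_zero 2 (neg_ne_zero.2 hq.ne'))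
  · intro h x q q' q'' hx hq hdef
    have hp := (L.definedAt_comovingJet_iff hx hq q' q'').1 hdef
    rw [L.iteratedDeriv_reducedLagrangian hx hq hp, h q q' q'' hq hp]
    ring

/-- After time is rescaled to f = 1, a point is realised by a comoving jet precisely when Y/b - k is
a square ȧ². Points with Y < k b are not realised by any FLRW metric and are not needed. -/
theorem curvHessian_eq_zero_of_linear (h : L.ReducedLagrangianLinear k) {p : ℝ × ℝ × ℝ × ℝ}
    (hp : p ∈ L.reducedDomain) (hY : k * p.2.1 ≤ p.2.2.2) : L.curvHessian p = 0 := by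
  obtain ⟨f, b, X, Y⟩ := p
  have hf : 0 < f := hp.1
  have hb : 0 < b := hp.2.1
  simp only at hY
  have hsb := Real.sqrt_pos.2 hb
  have hq : Real.sqrt b ^ 2 = b := Real.sq_sqrt hb.le
  have hq' : Real.sqrt (Y / b - k) ^ 2 = Y / b - k :=
    Real.sq_sqrt (by rw [sub_nonneg, le_div_iff₀ hb]; exact hY)
  -- The jet solves b = q², X/f = -q q'' and Y = q² (k + q'²): q = √b, q' = √(Y/b - k), q'' =
  -- -(X/f)/√b.
  have e : ((1 : ℝ), Real.sqrt b ^ 2, - Real.sqrt b * (- (f⁻¹ * X) / Real.sqrt b),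
      Real.sqrt b ^ 2 * (k + Real.sqrt (Y / b - k) ^ 2)) = (1, b, f⁻¹ * X, Y) := by
    rw [hq, hq']
    refine Prod.ext rfl (Prod.ext rfl (Prod.ext ?_ ?_))
    · simp only []
      field_simp
    · simp only []
      field_simp
      ring
  have h1 := L.reducedLagrangianLinear_iff.1 h (Real.sqrt b) (Real.sqrt (Y / b - k))
    (- (f⁻¹ * X) / Real.sqrt b) hsb
  rw [e] at h1
  rw [L.curvHessian_scale hp, h1 (L.reducedDensity_scale hp).1]
  ring

theorem hasSecondOrderFLRWEquations_of_linear (hd : 2 ≤ d) (h : L.ReducedLagrangianLinear k) :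
    L.HasSecondOrderFLRWEquations k := by
  intro I a₁ F₁ a₂ F₂ h₁ h₂ x ht hx hdef₁ hdef₂ ha hF i j
  have hj := flrwJet_eq_of_sameTwoJet h₁ h₂ ht ha hF
  have hp := (L.definedAt_flrw_iff_mem h₁ ht hx).1 hdef₁
  obtain ⟨e1, e2⟩ := L.equations_eq_of_curvHessian hd h₁ h₂ ht hj hF.deriv_deriv hp
    fun p hp hY => L.curvHessian_eq_zero_of_linear h hp hY
  have hS := symUnit_symm i j
  rw [fieldEquations_eq_eulerLagrange, fieldEquations_eq_eulerLagrange,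
    L.eulerLagrange_flrw hd h₁ ht hx hdef₁ hS, L.eulerLagrange_flrw hd h₂ ht hx hdef₂ hS, e1, e2]

end GravityTheory

end Reduced

/-! ### Perturbations of the scale factor of fourth order -/

section Perturbation

variable {f u : ℝ → ℝ}

/-- Differentiation preserves the shape f + sⁿ u, lowering n by one and replacing u by another
smooth function, so it can be iterated. -/
theorem deriv_add_pow_mul (hf : ContDiff ℝ ∞ f) (hu : ContDiff ℝ ∞ u) (n : ℕ) :
    deriv (fun s => f s + s ^ (n + 1) * u s)
      = fun s => deriv f s + s ^ n * ((n + 1) * u s + s * deriv u s) := by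
  funext s
  have h1 := (hf.differentiable (by simp) s).hasDerivAt
  have h2 := (hu.differentiable (by simp) s).hasDerivAt
  rw [(h1.fun_add ((hasDerivAt_pow (n + 1) s).fun_mul h2)).deriv]
  push_cast
  ring

theorem contDiff_deriv (hf : ContDiff ℝ ∞ f) : ContDiff ℝ ∞ (deriv f) :=
  contDiff_iff_contDiffAt.2 fun _ => contDiffAt_deriv_curve hf.contDiffAt

/-- Four applications of the previous step; the first three leave a positive power of s, and the
last produces 4 · 3 · 2 · 1 = 24. -/
theorem derivs_add_pow_four_mul (hf : ContDiff ℝ ∞ f) (hu : ContDiff ℝ ∞ u) :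
    deriv (fun s => f s + s ^ 4 * u s) 0 = deriv f 0 ∧
    deriv (deriv (fun s => f s + s ^ 4 * u s)) 0 = deriv (deriv f) 0 ∧
    deriv (deriv (deriv (fun s => f s + s ^ 4 * u s))) 0 = deriv (deriv (deriv f)) 0 ∧
    deriv (deriv (deriv (deriv (fun s => f s + s ^ 4 * u s)))) 0
      = deriv (deriv (deriv (deriv f))) 0 + 24 * u 0 := by
  have step : ∀ {v : ℝ → ℝ} (n : ℕ), ContDiff ℝ ∞ v →
      ContDiff ℝ ∞ fun s => ((n : ℝ) + 1) * v s + s * deriv v s := fun n hv =>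
    (contDiff_const.mul hv).add (contDiff_id.mul (contDiff_deriv hv))
  have hf1 := contDiff_deriv hf
  have hf2 := contDiff_deriv hf1
  have hf3 := contDiff_deriv hf2
  have hu1 := step 3 hu
  have hu2 := step 2 hu1
  have hu3 := step 1 hu2
  have e1 := deriv_add_pow_mul hf hu 3
  have e2 := deriv_add_pow_mul hf1 hu1 2
  have e3 := deriv_add_pow_mul hf2 hu2 1
  have e4 := deriv_add_pow_mul hf3 hu3 0
  simp only [Nat.reduceAdd] at e1 e2 e3 e4
  rw [e1, e2, e3, e4]
  refine ⟨by simp, by simp, by simp, ?_⟩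
  simp only [pow_zero, zero_mul, add_zero]
  push_cast
  ring

end Perturbation

/-! ### Second-order equations force linearity -/

section Necessity

variable {d : ℕ} {k : ℝ} {a F a₁ a₂ F₁ F₂ : ℝ → ℝ} {I : Set ℝ} {t : ℝ}

theorem deriv_deriv_flrwJet (hI : AdmissibleOn I a F) (ht : t ∈ I) :
    deriv (deriv (flrwJet a F)) t = (deriv (deriv (sqScale a)) t,
      deriv (deriv (deriv (sqScale a))) t, deriv (deriv (deriv (deriv (sqScale a)))) t,
      deriv (deriv F) t, deriv (deriv (deriv F)) t) := by
  have hev : deriv (flrwJet a F) =ᶠ[𝓝 t] fun s =>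
      (deriv (sqScale a) s, deriv (deriv (sqScale a)) s, deriv (deriv (deriv (sqScale a))) s,
        deriv F s, deriv (deriv F) s) := by
    filter_upwards [hI.isOpen.mem_nhds ht] with s hs
    exact (hasDerivAt_flrwJet hI hs).deriv
  have h : ∀ {f : ℝ → ℝ}, ContDiffAt ℝ ∞ f t → HasDerivAt f (deriv f t) t := fun hf =>
    (differentiableAt_of_contDiffAt hf).hasDerivAt
  have cb := contDiffAt_deriv_curve (hI.contDiffAt_sqScale ht)
  have cb1 := contDiffAt_deriv_curve cb
  have cF := contDiffAt_deriv_curve (hI.contDiffAt_lapse ht)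
  rw [hev.deriv_eq]
  exact ((h cb).prodMk ((h cb1).prodMk ((h (contDiffAt_deriv_curve cb1)).prodMk
    ((h cF).prodMk (h (contDiffAt_deriv_curve cF)))))).deriv

theorem spaceTrace_origin (S : Tensor2 d) :
    spaceTrace k S 0 = ∑ i : Fin d, S i.succ i.succ := by
  rw [spaceTrace_eq]
  simp [posQuad]

theorem sum_symUnit_succ (i : Fin d) : ∑ l : Fin d, symUnit i.succ i.succ l.succ l.succ = 1 := by
  have h : ∀ l : Fin d, symUnit i.succ i.succ l.succ l.succ = if i = l then 1 else 0 := by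
    intro l
    simp only [symUnit, Matrix.smul_apply, Matrix.add_apply, Matrix.single_apply, Fin.succ_inj,
      and_self, smul_eq_mul]
    split_ifs <;> norm_num
  simp [h]

namespace GravityTheory

variable (L : GravityTheory d)

/-- A diagonal spatial component at the origin of the chart has S_{00} = 0 and unit spatial trace,
so it isolates the spatial equation up to the nonzero factor ρ. -/
theorem spatialEquation_eq_of_secondOrder (hd : 2 ≤ d) (h : L.HasSecondOrderFLRWEquations k)
    (h₁ : AdmissibleOn I a₁ F₁) (h₂ : AdmissibleOn I a₂ F₂) (ht : (0 : ℝ) ∈ I)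
    (ha : SameTwoJet a₁ a₂ 0) (hF : SameTwoJet F₁ F₂ 0)
    (hp : flrwPoint k a₁ F₁ 0 ∈ L.reducedDomain) :
    L.spatialEquation k a₁ F₁ 0 = L.spatialEquation k a₂ F₂ 0 := by
  have hx : InFLRWChart k (0 : Chart d) := by simp [InFLRWChart, radiusSq]
  have hj := flrwJet_eq_of_sameTwoJet h₁ h₂ ht ha hF
  have hp₂ : flrwPoint k a₂ F₂ 0 ∈ L.reducedDomain := by
    rwa [← jetMap_flrwJet, ← hj, jetMap_flrwJet]
  have hdef₁ := (L.definedAt_flrw_iff_mem (x := 0) h₁ ht hx).2 hp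
  have hdef₂ := (L.definedAt_flrw_iff_mem (x := 0) h₂ ht hx).2 hp₂
  have i : Fin d := ⟨0, by omega⟩
  have e := h I a₁ F₁ a₂ F₂ h₁ h₂ 0 ht hx hdef₁ hdef₂ ha hF i.succ i.succ
  have hS := symUnit_symm i.succ i.succ
  have hT : spaceTrace k (symUnit i.succ i.succ) 0 = 1 :=
    (spaceTrace_origin _).trans (sum_symUnit_succ i)
  have h0 : symUnit i.succ i.succ 0 0 = 0 := by simp [symUnit, Matrix.single_apply]
  rw [fieldEquations_eq_eulerLagrange, fieldEquations_eq_eulerLagrange,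
    L.eulerLagrange_flrw hd h₁ ht hx hdef₁ hS, L.eulerLagrange_flrw hd h₂ ht hx hdef₂ hS, h0,
    hT] at e
  simp only [mul_one, mul_zero, zero_mul, add_zero] at e
  exact mul_left_cancel₀ (rho_pos hx).ne' e

/-- Two scale factors that differ by s⁴ have the same 3-jet at 0, so their spatial equations can
differ only by a nonzero multiple of Λ_XX. Second-order equations make this difference vanish. -/
theorem reducedLagrangianLinear_of_secondOrder (hd : 2 ≤ d)
    (h : L.HasSecondOrderFLRWEquations k) : L.ReducedLagrangianLinear k := by
  refine L.reducedLagrangianLinear_iff.2 fun q q' q'' hq hp => ?_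
  rw [← flrwPoint_scalePoly k 0 hq] at hp ⊢
  set a₁ := scalePoly 0 q q' q'' with ha₁
  have c₁ : ContDiff ℝ ∞ a₁ := contDiff_scalePoly 0 q q' q''
  set a₂ : ℝ → ℝ := fun s => a₁ s + s ^ 4 * 1 with ha₂
  have c₂ : ContDiff ℝ ∞ a₂ := by fun_prop
  have hz : a₁ 0 = q := scalePoly_self 0 q q' q''
  have hz₂ : a₂ 0 = q := by simp [ha₂, hz]
  set I : Set ℝ := {s | 0 < a₁ s} ∩ {s | 0 < a₂ s} with hIdef
  have hI : IsOpen I :=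
    (isOpen_lt continuous_const c₁.continuous).inter (isOpen_lt continuous_const c₂.continuous)
  have h₁ : AdmissibleOn I a₁ fun _ => 1 :=
    ⟨hI, c₁.contDiffOn, contDiffOn_const, fun _ hs => hs.1, fun _ _ => one_pos⟩
  have h₂ : AdmissibleOn I a₂ fun _ => 1 :=
    ⟨hI, c₂.contDiffOn, contDiffOn_const, fun _ hs => hs.2, fun _ _ => one_pos⟩
  have ht : (0 : ℝ) ∈ I := ⟨by simpa [hz] using hq, by simpa [hz₂] using hq⟩
  obtain ⟨u1, u2, -, -⟩ := derivs_add_pow_four_mul (u := fun _ => 1) c₁ contDiff_const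
  have ha : SameTwoJet a₁ a₂ 0 := by
    refine ⟨by rw [hz, hz₂], u1.symm, ?_⟩
    simp only [iteratedDeriv_succ, iteratedDeriv_zero]
    exact u2.symm
  have hF : SameTwoJet (fun _ : ℝ => (1 : ℝ)) (fun _ => 1) 0 := ⟨rfl, rfl, rfl⟩
  -- In a² the perturbation has leading coefficient 2q, so its fourth derivative changes by 24 · 2q
  -- = 48q.
  have hsq : sqScale a₂ = fun s => sqScale a₁ s + s ^ 4 * (2 * a₁ s + s ^ 4) := by
    funext s
    simp only [sqScale, ha₂]
    ring
  obtain ⟨v1, v2, v3, v4⟩ := derivs_add_pow_four_mul (f := sqScale a₁)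
    (u := fun s => 2 * a₁ s + s ^ 4) (c₁.pow 2) (by fun_prop)
  rw [← hsq] at v1 v2 v3 v4
  have hj := flrwJet_eq_of_sameTwoJet h₁ h₂ ht ha hF
  have hj' : deriv (flrwJet a₁ fun _ => 1) 0 = deriv (flrwJet a₂ fun _ => 1) 0 := by
    rw [(hasDerivAt_flrwJet h₁ ht).deriv, (hasDerivAt_flrwJet h₂ ht).deriv, v1, v2, v3]
  have hj'' : deriv (deriv (flrwJet a₁ fun _ => 1)) 0 - deriv (deriv (flrwJet a₂ fun _ => 1)) 0
      = (0, 0, - (48 * q), 0, 0) := by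
    rw [deriv_deriv_flrwJet h₁ ht, deriv_deriv_flrwJet h₂ ht, v2, v3, v4, hz]
    simp only [Prod.mk_sub_mk, sub_self]
    refine Prod.ext rfl (Prod.ext rfl (Prod.ext ?_ rfl))
    simp only []
    ring
  have e := L.spatialEquation_sub_of_threeJet h₁ h₂ ht hj hj' hj'' hp
  rw [L.spatialEquation_eq_of_secondOrder hd h h₁ h₂ ht ha hF hp, sub_self] at e
  have hd0 : (d : ℝ) ≠ 0 := by positivity
  exact (mul_eq_zero.1 e.symm).resolve_left
    (div_ne_zero (neg_ne_zero.2 (by positivity)) (by positivity))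

end GravityTheory

end Necessity

end CosmoGravity

end

theorem proposition3 {d : ℕ} (hd : 2 ≤ d) (L : CosmoGravity.GravityTheory d) :
    (L.IsCosmologicalGravity ↔ ∀ k ∈ ({-1, 0, 1} : Set ℝ), L.ReducedLagrangianLinear k) ∧
    (∀ k ∈ ({-1, 0, 1} : Set ℝ),
      (L.HasSecondOrderFLRWEquations k ↔ L.ReducedLagrangianLinear k)) := by
  -- The equivalence holds for every real k, so nothing special to -1, 0, 1 is used.
  have h : ∀ k : ℝ, L.HasSecondOrderFLRWEquations k ↔ L.ReducedLagrangianLinear k := fun k =>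
    ⟨L.reducedLagrangianLinear_of_secondOrder hd, L.hasSecondOrderFLRWEquations_of_linear hd⟩
  exact ⟨forall₂_congr fun k _ => h k, fun k _ => h k⟩
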